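/- **Problem.** Let $m\ge 1$, let $\mathcal A\subset\mathbb R^{d_\alpha}$ be nonempty, closed and convex, and for $i=1,\dots,m$ let $f_i:\mathbb R^{d_x}\times\mathbb R^{d_\alpha}\times\mathbb R^{d_y}\to\mathbb R$ and $g_i:\mathbb R^{d_x}\times\mathbb R^{d_y}\to\mathbb R$. Put $y_i(x)=\arg\min_{y}g_i(x,y)$, $\alpha_i(x)=\arg\max_{\alpha\in\mathcal A}f_i(x,\alpha,y_i(x))$ and $F(x)=\frac1m\sum_{i=1}^m f_i(x,\alpha_i(x),y_i(x))$. Vectors carry the Euclidean norm, matrices the spectral norm. **Assumption 1.** With positive constants $\mu_f,\mu_g,C_f,L_f,L_g,C_{gxy},L_{gxy},L_{gyy}$, for all $i$: (a) $f_i$ is differentiable at the points of $\mathbb R^{d_x}\times\mathcal A\times\mathbb R^{d_y}$, and on that set it is $C_f$-Lipschitz, has $L_f$-Lipschitz gradient, and is $\mu_f$-strongly concave in $\alpha\in\mathcal A$; (b) $g_i$ is twice differentiable, has $L_g$-Lipschitz gradient, and is $\mu_g$-strongly convex in $y$; (c) $\|\nabla^2_{xy}g_i\|\le C_{gxy}$,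 and $\nabla^2_{xy}g_i$, $\nabla^2_{yy}g_i$ are $L_{gxy}$- and $L_{gyy}$-Lipschitz. **Assumption 2.** A data batch $\mathcal B$ of block $i$ of size $b\ge1$ consists of $b$ independent samples $\xi\sim\mathcal P_i$ and, independently of them, $b$ independent samples $\zeta\sim\mathcal Q_i$. The oracles for $\nabla_xf_i,\nabla_\alpha f_i,\nabla_yf_i$ (functions of the point, with $\alpha\in\mathcal A$, and of the $\xi$-samples) and for $\nabla_yg_i,\nabla^2_{xy}g_i,\nabla^2_{yy}g_i$ (functions of the point and of the $\zeta$-samples) are measurable, unbiased, and have variance $\mathbb E\|\cdot\|^2$ at most $\sigma^2/b$, where $\sigma>0$; and the oracle $\nabla^2_{yy}g_i(x,y;\mathcal B)$ is always symmetric and $\succeq\mu_gI$. **Algorithm (single loop).** Start from deterministic $x_0,z_0\in\mathbb R^{d_x}$, $\alpha_i^0\in\mathcal A$, $y_i^0\in\mathbb R^{d_y}$ and symmetric $s_i^0\succeq\mu_gI$. At step $t=0,1,2,\dots$ draw a uniformly random set $I_t$ of $n$ blocks ($1\le n\le m$) and a batch $\mathcal B_i^t$ of size $b$ for each $i\in I_t$,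 all independent of one another and of the past. With $H_i^t=[s_i^t]^{-1}$, for $i\in I_t$ set $$\alpha_i^{t+1}=\Pi_{\mathcal A}[\alpha_i^t+\eta_1\nabla_\alpha f_i(x_t,\alpha_i^t,y_i^t;\mathcal B_i^t)],\quad y_i^{t+1}=y_i^t-\eta_2\nabla_yg_i(x_t,y_i^t;\mathcal B_i^t),\quad s_i^{t+1}=(1-\beta_1)s_i^t+\beta_1\nabla^2_{yy}g_i(x_t,y_i^t;\mathcal B_i^t),$$ and leave $\alpha_i,y_i,s_i$ unchanged for $i\notin I_t$. Then set $$\Delta^{t+1}=\frac1n\sum_{i\in I_t}\bigl\{\nabla_xf_i(x_t,\alpha_i^t,y_i^t;\mathcal B_i^t)-\nabla^2_{xy}g_i(x_t,y_i^t;\mathcal B_i^t)H_i^t\nabla_yf_i(x_t,\alpha_i^t,y_i^t;\mathcal B_i^t)\bigr\},$$ $z_{t+1}=(1-\beta_0)z_t+\beta_0\Delta^{t+1}$ and $x_{t+1}=x_t-\eta_0z_{t+1}$. Let $\delta_{\alpha,0}=\sum_i\|\alpha_i^0-\alpha_i(x_0)\|^2$, $\delta_{y,0}=\sum_i\|y_i^0-y_i(x_0)\|^2$,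 $\delta_{gyy,0}=\sum_i\|s_i^0-\nabla^2_{yy}g_i(x_0,y_i(x_0))\|^2$, $C_\alpha=L_f/\mu_f$, $C_y=L_g/\mu_g$. **Theorem.** There are positive constants $C_1,C_2,C_3,C_4,L_F$ that depend only on $\mu_f,\mu_g,C_f,L_f,L_g,C_{gxy},L_{gxy},L_{gyy},\sigma$ (not on $m,n,b,\varepsilon$, nor on the dimensions) such that the following holds. 1. Under Assumption 1, $F$ is differentiable and $\nabla F$ is $L_F$-Lipschitz. 2. Let Assumptions 1 and 2 hold, let $\varepsilon>0$, and let $F(x_0)-F(x)\le\Delta_F$ for all $x$. Let $\eta_0,\eta_1,\eta_2,\beta_0,\beta_1>0$ with $$\eta_1\le\min\Bigl\{\tfrac{\mu_f}{L_f^2},\tfrac1{\mu_f},\tfrac{4m}{\mu_fn},\tfrac{b\varepsilon^2}{96C_1\mu_f\sigma^2}\Bigr\},\quad \eta_2\le\min\Bigl\{\tfrac{\mu_g}{L_g^2},\tfrac{2m}{n\mu_g},\tfrac{\mu_gb\varepsilon^2}{48C_2\sigma^2}\Bigr\},\quad \beta_1\le\min\Bigl\{1,\tfrac{b\varepsilon^2}{96C_3\sigma^2}\Bigr\},\quad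 \beta_0\le\min\Bigl\{1,\tfrac{\min\{n,b\}\varepsilon^2}{12C_4}\Bigr\},$$ $$\eta_0\le\min\Bigl\{\tfrac1{2L_F},\tfrac{\beta_0}{\sqrt{80}L_F},\tfrac{\eta_1\mu_fn}{\sqrt{640}\,m\sqrt{C_1}C_\alpha},\tfrac{n\beta_1}{\sqrt{640}\,m\sqrt{C_3}L_{gyy}\sqrt{1+C_y^2}},\tfrac{n\eta_2\mu_g}{\sqrt{160}\,m\sqrt{C_2}C_y}\Bigr\},$$ and let $T\in\mathbb N$ with $$T\ge\max\Bigl\{\tfrac{30\Delta_F}{\eta_0\varepsilon^2},\tfrac{15\,\mathbb E\|\nabla F(x_0)-z_1\|^2}{\beta_0\varepsilon^2},\tfrac{60C_1\delta_{\alpha,0}}{\mu_fn\eta_1\varepsilon^2},\tfrac{30C_2\delta_{y,0}}{n\eta_2\mu_g\varepsilon^2},\tfrac{60C_3\delta_{gyy,0}}{n\beta_1\varepsilon^2}\Bigr\}.$$ If $\tau$ is uniform on $\{0,\dots,T\}$ and independent of the draws of the algorithm, then $$\mathbb E\|\nabla F(x_\tau)\|^2\le\varepsilon^2\quad\text{and}\quad\mathbb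 E\|\nabla F(x_\tau)-z_{\tau+1}\|^2<2\varepsilon^2 .$$ 3. For every $D>0$ there are $a_0,a_1,a_2,b_0,b_1,K_1,K_2>0$, depending only on $D$ and the constants of Assumptions 1 and 2, such that whenever $\varepsilon>0$, $b\varepsilon^2\le D$, $F(x_0)-F(x)\le D$ for all $x$, $\|z_0\|^2\le D$ and $\delta_{\alpha,0},\delta_{y,0},\delta_{gyy,0}\le mD$, the step sizes $\eta_1=a_1b\varepsilon^2$, $\eta_2=a_2b\varepsilon^2$, $\beta_1=b_1b\varepsilon^2$, $\beta_0=b_0\min\{n,b\}\varepsilon^2$, $\eta_0=a_0\min\{\min\{n,b\}\varepsilon^2,\,nb\varepsilon^2/m\}$ satisfy the conditions in 2, and the conclusion of 2 holds for every $$T\ge K_1\max\Bigl\{\frac{m}{nb\varepsilon^4},\frac{1}{\min\{n,b\}\varepsilon^4}\Bigr\}.$$ For the smallest such $T$, iterations $0,\dots,T$ draw, almost surely, at most $K_2\max\{m,b\}\varepsilon^{-4}$ samples; this is the $O(\varepsilon^{-4})$ sample complexity. -/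

import Mathlib

open MeasureTheory ProbabilityTheory
open scoped BigOperators

universe u v w

noncomputable section

namespace MinMaxBilevel

/-- Real Euclidean space of dimension `d`. -/
abbrev E (d : ℕ) : Type := EuclideanSpace ℝ (Fin d)

/-- A minimizer of `φ` over `s` (an arbitrary point if there is none). -/
def argminOn {d : ℕ} (s : Set (E d)) (φ : E d → ℝ) : E d :=
  Classical.epsilon fun v => v ∈ s ∧ IsMinOn φ s v

/-- A maximizer of `φ` over `s` (an arbitrary point if there is none). -/
def argmaxOn {d : ℕ} (s : Set (E d)) (φ : E d → ℝ) : E d :=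
  Classical.epsilon fun v => v ∈ s ∧ IsMaxOn φ s v

/-- Euclidean projection onto `s`: the point of `s` nearest to `v`. -/
def proj {d : ℕ} (s : Set (E d)) (v : E d) : E d :=
  argminOn s fun u => ‖u - v‖

/-- The constants of the two assumptions. -/
structure Consts where
  μf : ℝ
  μg : ℝ
  Cf : ℝ
  Lf : ℝ
  Lg : ℝ
  Cgxy : ℝ
  Lgxy : ℝ
  Lgyy : ℝ
  σ : ℝ

/-- All constants are positive. -/
structure Consts.Pos (c : Consts) : Prop where
  μf : 0 < c.μf
  μg : 0 < c.μg
  Cf : 0 < c.Cf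
  Lf : 0 < c.Lf
  Lg : 0 < c.Lg
  Cgxy : 0 < c.Cgxy
  Lgxy : 0 < c.Lgxy
  Lgyy : 0 < c.Lgyy
  σ : 0 < c.σ

/-- The Lipschitz constant `L_f / μ_f` of the inner maximizer. -/
def Consts.Cα (c : Consts) : ℝ := c.Lf / c.μf

/-- The Lipschitz constant `L_g / μ_g` of the lower-level solution. -/
def Consts.Cy (c : Consts) : ℝ := c.Lg / c.μg

/-- Data of a multi-block min-max bilevel problem with `m` blocks. -/
structure Problem (m dx dα dy : ℕ) where
  /-- the constraint set of each dual block -/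
  A : Set (E dα)
  /-- upper-level block objectives `f_i (x, α, y)` -/
  f : Fin m → E dx → E dα → E dy → ℝ
  /-- lower-level block objectives `g_i (x, y)` -/
  g : Fin m → E dx → E dy → ℝ

namespace Problem

variable {m dx dα dy : ℕ} (p : Problem m dx dα dy)

/-- `∇_x f_i` -/
def fx (i : Fin m) (x : E dx) (α : E dα) (y : E dy) : E dx :=
  gradient (fun x' => p.f i x' α y) x

/-- `∇_α f_i` -/
def fα (i : Fin m) (x : E dx) (α : E dα) (y : E dy) : E dα :=
  gradient (fun α' => p.f i x α' y) α

/-- `∇_y f_i` -/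
def fy (i : Fin m) (x : E dx) (α : E dα) (y : E dy) : E dy :=
  gradient (fun y' => p.f i x α y') y

/-- `∇_x g_i` -/
def gx (i : Fin m) (x : E dx) (y : E dy) : E dx :=
  gradient (fun x' => p.g i x' y) x

/-- `∇_y g_i` -/
def gy (i : Fin m) (x : E dx) (y : E dy) : E dy :=
  gradient (fun y' => p.g i x y') y

/-- `∇²_{xy} g_i`, the `dx × dy` matrix of mixed second derivatives, as an operator; the norm on
operators is the spectral norm. -/
def gxy (i : Fin m) (x : E dx) (y : E dy) : E dy →L[ℝ] E dx :=
  fderiv ℝ (fun y' => p.gx i x y') y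

/-- `∇²_{yy} g_i`, as an operator. -/
def gyy (i : Fin m) (x : E dx) (y : E dy) : E dy →L[ℝ] E dy :=
  fderiv ℝ (fun y' => p.gy i x y') y

/-- The lower-level solution `y_i(x) = argmin_y g_i(x, y)`. -/
def ySol (i : Fin m) (x : E dx) : E dy :=
  argminOn Set.univ fun y => p.g i x y

/-- The dual solution `α_i(x) = argmax_{α ∈ A} f_i(x, α, y_i(x))`. -/
def αSol (i : Fin m) (x : E dx) : E dα :=
  argmaxOn p.A fun α => p.f i x α (p.ySol i x)

/-- The objective `F(x) = (1/m) ∑_i f_i(x, α_i(x), y_i(x))`. -/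
def F (x : E dx) : ℝ :=
  (1 / (m : ℝ)) * ∑ i, p.f i x (p.αSol i x) (p.ySol i x)

/-- The first assumption, on the functions `f_i`, `g_i` and the set `A`; what is said of `f_i`
concerns dual variables in `A` only, and the norm of a triple or pair is the Euclidean one. -/
structure Regular (c : Consts) : Prop where
  A_nonempty : p.A.Nonempty
  A_closed : IsClosed p.A
  A_convex : Convex ℝ p.A
  f_diff : ∀ i x, ∀ α ∈ p.A, ∀ y,
    DifferentiableAt ℝ (fun q : E dx × E dα × E dy => p.f i q.1 q.2.1 q.2.2) (x, α, y)
  f_strongConcave : ∀ i x y, StrongConcaveOn p.A c.μf fun α => p.f i x α y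
  f_lipschitz : ∀ i x x', ∀ α ∈ p.A, ∀ α' ∈ p.A, ∀ y y',
    (p.f i x α y - p.f i x' α' y') ^ 2 ≤
      c.Cf ^ 2 * (‖x - x'‖ ^ 2 + ‖α - α'‖ ^ 2 + ‖y - y'‖ ^ 2)
  f_smooth : ∀ i x x', ∀ α ∈ p.A, ∀ α' ∈ p.A, ∀ y y',
    ‖p.fx i x α y - p.fx i x' α' y'‖ ^ 2 + ‖p.fα i x α y - p.fα i x' α' y'‖ ^ 2 +
        ‖p.fy i x α y - p.fy i x' α' y'‖ ^ 2 ≤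
      c.Lf ^ 2 * (‖x - x'‖ ^ 2 + ‖α - α'‖ ^ 2 + ‖y - y'‖ ^ 2)
  g_diff : ∀ i, Differentiable ℝ fun q : E dx × E dy => p.g i q.1 q.2
  g_diff_twice : ∀ i, Differentiable ℝ (fderiv ℝ fun q : E dx × E dy => p.g i q.1 q.2)
  g_strongConvex : ∀ i x, StrongConvexOn Set.univ c.μg fun y => p.g i x y
  g_smooth : ∀ i x x' y y',
    ‖p.gx i x y - p.gx i x' y'‖ ^ 2 + ‖p.gy i x y - p.gy i x' y'‖ ^ 2 ≤
      c.Lg ^ 2 * (‖x - x'‖ ^ 2 + ‖y - y'‖ ^ 2)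
  gxy_bound : ∀ i x y, ‖p.gxy i x y‖ ^ 2 ≤ c.Cgxy ^ 2
  gxy_lipschitz : ∀ i x x' y y',
    ‖p.gxy i x y - p.gxy i x' y'‖ ^ 2 ≤ c.Lgxy ^ 2 * (‖x - x'‖ ^ 2 + ‖y - y'‖ ^ 2)
  gyy_lipschitz : ∀ i x x' y y',
    ‖p.gyy i x y - p.gyy i x' y'‖ ^ 2 ≤ c.Lgyy ^ 2 * (‖x - x'‖ ^ 2 + ‖y - y'‖ ^ 2)

end Problem

/-- The random operation `O` is an unbiased estimate of `v`, of variance at most `s`, when its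
input has the law `ν`. -/
structure IsUnbiased {B V : Type*} [MeasurableSpace B] [NormedAddCommGroup V] [NormedSpace ℝ V]
    (ν : Measure B) (O : B → V) (v : V) (s : ℝ) : Prop where
  integrable : Integrable O ν
  mean : ∫ β, O β ∂ν = v
  integrable_sq : Integrable (fun β => ‖O β - v‖ ^ 2) ν
  variance : ∫ β, ‖O β - v‖ ^ 2 ∂ν ≤ s

/-- Stochastic oracles with batch size `b`. For block `i` a batch consists of `b` samples `ξ` from
`P i`, which feed the derivatives of `f_i`, and `b` samples `ζ` from `Q i`, which feed the
derivatives of `g_i`. -/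
structure Oracles (m dx dα dy b : ℕ) (Ξ Z : Type*) [MeasurableSpace Ξ] [MeasurableSpace Z] where
  P : Fin m → Measure Ξ
  Q : Fin m → Measure Z
  fx : Fin m → E dx → E dα → E dy → (Fin b → Ξ) → E dx
  fα : Fin m → E dx → E dα → E dy → (Fin b → Ξ) → E dα
  fy : Fin m → E dx → E dα → E dy → (Fin b → Ξ) → E dy
  gy : Fin m → E dx → E dy → (Fin b → Z) → E dy
  gxy : Fin m → E dx → E dy → (Fin b → Z) → (E dy →L[ℝ] E dx)
  gyy : Fin m → E dx → E dy → (Fin b → Z) → (E dy →L[ℝ] E dy)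

/-- What is sampled in one iteration: a set of blocks, and for every block the two halves of its
data batch (those of unsampled blocks are not used by the algorithm). -/
abbrev Draw (m b : ℕ) (Ξ Z : Type*) : Type _ :=
  Finset (Fin m) × (Fin m → Fin b → Ξ) × (Fin m → Fin b → Z)

instance instMeasurableSpaceBlocks (m : ℕ) : MeasurableSpace (Finset (Fin m)) := ⊤

namespace Oracles

variable {m dx dα dy b : ℕ} {Ξ Z : Type*} [MeasurableSpace Ξ] [MeasurableSpace Z]
  (o : Oracles m dx dα dy b Ξ Z)

/-- The law of the `f`-half of a batch of block `i`: `b` independent samples from `P i`. -/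
def batchP (i : Fin m) : Measure (Fin b → Ξ) := Measure.pi fun _ => o.P i

/-- The law of the `g`-half of a batch of block `i`: `b` independent samples from `Q i`. -/
def batchQ (i : Fin m) : Measure (Fin b → Z) := Measure.pi fun _ => o.Q i

/-- The second assumption: the oracles are unbiased, with variance at most `σ² / b`; moreover the
Hessian oracle is symmetric and `⪰ μ_g I`. -/
structure Valid (p : Problem m dx dα dy) (c : Consts) : Prop where
  P_prob : ∀ i, IsProbabilityMeasure (o.P i)
  Q_prob : ∀ i, IsProbabilityMeasure (o.Q i)
  fx_meas : ∀ i, Measurable fun q : E dx × E dα × E dy × (Fin b → Ξ) =>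
    o.fx i q.1 q.2.1 q.2.2.1 q.2.2.2
  fα_meas : ∀ i, Measurable fun q : E dx × E dα × E dy × (Fin b → Ξ) =>
    o.fα i q.1 q.2.1 q.2.2.1 q.2.2.2
  fy_meas : ∀ i, Measurable fun q : E dx × E dα × E dy × (Fin b → Ξ) =>
    o.fy i q.1 q.2.1 q.2.2.1 q.2.2.2
  gy_meas : ∀ i, Measurable fun q : E dx × E dy × (Fin b → Z) => o.gy i q.1 q.2.1 q.2.2
  gxy_meas : ∀ i, Measurable fun q : E dx × E dy × (Fin b → Z) => o.gxy i q.1 q.2.1 q.2.2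
  gyy_meas : ∀ i, Measurable fun q : E dx × E dy × (Fin b → Z) => o.gyy i q.1 q.2.1 q.2.2
  fx_unbiased : ∀ i x, ∀ α ∈ p.A, ∀ y,
    IsUnbiased (o.batchP i) (o.fx i x α y) (p.fx i x α y) (c.σ ^ 2 / b)
  fα_unbiased : ∀ i x, ∀ α ∈ p.A, ∀ y,
    IsUnbiased (o.batchP i) (o.fα i x α y) (p.fα i x α y) (c.σ ^ 2 / b)
  fy_unbiased : ∀ i x, ∀ α ∈ p.A, ∀ y,
    IsUnbiased (o.batchP i) (o.fy i x α y) (p.fy i x α y) (c.σ ^ 2 / b)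
  gy_unbiased : ∀ i x y,
    IsUnbiased (o.batchQ i) (o.gy i x y) (p.gy i x y) (c.σ ^ 2 / b)
  gxy_unbiased : ∀ i x y,
    IsUnbiased (o.batchQ i) (o.gxy i x y) (p.gxy i x y) (c.σ ^ 2 / b)
  gyy_unbiased : ∀ i x y,
    IsUnbiased (o.batchQ i) (o.gyy i x y) (p.gyy i x y) (c.σ ^ 2 / b)
  gyy_lower : ∀ i x y ζ,
    (o.gyy i x y ζ - c.μg • ContinuousLinearMap.id ℝ (E dy)).IsPositive

/-- The law of one iteration's draw: the block set is uniform among the sets of `n` blocks, and it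
and all halves of all batches are independent. -/
def drawLaw (n : ℕ) : Measure (Draw m b Ξ Z) :=
  (uniformOn {I : Finset (Fin m) | I.card = n}).prod
    ((Measure.pi fun i => o.batchP i).prod (Measure.pi fun i => o.batchQ i))

end Oracles

/-- Step sizes of the algorithm. -/
structure Steps where
  η₀ : ℝ
  η₁ : ℝ
  η₂ : ℝ
  β₀ : ℝ
  β₁ : ℝ

/-- The variables maintained by the algorithm. -/
structure State (m dx dα dy : ℕ) where
  x : E dx
  z : E dx
  α : Fin m → E dα
  y : Fin m → E dy
  /-- moving average of Hessian estimates -/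
  s : Fin m → (E dy →L[ℝ] E dy)

/-- The Hessian inverse estimate `H_i = [s_i]⁻¹`. It changes only when `s_i` does, that is, when
block `i` is sampled. -/
def State.H {m dx dα dy : ℕ} (u : State m dx dα dy) (i : Fin m) : E dy →L[ℝ] E dy :=
  (u.s i).inverse

section Algorithm

variable {m dx dα dy b : ℕ} {Ξ Z : Type*} [MeasurableSpace Ξ] [MeasurableSpace Z]

/-- The stochastic gradient estimate `Δ^{t+1}`. -/
def gradEst (o : Oracles m dx dα dy b Ξ Z) (u : State m dx dα dy) (w : Draw m b Ξ Z) : E dx :=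
  (1 / (w.1.card : ℝ)) • ∑ i ∈ w.1,
    (o.fx i u.x (u.α i) (u.y i) (w.2.1 i) -
      o.gxy i u.x (u.y i) (w.2.2 i) (u.H i (o.fy i u.x (u.α i) (u.y i) (w.2.1 i))))

/-- The momentum update `z_{t+1} = (1 - β₀) z_t + β₀ Δ^{t+1}`. -/
def nextZ (o : Oracles m dx dα dy b Ξ Z) (k : Steps) (u : State m dx dα dy)
    (w : Draw m b Ξ Z) : E dx :=
  (1 - k.β₀) • u.z + k.β₀ • gradEst o u w

/-- One iteration of the algorithm. -/
def step (A : Set (E dα)) (o : Oracles m dx dα dy b Ξ Z) (k : Steps) (u : State m dx dα dy)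
    (w : Draw m b Ξ Z) : State m dx dα dy where
  x := u.x - k.η₀ • nextZ o k u w
  z := nextZ o k u w
  α := fun i =>
    if i ∈ w.1 then proj A (u.α i + k.η₁ • o.fα i u.x (u.α i) (u.y i) (w.2.1 i)) else u.α i
  y := fun i => if i ∈ w.1 then u.y i - k.η₂ • o.gy i u.x (u.y i) (w.2.2 i) else u.y i
  s := fun i =>
    if i ∈ w.1 then (1 - k.β₁) • u.s i + k.β₁ • o.gyy i u.x (u.y i) (w.2.2 i) else u.s i

/-- The state at time `t` of the run that starts from `u₀` and uses the draws `w 0, w 1, …`. -/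
def run (A : Set (E dα)) (o : Oracles m dx dα dy b Ξ Z) (k : Steps) (u₀ : State m dx dα dy)
    (w : ℕ → Draw m b Ξ Z) : ℕ → State m dx dα dy
  | 0 => u₀
  | t + 1 => step A o k (run A o k u₀ w t) (w t)

/-- The number of data samples drawn in iterations `0, …, T`: `b` samples `ξ` and `b` samples `ζ`
for every sampled block. -/
def samplesUsed (w : ℕ → Draw m b Ξ Z) (T : ℕ) : ℕ :=
  ∑ t ∈ Finset.range (T + 1), ∑ _i ∈ (w t).1, (b + b)

/-- The draws `w t` are independent with the law `drawLaw n`, and `τ` is uniform on `{0, …, T}`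
and independent of them. -/
structure IsSampling {Ω : Type*} [MeasurableSpace Ω] (μ : Measure Ω)
    (o : Oracles m dx dα dy b Ξ Z) (n T : ℕ) (w : ℕ → Ω → Draw m b Ξ Z) (τ : Ω → ℕ) : Prop where
  prob : IsProbabilityMeasure μ
  w_meas : ∀ t, Measurable (w t)
  w_indep : iIndepFun w μ
  w_law : ∀ t, μ.map (w t) = o.drawLaw n
  τ_meas : Measurable τ
  τ_law : μ.map τ = uniformOn {t : ℕ | t ≤ T}
  τ_indep : IndepFun τ (fun ω t => w t ω) μ

/-- Requirements on the initial state: dual variables in `A`, and `s_i` symmetric with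
`s_i ⪰ μ_g I`. -/
structure State.Admissible (u₀ : State m dx dα dy) (A : Set (E dα)) (c : Consts) : Prop where
  α_mem : ∀ i, u₀.α i ∈ A
  s_lower : ∀ i, (u₀.s i - c.μg • ContinuousLinearMap.id ℝ (E dy)).IsPositive

/-- Initial error `δ_{α,0} = ∑_i ‖α_i^0 - α_i(x_0)‖²`. -/
def errα (p : Problem m dx dα dy) (u : State m dx dα dy) : ℝ :=
  ∑ i, ‖u.α i - p.αSol i u.x‖ ^ 2

/-- Initial error `δ_{y,0} = ∑_i ‖y_i^0 - y_i(x_0)‖²`. -/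
def erry (p : Problem m dx dα dy) (u : State m dx dα dy) : ℝ :=
  ∑ i, ‖u.y i - p.ySol i u.x‖ ^ 2

/-- Initial error `δ_{gyy,0} = ∑_i ‖s_i^0 - ∇²_{yy} g_i(x_0, y_i(x_0))‖²`. -/
def errgyy (p : Problem m dx dα dy) (u : State m dx dα dy) : ℝ :=
  ∑ i, ‖u.s i - p.gyy i u.x (p.ySol i u.x)‖ ^ 2

/-- `E ‖∇F(x_0) - z_1‖²`. -/
def errz {Ω : Type*} [MeasurableSpace Ω] (μ : Measure Ω) (p : Problem m dx dα dy)
    (o : Oracles m dx dα dy b Ξ Z) (k : Steps) (u₀ : State m dx dα dy)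
    (w : ℕ → Ω → Draw m b Ξ Z) : ℝ :=
  ∫ ω, ‖gradient p.F u₀.x - (run p.A o k u₀ (fun t => w t ω) 1).z‖ ^ 2 ∂μ

/-- The guarantee `E ‖∇F(x_τ)‖² ≤ ε²` and `E ‖∇F(x_τ) - z_{τ+1}‖² < 2 ε²`. -/
def Guarantee {Ω : Type*} [MeasurableSpace Ω] (μ : Measure Ω) (p : Problem m dx dα dy)
    (o : Oracles m dx dα dy b Ξ Z) (k : Steps) (u₀ : State m dx dα dy)
    (w : ℕ → Ω → Draw m b Ξ Z) (τ : Ω → ℕ) (ε : ℝ) : Prop :=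
  let x : ℕ → Ω → E dx := fun t ω => (run p.A o k u₀ (fun r => w r ω) t).x
  let z : ℕ → Ω → E dx := fun t ω => (run p.A o k u₀ (fun r => w r ω) t).z
  (Integrable (fun ω => ‖gradient p.F (x (τ ω) ω)‖ ^ 2) μ ∧
    ∫ ω, ‖gradient p.F (x (τ ω) ω)‖ ^ 2 ∂μ ≤ ε ^ 2) ∧
  (Integrable (fun ω => ‖gradient p.F (x (τ ω) ω) - z (τ ω + 1) ω‖ ^ 2) μ ∧
    ∫ ω, ‖gradient p.F (x (τ ω) ω) - z (τ ω + 1) ω‖ ^ 2 ∂μ < 2 * ε ^ 2)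

end Algorithm

/-- Constants appearing in the bounds on the step sizes and on the number of iterations. -/
structure RateConsts where
  C₁ : ℝ
  C₂ : ℝ
  C₃ : ℝ
  C₄ : ℝ
  LF : ℝ

/-- All of them are positive. -/
structure RateConsts.Pos (C : RateConsts) : Prop where
  C₁ : 0 < C.C₁
  C₂ : 0 < C.C₂
  C₃ : 0 < C.C₃
  C₄ : 0 < C.C₄
  LF : 0 < C.LF

/-- The conditions on the step sizes, for `m` blocks, `n` sampled blocks, batch size `b` and
accuracy `ε`. -/
structure Steps.Ok (k : Steps) (c : Consts) (C : RateConsts) (m n b : ℕ) (ε : ℝ) : Prop where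
  η₀_pos : 0 < k.η₀
  η₁_pos : 0 < k.η₁
  η₂_pos : 0 < k.η₂
  β₀_pos : 0 < k.β₀
  β₁_pos : 0 < k.β₁
  η₁_le : k.η₁ ≤ min (min (c.μf / c.Lf ^ 2) (1 / c.μf))
    (min (4 * m / (c.μf * n)) (b * ε ^ 2 / (96 * C.C₁ * c.μf * c.σ ^ 2)))
  η₂_le : k.η₂ ≤ min (c.μg / c.Lg ^ 2)
    (min (2 * m / (n * c.μg)) (c.μg * b * ε ^ 2 / (48 * C.C₂ * c.σ ^ 2)))
  β₁_le : k.β₁ ≤ min 1 (b * ε ^ 2 / (96 * C.C₃ * c.σ ^ 2))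
  β₀_le : k.β₀ ≤ min 1 (min (n : ℝ) (b : ℝ) * ε ^ 2 / (12 * C.C₄))
  η₀_le : k.η₀ ≤ min (min (1 / (2 * C.LF)) (k.β₀ / (√80 * C.LF)))
    (min (k.η₁ * c.μf * n / (√640 * m * √C.C₁ * c.Cα))
      (min (n * k.β₁ / (√640 * m * √C.C₃ * c.Lgyy * √(1 + c.Cy ^ 2)))
        (n * k.η₂ * c.μg / (√160 * m * √C.C₂ * c.Cy))))

/-- The number of iterations that is sufficient, in terms of the initial gap `ΔF` and the initial
errors `dz`, `dα`, `dy`, `dgyy`. -/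
def iterBound (k : Steps) (c : Consts) (C : RateConsts) (n : ℕ) (ε ΔF dz dα dy dgyy : ℝ) : ℝ :=
  max (max (30 * ΔF / (k.η₀ * ε ^ 2)) (15 * dz / (k.β₀ * ε ^ 2)))
    (max (60 * C.C₁ * dα / (c.μf * n * k.η₁ * ε ^ 2))
      (max (30 * C.C₂ * dy / (n * k.η₂ * c.μg * ε ^ 2)) (60 * C.C₃ * dgyy / (n * k.β₁ * ε ^ 2))))

/-- The rate `max {m / (n b ε⁴), 1 / (min {n, b} ε⁴)}`. -/
def rate (m n b : ℕ) (ε : ℝ) : ℝ :=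
  max (m / (n * b * ε ^ 4)) (1 / (min (n : ℝ) (b : ℝ) * ε ^ 4))

/-- Positive proportionality factors for the five step sizes. -/
structure StepFactors where
  a₀ : ℝ
  a₁ : ℝ
  a₂ : ℝ
  b₀ : ℝ
  b₁ : ℝ
  a₀_pos : 0 < a₀
  a₁_pos : 0 < a₁
  a₂_pos : 0 < a₂
  b₀_pos : 0 < b₀
  b₁_pos : 0 < b₁

/-- Step sizes of order `ε²`: `η₁, η₂, β₁ ∝ b ε²`, `β₀ ∝ min {n, b} ε²` and
`η₀ ∝ min {min {n, b} ε², n b ε² / m}`. -/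
def StepFactors.steps (a : StepFactors) (m n b : ℕ) (ε : ℝ) : Steps where
  η₀ := a.a₀ * min (min (n : ℝ) (b : ℝ) * ε ^ 2) (n * b * ε ^ 2 / m)
  η₁ := a.a₁ * (b * ε ^ 2)
  η₂ := a.a₂ * (b * ε ^ 2)
  β₀ := a.b₀ * (min (n : ℝ) (b : ℝ) * ε ^ 2)
  β₁ := a.b₁ * (b * ε ^ 2)

end MinMaxBilevel

end

/-! Gradient of the objective. Each `y_i` is Lipschitz by strong monotonicity of `∇_y g_i`, and
`α_i` by strong concavity together with the two variational inequalities. Linearising `∇_y g_i(x,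
y_i(x)) = 0` makes `y_i` differentiable (`hasFDerivAt_ySol`), while the maximiser `α_i`, which is
only Lipschitz, contributes nothing to first order by a Danskin argument (`hasGradientAt_block`).
Hence `∇F` is the mean over the blocks of `hyper` at the exact inner solutions and the exact
Hessian, and all its ingredients are bounded and Lipschitz (`gradient_F_lip`).

One iteration. The momentum error contracts at rate `β₀`, up to a drift of order `η₀²‖z‖²`, the
squared bias caused by inexact `α`, `y`, `s`, and a variance of order `1 / min {n, b}`
(`ebound_gradErr`). The errors of `α` and `y` contract when their block is drawn: a projected ascent
step is nonexpansive towards the fixed point `α_i(x)`, and a gradient step contracts towards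
`y_i(x)`.

The Hessian error is the delicate part. The spectral norm is not Hilbertian, so unbiasedness gives
no dimension-free recursion for `E‖s - S‖²`, where `S` is the exact Hessian. But by the resolvent
identity the hypergradient sees the error only through the residual `(s - S) v` with `v = S⁻¹ ∇_y f`
(`dir`), a vector of norm at most `C_f / μ_g`, and for vectors the bias-variance decomposition is
available (`ebound_s_dir`). When `x` moves, so does `v`, and the residual changes by a multiple of
`‖s‖`, which is not bounded since the oracle is not. So `hessErr` multiplies the squared residual by
a cutoff in `‖s‖` and adds a multiple of the squared excess of `‖s‖` over `K = L_g + σ`. The excess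
is a scalar whose recursion needs only the triangle inequality (`ebound_excess`). Above the cutoff
the error of the linear solve is trivially bounded and the excess pays for it
(`norm_solve_sub_sq_le`); an increase of the cutoff happens only from `‖s‖ > 2K` and is again paid
for by the excess (`ebound_cut`).

Combination. `lyapunov` adds `2/η₀` times the objective gap, the inner errors divided by their
contraction rates, a multiple of order `1/β₀` of the momentum error and a little of `‖z‖²`. Descent
supplies `‖∇F‖² + ‖z‖²/2`. The `‖z‖²/2` absorbs every drift, and the weights are such that the decay
of the inner errors cancels the bias exactly. So each step lowers the mean of `lyapunov` by that of
`‖∇F(x_t)‖² + ‖∇F(x_t) - z_{t+1}‖²`, up to a small noise (`ebound_lyapunov`). Independence of the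
fresh draw from the past lets this be summed along the run (`ebound_sum`), and an independent
uniform time turns the sum into a mean (`ebound_uniform`). The rest is bookkeeping: constants for
which the stated conditions imply those of the analysis, then step sizes of the stated orders. -/

namespace MinMaxBilevel

open Filter Topology Set

/-! ### Strongly convex functions: quadratic growth, minimisers, first-order conditions. -/

section Convexity

variable {V : Type*} [NormedAddCommGroup V] [InnerProductSpace ℝ V]

/-- The quadratic lower bound of a strongly convex function at a point of differentiability. -/
theorem add_fderiv_add_le_of_strongConvexOn {s : Set V} {m : ℝ} {φ : V → ℝ}
    (h : StrongConvexOn s m φ) {φ' : V →L[ℝ] ℝ} {x y : V} (hx : x ∈ s) (hy : y ∈ s)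
    (hφ : HasFDerivAt φ φ' x) : φ x + φ' (y - x) + m / 2 * ‖y - x‖ ^ 2 ≤ φ y := by
  have hd : HasDerivAt (fun t : ℝ => φ (x + t • (y - x))) (φ' (y - x)) 0 := by
    have h1 : HasDerivAt (fun t : ℝ => x + t • (y - x)) (y - x) 0 := by
      simpa using ((hasDerivAt_id (0 : ℝ)).smul_const (y - x)).const_add x
    have h2 : HasFDerivAt φ φ' (x + (0 : ℝ) • (y - x)) := by simpa using hφ
    exact h2.comp_hasDerivAt 0 h1
  have ht := hd.tendsto_slope_zero_right
  have hr : Tendsto (fun t : ℝ => φ y - φ x - (1 - t) * (m / 2 * ‖y - x‖ ^ 2)) (𝓝[>] 0)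
      (𝓝 (φ y - φ x - (1 - 0) * (m / 2 * ‖y - x‖ ^ 2))) := by
    apply Tendsto.mono_left _ nhdsWithin_le_nhds
    apply Continuous.tendsto
    fun_prop
  -- Strong convexity on the segment, divided by `t`, bounds the difference quotient; then `t → 0+`.
  have := le_of_tendsto_of_tendsto ht hr (by
    filter_upwards [Ioo_mem_nhdsGT (show (0 : ℝ) < 1 by norm_num)] with t ht
    have h3 := h.2 hx hy (show 0 ≤ 1 - t by linarith [ht.2]) ht.1.le (by ring)
    have h4 : (1 - t) • x + t • y = x + t • (y - x) := by module
    rw [h4, norm_sub_rev x y] at h3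
    simp only [zero_add, zero_smul, add_zero, smul_eq_mul] at h3 ⊢
    rw [inv_mul_le_iff₀ ht.1]
    linarith)
  linarith

theorem le_fderiv_sub_of_strongConvexOn {s : Set V} {m : ℝ} {φ : V → ℝ}
    (h : StrongConvexOn s m φ) {φ' ψ' : V →L[ℝ] ℝ} {x y : V} (hx : x ∈ s) (hy : y ∈ s)
    (hφ : HasFDerivAt φ φ' x) (hψ : HasFDerivAt φ ψ' y) :
    m * ‖x - y‖ ^ 2 ≤ φ' (x - y) - ψ' (x - y) := by
  have h1 := add_fderiv_add_le_of_strongConvexOn h hx hy hφ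
  have h2 := add_fderiv_add_le_of_strongConvexOn h hy hx hψ
  have h3 : φ' (y - x) = - φ' (x - y) := by rw [← map_neg, neg_sub]
  rw [norm_sub_rev y x] at h1
  linarith

/-- A differentiable strongly convex function attains its minimum over a closed set. -/
theorem exists_isMinOn_of_strongConvexOn [FiniteDimensional ℝ V] {s : Set V} {m : ℝ} {φ : V → ℝ}
    (h : StrongConvexOn s m φ) (hm : 0 < m) (hs : IsClosed s) (hne : s.Nonempty)
    (hφ : ∀ x ∈ s, DifferentiableAt ℝ φ x) : ∃ x, x ∈ s ∧ IsMinOn φ s x := by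
  obtain ⟨x₀, hx₀⟩ := hne
  have : ProperSpace V := FiniteDimensional.proper ℝ V
  refine ContinuousOn.exists_isMinOn'
    (fun x hx => (hφ x hx).continuousAt.continuousWithinAt) hs hx₀ ?_
  set C := ‖fderiv ℝ φ x₀‖
  -- Beyond the radius `2C/m` the quadratic term `m/2 ‖y - x₀‖²` outweighs the linear term, which is
  -- at least `-C ‖y - x₀‖`, so `φ y ≥ φ x₀` there.
  have hK : (Metric.closedBall x₀ (2 * C / m))ᶜ ∈ cocompact V :=
    (isCompact_closedBall x₀ (2 * C / m)).compl_mem_cocompact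
  filter_upwards [mem_inf_of_left hK, mem_inf_of_right (mem_principal_self s)] with y hy hys
  have h1 := add_fderiv_add_le_of_strongConvexOn h hx₀ hys (hφ x₀ hx₀).hasFDerivAt
  have h2 : 2 * C / m < ‖y - x₀‖ := by simpa [dist_eq_norm] using hy
  have h3 : -(C * ‖y - x₀‖) ≤ fderiv ℝ φ x₀ (y - x₀) :=
    neg_le_of_abs_le ((fderiv ℝ φ x₀).le_opNorm (y - x₀))
  rw [div_lt_iff₀ hm] at h2
  nlinarith [norm_nonneg (y - x₀)]

theorem fderiv_sub_nonneg_of_isMinOn {s : Set V} {φ : V → ℝ} {φ' : V →L[ℝ] ℝ} {x y : V}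
    (h : IsMinOn φ s x) (hs : Convex ℝ s) (hx : x ∈ s) (hy : y ∈ s) (hφ : HasFDerivAt φ φ' x) :
    0 ≤ φ' (y - x) :=
  h.localize.hasFDerivWithinAt_nonneg hφ.hasFDerivWithinAt
    (sub_mem_posTangentConeAt_of_segment_subset (hs.segment_subset hx hy))

end Convexity

/-! ### Coercive operators and their inverses. -/

section Coercive

variable {V : Type*} [NormedAddCommGroup V] [InnerProductSpace ℝ V]

/-- `⟪s v, v⟫ ≥ μ ‖v‖²` for all `v`. -/
def Coercive (μ : ℝ) (s : V →L[ℝ] V) : Prop := ∀ v, μ * ‖v‖ ^ 2 ≤ inner ℝ (s v) v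

theorem Coercive.norm_le {μ : ℝ} {s : V →L[ℝ] V} (h : Coercive μ s) (v : V) :
    μ * ‖v‖ ≤ ‖s v‖ := by
  rcases eq_or_ne v 0 with rfl | hv
  · simp
  have h1 := (h v).trans (real_inner_le_norm _ _)
  have h2 : 0 < ‖v‖ := norm_pos_iff.mpr hv
  nlinarith

/-- Keeps the moving averages of Hessian estimates invertible, with a uniform bound on the inverse.
-/
theorem Coercive.convexComb {μ β : ℝ} {s t : V →L[ℝ] V} (hs : Coercive μ s) (ht : Coercive μ t)
    (h0 : 0 ≤ β) (h1 : β ≤ 1) : Coercive μ ((1 - β) • s + β • t) := by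
  intro v
  have h2 := mul_le_mul_of_nonneg_left (hs v) (sub_nonneg.mpr h1)
  have h3 := mul_le_mul_of_nonneg_left (ht v) h0
  simp only [add_apply, smul_apply, inner_add_left,
    real_inner_smul_left]
  linarith

theorem coercive_of_isPositive {μ : ℝ} {s : V →L[ℝ] V}
    (h : (s - μ • ContinuousLinearMap.id ℝ V).IsPositive) : Coercive μ s := by
  intro v
  have h1 := h.inner_nonneg_left v
  simp only [sub_apply, smul_apply, inner_sub_left,
    real_inner_smul_left, ContinuousLinearMap.id_apply, real_inner_self_eq_norm_sq] at h1
  linarith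

variable [FiniteDimensional ℝ V]

theorem Coercive.isInvertible {μ : ℝ} (hμ : 0 < μ) {s : V →L[ℝ] V} (h : Coercive μ s) :
    s.IsInvertible := by
  have hinj : Function.Injective (s : V →ₗ[ℝ] V) := by
    rw [injective_iff_map_eq_zero]
    intro v hv
    have h1 := h.norm_le v
    have h2 : s v = 0 := hv
    rw [h2, norm_zero] at h1
    exact norm_le_zero_iff.mp (by nlinarith [norm_nonneg v])
  refine ⟨(LinearEquiv.ofInjectiveEndo _ hinj).toContinuousLinearEquiv, ?_⟩
  ext v
  rfl

theorem Coercive.apply_inverse {μ : ℝ} (hμ : 0 < μ) {s : V →L[ℝ] V} (h : Coercive μ s) (v : V) :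
    s (s.inverse v) = v := by
  obtain ⟨e, rfl⟩ := h.isInvertible hμ
  simp

theorem Coercive.inverse_apply {μ : ℝ} (hμ : 0 < μ) {s : V →L[ℝ] V} (h : Coercive μ s) (v : V) :
    s.inverse (s v) = v := by
  obtain ⟨e, rfl⟩ := h.isInvertible hμ
  simp

theorem Coercive.norm_inverse_apply_le {μ : ℝ} (hμ : 0 < μ) {s : V →L[ℝ] V} (h : Coercive μ s)
    (v : V) : ‖s.inverse v‖ ≤ μ⁻¹ * ‖v‖ := by
  have h1 := h.norm_le (s.inverse v)
  rw [h.apply_inverse hμ] at h1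
  rwa [inv_mul_eq_div, le_div_iff₀' hμ]

theorem Coercive.norm_inverse_le {μ : ℝ} (hμ : 0 < μ) {s : V →L[ℝ] V} (h : Coercive μ s) :
    ‖s.inverse‖ ≤ μ⁻¹ :=
  ContinuousLinearMap.opNorm_le_bound _ (inv_nonneg.mpr hμ.le) (h.norm_inverse_apply_le hμ)

/-- The resolvent identity `s⁻¹ v - t⁻¹ v = s⁻¹ (t - s) t⁻¹ v`. -/
theorem Coercive.inverse_sub_inverse_apply {μ : ℝ} (hμ : 0 < μ) {s t : V →L[ℝ] V}
    (hs : Coercive μ s) (ht : Coercive μ t) (v : V) :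
    s.inverse v - t.inverse v = s.inverse ((t - s) (t.inverse v)) := by
  rw [sub_apply, map_sub, ht.apply_inverse hμ, hs.inverse_apply hμ]

end Coercive

/-! ### Projection onto the constraint set. -/

section Projection

variable {d : ℕ}

theorem argminOn_spec {s : Set (E d)} {φ : E d → ℝ} (h : ∃ v, v ∈ s ∧ IsMinOn φ s v) :
    argminOn s φ ∈ s ∧ IsMinOn φ s (argminOn s φ) :=
  Classical.epsilon_spec h

theorem argmaxOn_spec {s : Set (E d)} {φ : E d → ℝ} (h : ∃ v, v ∈ s ∧ IsMaxOn φ s v) :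
    argmaxOn s φ ∈ s ∧ IsMaxOn φ s (argmaxOn s φ) :=
  Classical.epsilon_spec h

variable {s : Set (E d)} (hne : s.Nonempty) (hcl : IsClosed s) (hcv : Convex ℝ s)
include hne hcl hcv

/-- Existence of the nearest point makes the choice in `argminOn` a genuine minimiser, and every
minimiser satisfies the obtuse-angle inequality. -/
theorem proj_spec (v : E d) : proj s v ∈ s ∧ ∀ a ∈ s, inner ℝ (v - proj s v) (a - proj s v) ≤ 0 := by
  obtain ⟨p, hp, hpi⟩ := exists_norm_eq_iInf_of_complete_convex hne hcl.isComplete hcv v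
  have hbdd : BddBelow (range fun w : s => ‖v - w‖) := ⟨0, by rintro _ ⟨w, rfl⟩; positivity⟩
  have hmin : IsMinOn (fun u => ‖u - v‖) s p := by
    intro a ha
    simp only [mem_ofPred_eq]
    rw [norm_sub_rev, hpi, norm_sub_rev a]
    exact ciInf_le hbdd (⟨a, ha⟩ : s)
  obtain ⟨h1, h2⟩ := argminOn_spec ⟨p, hp, hmin⟩
  refine ⟨h1, (norm_eq_iInf_iff_real_inner_le_zero hcv h1).mp ?_⟩
  have : Nonempty s := ⟨⟨p, hp⟩⟩
  refine le_antisymm (le_ciInf fun w => ?_) (ciInf_le hbdd (⟨_, h1⟩ : s))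
  have := h2 w.2
  simp only [mem_ofPred_eq] at this
  rwa [norm_sub_rev, norm_sub_rev v]

/-- A projection step is nonexpansive towards a solution `a` of a variational inequality. -/
theorem norm_proj_sub_le {v a g : E d} (ha : a ∈ s) (hg : ∀ b ∈ s, inner ℝ g (b - a) ≤ 0) :
    ‖proj s v - a‖ ≤ ‖v - (a + g)‖ := by
  obtain ⟨h1, h2⟩ := proj_spec hne hcl hcv v
  have h3 := h2 a ha
  have h4 := hg _ h1
  set q := proj s v
  have h5 : ‖q - a‖ ^ 2 ≤ inner ℝ (v - (a + g)) (q - a) := by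
    have e1 : v - (a + g) = (v - q) + (q - a) - g := by abel
    have e2 : inner ℝ (v - q) (a - q) = - inner ℝ (v - q) (q - a) := by
      rw [← inner_neg_right, neg_sub]
    rw [e1, inner_sub_left, inner_add_left, real_inner_self_eq_norm_sq]
    linarith
  have h6 := h5.trans (real_inner_le_norm _ _)
  rcases eq_or_ne (q - a) 0 with h | h
  · rw [h, norm_zero]; positivity
  · have : 0 < ‖q - a‖ := norm_pos_iff.mpr h
    nlinarith

/-- The point `proj s w` solves the variational inequality with `g = w - proj s w`, so the previous
bound says that the projection is 1-Lipschitz. Continuity is what makes the iteration measurable. -/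
theorem continuous_proj : Continuous (proj s) := by
  refine LipschitzWith.continuous (K := 1) (LipschitzWith.of_dist_le_mul fun v w => ?_)
  obtain ⟨h1, h2⟩ := proj_spec hne hcl hcv w
  have := norm_proj_sub_le hne hcl hcv (v := v) h1 h2
  simpa [dist_eq_norm] using this

end Projection

end MinMaxBilevel

/-! ### Partial derivatives of the data; the inner solutions and their Lipschitz bounds. -/

namespace MinMaxBilevel

open Filter Topology Set Asymptotics

theorem inner_gradient_left' {V : Type*} [NormedAddCommGroup V] [InnerProductSpace ℝ V]
    [CompleteSpace V] (φ : V → ℝ) (x v : V) : inner ℝ (gradient φ x) v = fderiv ℝ φ x v :=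
  InnerProductSpace.toDual_symm_apply

theorem norm_gradient_eq {V : Type*} [NormedAddCommGroup V] [InnerProductSpace ℝ V]
    [CompleteSpace V] (φ : V → ℝ) (x : V) : ‖gradient φ x‖ = ‖fderiv ℝ φ x‖ :=
  LinearIsometryEquiv.norm_map _ _

theorem norm_fderiv_le_of_sq_le {V : Type*} [NormedAddCommGroup V] [NormedSpace ℝ V]
    {W : Type*} [NormedAddCommGroup W] [NormedSpace ℝ W]
    {φ : V → W} {C : ℝ} (hC : 0 ≤ C) (x : V)
    (h : ∀ y, ‖φ y - φ x‖ ^ 2 ≤ C ^ 2 * ‖y - x‖ ^ 2) : ‖fderiv ℝ φ x‖ ≤ C := by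
  by_cases hd : DifferentiableAt ℝ φ x
  · refine hd.hasFDerivAt.le_of_lip' hC (Eventually.of_forall fun y => ?_)
    exact abs_le_of_sq_le_sq' (by simpa [mul_pow] using h y) (by positivity) |>.2
  -- `fderiv` is zero where the function is not differentiable, so the bound persists.
  · simp [fderiv_zero_of_not_differentiableAt hd, hC]

theorem le_mul_add₃_of_sq {t L a b c : ℝ} (hL : 0 ≤ L) (ha : 0 ≤ a) (hb : 0 ≤ b) (hc : 0 ≤ c)
    (h : t ^ 2 ≤ L ^ 2 * (a ^ 2 + b ^ 2 + c ^ 2)) : t ≤ L * (a + b + c) := by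
  refine (abs_le_of_sq_le_sq' (h.trans ?_) (by positivity)).2
  rw [mul_pow]
  refine mul_le_mul_of_nonneg_left ?_ (sq_nonneg L)
  nlinarith [mul_nonneg ha hb, mul_nonneg ha hc, mul_nonneg hb hc]

theorem le_mul_add_of_sq {t L a b : ℝ} (hL : 0 ≤ L) (ha : 0 ≤ a) (hb : 0 ≤ b)
    (h : t ^ 2 ≤ L ^ 2 * (a ^ 2 + b ^ 2)) : t ≤ L * (a + b) := by
  simpa using le_mul_add₃_of_sq hL ha hb le_rfl (by simpa using h)

namespace Problem

variable {m dx dα dy : ℕ} (p : Problem m dx dα dy)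

/-- The Hessian `∇²_{yy} g_i` at the lower-level solution. -/
noncomputable def hess (i : Fin m) (x : E dx) : E dy →L[ℝ] E dy := p.gyy i x (p.ySol i x)

/-- `∇_y f_i` at the inner solutions. -/
noncomputable def fySol (i : Fin m) (x : E dx) : E dy := p.fy i x (p.αSol i x) (p.ySol i x)

/-- The solution of the linear system with matrix `hess` and right-hand side `fySol`. -/
noncomputable def dir (i : Fin m) (x : E dx) : E dy := (p.hess i x).inverse (p.fySol i x)

/-- The gradient surrogate at a point, with Hessian estimate `s`. -/
noncomputable def hyper (i : Fin m) (x : E dx) (α : E dα) (y : E dy) (s : E dy →L[ℝ] E dy) : E dx :=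
  p.fx i x α y - p.gxy i x y (s.inverse (p.fy i x α y))

variable {p}

namespace Regular

variable {c : Consts} (h : p.Regular c)
include h

section Upper

theorem hasFDerivAt_f (i : Fin m) (x : E dx) {α : E dα} (hα : α ∈ p.A) (y : E dy) :
    HasFDerivAt (fun q : E dx × E dα × E dy => p.f i q.1 q.2.1 q.2.2)
      (fderiv ℝ (fun q : E dx × E dα × E dy => p.f i q.1 q.2.1 q.2.2) (x, α, y)) (x, α, y) :=
  (h.f_diff i x α hα y).hasFDerivAt

theorem hasFDerivAt_f_x (i : Fin m) (x : E dx) {α : E dα} (hα : α ∈ p.A) (y : E dy) :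
    HasFDerivAt (fun x' => p.f i x' α y)
      ((fderiv ℝ (fun q : E dx × E dα × E dy => p.f i q.1 q.2.1 q.2.2) (x, α, y)).comp
        (.inl ℝ _ _)) x := by
  have h2 : HasFDerivAt (fun x' : E dx => (x', α, y)) (.inl ℝ (E dx) (E dα × E dy)) x :=
    hasFDerivAt_prodMk_left x _
  exact (h.hasFDerivAt_f i x hα y).comp x h2

theorem hasFDerivAt_f_α (i : Fin m) (x : E dx) {α : E dα} (hα : α ∈ p.A) (y : E dy) :
    HasFDerivAt (fun α' => p.f i x α' y)
      ((fderiv ℝ (fun q : E dx × E dα × E dy => p.f i q.1 q.2.1 q.2.2) (x, α, y)).comp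
        ((ContinuousLinearMap.inr ℝ (E dx) (E dα × E dy)).comp (.inl ℝ (E dα) (E dy)))) α := by
  have h2 : HasFDerivAt (fun α' : E dα => (x, α', y))
      ((ContinuousLinearMap.inr ℝ (E dx) (E dα × E dy)).comp (.inl ℝ (E dα) (E dy))) α :=
    (hasFDerivAt_prodMk_right x (α, y)).comp α (hasFDerivAt_prodMk_left α y)
  exact (h.hasFDerivAt_f i x hα y).comp α h2

theorem hasFDerivAt_f_y (i : Fin m) (x : E dx) {α : E dα} (hα : α ∈ p.A) (y : E dy) :
    HasFDerivAt (fun y' => p.f i x α y')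
      ((fderiv ℝ (fun q : E dx × E dα × E dy => p.f i q.1 q.2.1 q.2.2) (x, α, y)).comp
        ((ContinuousLinearMap.inr ℝ (E dx) (E dα × E dy)).comp (.inr ℝ (E dα) (E dy)))) y := by
  have h2 : HasFDerivAt (fun y' : E dy => (x, α, y'))
      ((ContinuousLinearMap.inr ℝ (E dx) (E dα × E dy)).comp (.inr ℝ (E dα) (E dy))) y :=
    (hasFDerivAt_prodMk_right x (α, y)).comp y (hasFDerivAt_prodMk_right α y)
  exact (h.hasFDerivAt_f i x hα y).comp y h2

theorem fderiv_f_apply (i : Fin m) (x : E dx) {α : E dα} (hα : α ∈ p.A) (y : E dy)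
    (v : E dx × E dα × E dy) :
    fderiv ℝ (fun q : E dx × E dα × E dy => p.f i q.1 q.2.1 q.2.2) (x, α, y) v =
      inner ℝ (p.fx i x α y) v.1 + inner ℝ (p.fα i x α y) v.2.1 +
        inner ℝ (p.fy i x α y) v.2.2 := by
  simp only [fx, fα, fy, inner_gradient_left', (h.hasFDerivAt_f_x i x hα y).fderiv,
    (h.hasFDerivAt_f_α i x hα y).fderiv, (h.hasFDerivAt_f_y i x hα y).fderiv,
    ContinuousLinearMap.comp_apply, ContinuousLinearMap.inl_apply, ContinuousLinearMap.inr_apply,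
    ← map_add]
  simp

theorem fx_lip (hc : c.Pos) (i : Fin m) (x x' : E dx) {α α' : E dα} (hα : α ∈ p.A)
    (hα' : α' ∈ p.A) (y y' : E dy) :
    ‖p.fx i x α y - p.fx i x' α' y'‖ ≤ c.Lf * (‖x - x'‖ + ‖α - α'‖ + ‖y - y'‖) := by
  have := h.f_smooth i x x' α hα α' hα' y y'
  refine le_mul_add₃_of_sq hc.Lf.le (norm_nonneg _) (norm_nonneg _) (norm_nonneg _) ?_
  nlinarith [sq_nonneg ‖p.fα i x α y - p.fα i x' α' y'‖, sq_nonneg ‖p.fy i x α y - p.fy i x' α' y'‖]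

theorem fα_lip (hc : c.Pos) (i : Fin m) (x x' : E dx) {α α' : E dα} (hα : α ∈ p.A)
    (hα' : α' ∈ p.A) (y y' : E dy) :
    ‖p.fα i x α y - p.fα i x' α' y'‖ ≤ c.Lf * (‖x - x'‖ + ‖α - α'‖ + ‖y - y'‖) := by
  have := h.f_smooth i x x' α hα α' hα' y y'
  refine le_mul_add₃_of_sq hc.Lf.le (norm_nonneg _) (norm_nonneg _) (norm_nonneg _) ?_
  nlinarith [sq_nonneg ‖p.fx i x α y - p.fx i x' α' y'‖, sq_nonneg ‖p.fy i x α y - p.fy i x' α' y'‖]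

theorem fy_lip (hc : c.Pos) (i : Fin m) (x x' : E dx) {α α' : E dα} (hα : α ∈ p.A)
    (hα' : α' ∈ p.A) (y y' : E dy) :
    ‖p.fy i x α y - p.fy i x' α' y'‖ ≤ c.Lf * (‖x - x'‖ + ‖α - α'‖ + ‖y - y'‖) := by
  have := h.f_smooth i x x' α hα α' hα' y y'
  refine le_mul_add₃_of_sq hc.Lf.le (norm_nonneg _) (norm_nonneg _) (norm_nonneg _) ?_
  nlinarith [sq_nonneg ‖p.fx i x α y - p.fx i x' α' y'‖, sq_nonneg ‖p.fα i x α y - p.fα i x' α' y'‖]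

theorem norm_fx_le (hc : c.Pos) (i : Fin m) (x : E dx) {α : E dα} (hα : α ∈ p.A) (y : E dy) :
    ‖p.fx i x α y‖ ≤ c.Cf := by
  rw [fx, norm_gradient_eq]
  exact norm_fderiv_le_of_sq_le hc.Cf.le x fun x' => by
    simpa using h.f_lipschitz i x' x α hα α hα y y

theorem norm_fy_le (hc : c.Pos) (i : Fin m) (x : E dx) {α : E dα} (hα : α ∈ p.A) (y : E dy) :
    ‖p.fy i x α y‖ ≤ c.Cf := by
  rw [fy, norm_gradient_eq]
  exact norm_fderiv_le_of_sq_le hc.Cf.le y fun y' => by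
    simpa using h.f_lipschitz i x x α hα α hα y' y

theorem strongConvexOn_neg_f (i : Fin m) (x : E dx) (y : E dy) :
    StrongConvexOn p.A c.μf fun α => -p.f i x α y := (h.f_strongConcave i x y).neg

theorem fα_mono (i : Fin m) (x : E dx) {α α' : E dα} (hα : α ∈ p.A) (hα' : α' ∈ p.A) (y : E dy) :
    inner ℝ (p.fα i x α y - p.fα i x α' y) (α - α') ≤ -(c.μf * ‖α - α'‖ ^ 2) := by
  have h1 := le_fderiv_sub_of_strongConvexOn (h.strongConvexOn_neg_f i x y) hα hα'
    (h.hasFDerivAt_f_α i x hα y).neg (h.hasFDerivAt_f_α i x hα' y).neg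
  rw [inner_sub_left, fα, fα, inner_gradient_left', inner_gradient_left',
    (h.hasFDerivAt_f_α i x hα y).fderiv, (h.hasFDerivAt_f_α i x hα' y).fderiv]
  simp only [neg_apply] at h1
  linarith

theorem αSol_spec (hc : c.Pos) (i : Fin m) (x : E dx) :
    p.αSol i x ∈ p.A ∧ IsMaxOn (fun α => p.f i x α (p.ySol i x)) p.A (p.αSol i x) := by
  apply argmaxOn_spec
  obtain ⟨a, ha, hm⟩ := exists_isMinOn_of_strongConvexOn (h.strongConvexOn_neg_f i x (p.ySol i x))
    hc.μf h.A_closed h.A_nonempty fun α hα => (h.hasFDerivAt_f_α i x hα _).neg.differentiableAt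
  exact ⟨a, ha, by simpa using hm.neg⟩

theorem αSol_mem (hc : c.Pos) (i : Fin m) (x : E dx) : p.αSol i x ∈ p.A := (h.αSol_spec hc i x).1

/-- The maximiser may lie on the boundary of `A`, so stationarity takes the form of a variational
inequality. -/
theorem αSol_vi (hc : c.Pos) (i : Fin m) (x : E dx) {b : E dα} (hb : b ∈ p.A) :
    inner ℝ (p.fα i x (p.αSol i x) (p.ySol i x)) (b - p.αSol i x) ≤ 0 := by
  obtain ⟨h1, h2⟩ := h.αSol_spec hc i x
  have h3 := fderiv_sub_nonneg_of_isMinOn h2.neg h.A_convex h1 hb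
    (h.hasFDerivAt_f_α i x h1 _).neg
  rw [fα, inner_gradient_left', (h.hasFDerivAt_f_α i x h1 _).fderiv]
  simp only [neg_apply] at h3
  linarith

end Upper

section Lower

theorem hasFDerivAt_g (i : Fin m) (x : E dx) (y : E dy) :
    HasFDerivAt (fun q : E dx × E dy => p.g i q.1 q.2)
      (fderiv ℝ (fun q : E dx × E dy => p.g i q.1 q.2) (x, y)) (x, y) :=
  (h.g_diff i (x, y)).hasFDerivAt

theorem hasFDerivAt_g_y (i : Fin m) (x : E dx) (y : E dy) :
    HasFDerivAt (fun y' => p.g i x y')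
      ((fderiv ℝ (fun q : E dx × E dy => p.g i q.1 q.2) (x, y)).comp (.inr ℝ _ _)) y :=
  (h.hasFDerivAt_g i x y).comp y (hasFDerivAt_prodMk_right x y)

theorem inner_gx (i : Fin m) (x : E dx) (y : E dy) (v : E dx) :
    inner ℝ (p.gx i x y) v = fderiv ℝ (fun q : E dx × E dy => p.g i q.1 q.2) (x, y) (v, 0) := by
  have : HasFDerivAt (fun x' => p.g i x' y)
      ((fderiv ℝ (fun q : E dx × E dy => p.g i q.1 q.2) (x, y)).comp (.inl ℝ _ _)) x :=
    (h.hasFDerivAt_g i x y).comp (f := fun x' : E dx => (x', y)) x (hasFDerivAt_prodMk_left x y)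
  rw [gx, inner_gradient_left', this.fderiv]
  simp

theorem inner_gy (i : Fin m) (x : E dx) (y v : E dy) :
    inner ℝ (p.gy i x y) v = fderiv ℝ (fun q : E dx × E dy => p.g i q.1 q.2) (x, y) (0, v) := by
  rw [gy, inner_gradient_left', (h.hasFDerivAt_g_y i x y).fderiv]
  simp

/-- Coordinate `k` of the partial gradient is the total derivative evaluated at a fixed basis
vector, hence inherits its differentiability. -/
theorem differentiable_gy (i : Fin m) :
    Differentiable ℝ fun q : E dx × E dy => p.gy i q.1 q.2 := by
  rw [differentiable_euclidean]
  intro k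
  have h1 : (fun q : E dx × E dy => p.gy i q.1 q.2 k) = fun q =>
      fderiv ℝ (fun q : E dx × E dy => p.g i q.1 q.2) q (0, EuclideanSpace.single k 1) := by
    ext q
    rw [← h.inner_gy, EuclideanSpace.inner_single_right]
    simp
  rw [h1]
  exact (h.g_diff_twice i).clm_apply (differentiable_const _)

theorem differentiable_gx (i : Fin m) :
    Differentiable ℝ fun q : E dx × E dy => p.gx i q.1 q.2 := by
  rw [differentiable_euclidean]
  intro k
  have h1 : (fun q : E dx × E dy => p.gx i q.1 q.2 k) = fun q =>
      fderiv ℝ (fun q : E dx × E dy => p.g i q.1 q.2) q (EuclideanSpace.single k 1, 0) := by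
    ext q
    rw [← h.inner_gx, EuclideanSpace.inner_single_right]
    simp
  rw [h1]
  exact (h.g_diff_twice i).clm_apply (differentiable_const _)

theorem hasFDerivAt_gy_y (i : Fin m) (x : E dx) (y : E dy) :
    HasFDerivAt (fun y' => p.gy i x y') (p.gyy i x y) y :=
  ((h.differentiable_gy i (x, y)).hasFDerivAt.comp y
    (hasFDerivAt_prodMk_right x y)).differentiableAt.hasFDerivAt

theorem fderiv_gy_inr (i : Fin m) (x : E dx) (y v : E dy) :
    fderiv ℝ (fun q : E dx × E dy => p.gy i q.1 q.2) (x, y) (0, v) = p.gyy i x y v := by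
  have h1 : HasFDerivAt (fun y' => p.gy i x y')
      ((fderiv ℝ (fun q : E dx × E dy => p.gy i q.1 q.2) (x, y)).comp (.inr ℝ _ _)) y :=
    (h.differentiable_gy i (x, y)).hasFDerivAt.comp y (hasFDerivAt_prodMk_right x y)
  rw [(h.hasFDerivAt_gy_y i x y).unique h1]
  simp

theorem inner_fderiv_gy (i : Fin m) (x : E dx) (y : E dy) (u : E dx × E dy) (v : E dy) :
    inner ℝ (fderiv ℝ (fun q : E dx × E dy => p.gy i q.1 q.2) (x, y) u) v =
      fderiv ℝ (fderiv ℝ fun q : E dx × E dy => p.g i q.1 q.2) (x, y) u (0, v) := by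
  have h1 := (h.differentiable_gy i (x, y)).hasFDerivAt.inner ℝ
    (hasFDerivAt_const v ((x, y) : E dx × E dy))
  have h2 := (h.g_diff_twice i (x, y)).hasFDerivAt.clm_apply
    (hasFDerivAt_const ((0, v) : E dx × E dy) ((x, y) : E dx × E dy))
  have h3 : (fun q : E dx × E dy => inner ℝ (p.gy i q.1 q.2) v) = fun q =>
      fderiv ℝ (fun q : E dx × E dy => p.g i q.1 q.2) q (0, v) := by
    ext q; exact h.inner_gy i q.1 q.2 v
  rw [h3] at h1
  have h4 := congrArg (fun L : (E dx × E dy) →L[ℝ] ℝ => L u) (h1.unique h2)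
  simpa using h4

theorem inner_gxy (i : Fin m) (x : E dx) (y v : E dy) (u : E dx) :
    inner ℝ (p.gxy i x y v) u =
      fderiv ℝ (fderiv ℝ fun q : E dx × E dy => p.g i q.1 q.2) (x, y) (0, v) (u, 0) := by
  have h0 : HasFDerivAt (fun y' => p.gx i x y')
      ((fderiv ℝ (fun q : E dx × E dy => p.gx i q.1 q.2) (x, y)).comp (.inr ℝ _ _)) y :=
    (h.differentiable_gx i (x, y)).hasFDerivAt.comp y (hasFDerivAt_prodMk_right x y)
  have h1 := (h.differentiable_gx i (x, y)).hasFDerivAt.inner ℝ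
    (hasFDerivAt_const u ((x, y) : E dx × E dy))
  have h2 := (h.g_diff_twice i (x, y)).hasFDerivAt.clm_apply
    (hasFDerivAt_const ((u, 0) : E dx × E dy) ((x, y) : E dx × E dy))
  have h3 : (fun q : E dx × E dy => inner ℝ (p.gx i q.1 q.2) u) = fun q =>
      fderiv ℝ (fun q : E dx × E dy => p.g i q.1 q.2) q (u, 0) := by
    ext q; exact h.inner_gx i q.1 q.2 u
  rw [h3] at h1
  have h4 := congrArg (fun L : (E dx × E dy) →L[ℝ] ℝ => L (0, v)) (h1.unique h2)
  rw [gxy, h0.fderiv]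
  simpa using h4

theorem fderiv_fderiv_g_symm (i : Fin m) (q u v : E dx × E dy) :
    fderiv ℝ (fderiv ℝ fun q : E dx × E dy => p.g i q.1 q.2) q u v =
      fderiv ℝ (fderiv ℝ fun q : E dx × E dy => p.g i q.1 q.2) q v u :=
  second_derivative_symmetric (fun q => (h.g_diff i q).hasFDerivAt)
    (h.g_diff_twice i q).hasFDerivAt u v

/-- Symmetry of the second derivative: `∇²_{xy} g` is the adjoint of the `x`-derivative of `∇_y g`.
This turns the implicit derivative of `y_i` into the product that appears in the hypergradient. -/
theorem inner_gxy_eq (i : Fin m) (x : E dx) (y v : E dy) (u : E dx) :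
    inner ℝ (p.gxy i x y v) u =
      inner ℝ (fderiv ℝ (fun q : E dx × E dy => p.gy i q.1 q.2) (x, y) (u, 0)) v := by
  rw [h.inner_gxy, h.inner_fderiv_gy, h.fderiv_fderiv_g_symm]

theorem gyy_symm (i : Fin m) (x : E dx) (y u v : E dy) :
    inner ℝ (p.gyy i x y u) v = inner ℝ u (p.gyy i x y v) := by
  rw [← h.fderiv_gy_inr, ← h.fderiv_gy_inr, h.inner_fderiv_gy,
    real_inner_comm, h.inner_fderiv_gy, h.fderiv_fderiv_g_symm]

theorem gy_lip (hc : c.Pos) (i : Fin m) (x x' : E dx) (y y' : E dy) :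
    ‖p.gy i x y - p.gy i x' y'‖ ≤ c.Lg * (‖x - x'‖ + ‖y - y'‖) := by
  have := h.g_smooth i x x' y y'
  refine le_mul_add_of_sq hc.Lg.le (norm_nonneg _) (norm_nonneg _) ?_
  nlinarith [sq_nonneg ‖p.gx i x y - p.gx i x' y'‖]

theorem gxy_lip (hc : c.Pos) (i : Fin m) (x x' : E dx) (y y' : E dy) :
    ‖p.gxy i x y - p.gxy i x' y'‖ ≤ c.Lgxy * (‖x - x'‖ + ‖y - y'‖) :=
  le_mul_add_of_sq hc.Lgxy.le (norm_nonneg _) (norm_nonneg _) (h.gxy_lipschitz i x x' y y')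

theorem gyy_lip (hc : c.Pos) (i : Fin m) (x x' : E dx) (y y' : E dy) :
    ‖p.gyy i x y - p.gyy i x' y'‖ ≤ c.Lgyy * (‖x - x'‖ + ‖y - y'‖) :=
  le_mul_add_of_sq hc.Lgyy.le (norm_nonneg _) (norm_nonneg _) (h.gyy_lipschitz i x x' y y')

theorem norm_gxy_le (hc : c.Pos) (i : Fin m) (x : E dx) (y : E dy) : ‖p.gxy i x y‖ ≤ c.Cgxy :=
  (abs_le_of_sq_le_sq' (h.gxy_bound i x y) hc.Cgxy.le).2

theorem norm_gyy_le (hc : c.Pos) (i : Fin m) (x : E dx) (y : E dy) : ‖p.gyy i x y‖ ≤ c.Lg := by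
  refine norm_fderiv_le_of_sq_le hc.Lg.le y fun y' => ?_
  have := h.g_smooth i x x y' y
  simp only [sub_self, norm_zero] at this
  nlinarith [sq_nonneg ‖p.gx i x y' - p.gx i x y‖]

theorem gy_mono (i : Fin m) (x : E dx) (y y' : E dy) :
    c.μg * ‖y - y'‖ ^ 2 ≤ inner ℝ (p.gy i x y - p.gy i x y') (y - y') := by
  have h1 := le_fderiv_sub_of_strongConvexOn (h.g_strongConvex i x) (mem_univ y) (mem_univ y')
    (h.hasFDerivAt_g_y i x y) (h.hasFDerivAt_g_y i x y')
  rw [inner_sub_left, h.inner_gy, h.inner_gy]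
  simpa using h1

/-- Strong monotonicity of `∇_y g` between `y + t v` and `y`, divided by `t²`, in the limit `t →
0+`. -/
theorem gyy_coercive (i : Fin m) (x : E dx) (y : E dy) : Coercive c.μg (p.gyy i x y) := by
  intro v
  have hd : HasDerivAt (fun t : ℝ => p.gy i x (y + t • v)) (p.gyy i x y v) 0 := by
    have h1 : HasDerivAt (fun t : ℝ => y + t • v) v 0 := by
      simpa using ((hasDerivAt_id (0 : ℝ)).smul_const v).const_add y
    have h2 : HasFDerivAt (fun y' => p.gy i x y') (p.gyy i x y) (y + (0 : ℝ) • v) := by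
      simpa using h.hasFDerivAt_gy_y i x y
    exact h2.comp_hasDerivAt 0 h1
  have ht : Tendsto (fun t : ℝ => inner ℝ (t⁻¹ • (p.gy i x (y + (0 + t) • v) -
      p.gy i x (y + (0 : ℝ) • v))) v) (𝓝[>] 0) (𝓝 (inner ℝ (p.gyy i x y v) v)) :=
    hd.tendsto_slope_zero_right.inner tendsto_const_nhds
  refine ge_of_tendsto ht ?_
  filter_upwards [self_mem_nhdsWithin] with t ht
  have ht : 0 < t := ht
  have h3 := h.gy_mono i x (y + t • v) y
  simp only [add_sub_cancel_left, norm_smul, mul_pow, inner_smul_right, Real.norm_eq_abs,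
    sq_abs] at h3
  simp only [zero_add, zero_smul, add_zero, real_inner_smul_left]
  rw [inv_mul_eq_div, le_div_iff₀ ht]
  nlinarith

theorem gy_ySol (hc : c.Pos) (i : Fin m) (x : E dx) : p.gy i x (p.ySol i x) = 0 := by
  obtain ⟨-, h2⟩ : p.ySol i x ∈ univ ∧ IsMinOn (fun y => p.g i x y) univ (p.ySol i x) :=
    argminOn_spec (exists_isMinOn_of_strongConvexOn (h.g_strongConvex i x) hc.μg isClosed_univ
      univ_nonempty fun y _ => (h.hasFDerivAt_g_y i x y).differentiableAt)
  have h3 : IsLocalMin (fun y => p.g i x y) (p.ySol i x) := h2.isLocalMin univ_mem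
  rw [gy, gradient, h3.fderiv_eq_zero, map_zero]

/-- Strong monotonicity at `x'` between the two solutions. Both optimality conditions vanish, so
only the change of `∇_y g` from `x` to `x'` at the same `y` remains. -/
theorem ySol_lip (hc : c.Pos) (i : Fin m) (x x' : E dx) :
    ‖p.ySol i x - p.ySol i x'‖ ≤ c.Cy * ‖x - x'‖ := by
  have h1 := h.gy_mono i x' (p.ySol i x) (p.ySol i x')
  have h2 : p.gy i x' (p.ySol i x) - p.gy i x' (p.ySol i x') =
      p.gy i x' (p.ySol i x) - p.gy i x (p.ySol i x) := by
    rw [h.gy_ySol hc, h.gy_ySol hc]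
  have h3 := h.gy_lip hc i x' x (p.ySol i x) (p.ySol i x)
  rw [sub_self, norm_zero, add_zero, norm_sub_rev x' x] at h3
  rw [h2] at h1
  have h4 := h1.trans (real_inner_le_norm _ _)
  rw [Consts.Cy, div_mul_eq_mul_div, le_div_iff₀ hc.μg]
  rcases eq_or_lt_of_le (norm_nonneg (p.ySol i x - p.ySol i x')) with h0 | h0
  · rw [← h0, zero_mul]; exact mul_nonneg hc.Lg.le (norm_nonneg _)
  · nlinarith

end Lower

/-- Each maximiser is tested in the variational inequality of the other. The sum, with strong
monotonicity at `x'`, leaves only the change of `∇_α f` when `(x, y_i(x))` moves at fixed `α`;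
whence the factor `1 + C_y`. -/
theorem αSol_lip (hc : c.Pos) (i : Fin m) (x x' : E dx) :
    ‖p.αSol i x - p.αSol i x'‖ ≤ c.Cα * (1 + c.Cy) * ‖x - x'‖ := by
  have hA := h.αSol_mem hc i x
  have hA' := h.αSol_mem hc i x'
  have h1 := h.fα_mono i x' hA hA' (p.ySol i x')
  have h2 := h.αSol_vi hc i x hA'
  have h3 := h.αSol_vi hc i x' hA
  have h4 := h.fα_lip hc i x x' hA hA (p.ySol i x) (p.ySol i x')
  have h5 := h.ySol_lip hc i x x'
  rw [sub_self, norm_zero, add_zero] at h4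
  set a := p.αSol i x
  set a' := p.αSol i x'
  have h6 : inner ℝ (p.fα i x a (p.ySol i x)) (a' - a) =
      - inner ℝ (p.fα i x a (p.ySol i x)) (a - a') := by rw [← inner_neg_right, neg_sub]
  have h7 : c.μf * ‖a - a'‖ ^ 2 ≤
      inner ℝ (p.fα i x a (p.ySol i x) - p.fα i x' a (p.ySol i x')) (a - a') := by
    rw [inner_sub_left] at h1 ⊢
    linarith
  have h8 := h7.trans (real_inner_le_norm _ _)
  have h9 : ‖p.fα i x a (p.ySol i x) - p.fα i x' a (p.ySol i x')‖ ≤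
      c.Lf * ((1 + c.Cy) * ‖x - x'‖) :=
    h4.trans (mul_le_mul_of_nonneg_left (by linarith) hc.Lf.le)
  have h10 : c.Cα * (1 + c.Cy) * ‖x - x'‖ = c.Lf * ((1 + c.Cy) * ‖x - x'‖) / c.μf := by
    rw [Consts.Cα]; ring
  rw [h10, le_div_iff₀ hc.μf]
  have h11 := (norm_nonneg _).trans h9
  rcases eq_or_lt_of_le (norm_nonneg (a - a')) with h0 | h0
  · rw [← h0, zero_mul]; exact h11
  · nlinarith

end Regular

end Problem

end MinMaxBilevel

/-! ### The hypergradient: formula, bounds, Lipschitz continuity, descent. -/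

namespace MinMaxBilevel

open Filter Topology Set Asymptotics

namespace Consts

variable (c : Consts)

/-- A bound for the joint displacement of `(x, α_i(x), y_i(x))` relative to that of `x`. -/
noncomputable def Lsol : ℝ := 1 + c.Cα * (1 + c.Cy) + c.Cy

/-- A Lipschitz constant of `Problem.hyper` with the Hessian estimate held fixed. -/
noncomputable def Lhyp : ℝ := c.Lf + c.Lgxy * (c.μg⁻¹ * c.Cf) + c.Cgxy * (c.μg⁻¹ * c.Lf)

/-- A Lipschitz constant of `Problem.dir`. -/
noncomputable def Ldir : ℝ := (c.μg⁻¹ * c.Lf + c.μg⁻¹ * (c.Lgyy * (c.μg⁻¹ * c.Cf))) * c.Lsol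

/-- A Lipschitz constant of the gradient of `Problem.F`. -/
noncomputable def Lgrad : ℝ :=
  (c.Lhyp + c.Cgxy * (c.μg⁻¹ * (c.Lgyy * (c.μg⁻¹ * c.Cf)))) * c.Lsol

/-- A bound for `Problem.hyper`. -/
noncomputable def Bhyp : ℝ := c.Cf + c.Cgxy * (c.μg⁻¹ * c.Cf)

variable {c}

theorem Pos.Cα_pos (hc : c.Pos) : 0 < c.Cα := div_pos hc.Lf hc.μf

theorem Pos.Cy_pos (hc : c.Pos) : 0 < c.Cy := div_pos hc.Lg hc.μg

theorem Pos.Lsol_pos (hc : c.Pos) : 0 < c.Lsol := by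
  have := hc.Cα_pos; have := hc.Cy_pos; unfold Lsol; positivity

theorem Pos.Lhyp_pos (hc : c.Pos) : 0 < c.Lhyp := by
  obtain ⟨_, _, _, _, _, _, _, _, _⟩ := hc; unfold Lhyp; positivity

theorem Pos.Ldir_pos (hc : c.Pos) : 0 < c.Ldir := by
  have := hc.Lsol_pos; obtain ⟨_, _, _, _, _, _, _, _, _⟩ := hc; unfold Ldir; positivity

theorem Pos.Lgrad_pos (hc : c.Pos) : 0 < c.Lgrad := by
  have := hc.Lsol_pos; have := hc.Lhyp_pos; obtain ⟨_, _, _, _, _, _, _, _, _⟩ := hc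
  unfold Lgrad; positivity

theorem Pos.Bhyp_pos (hc : c.Pos) : 0 < c.Bhyp := by
  obtain ⟨_, _, _, _, _, _, _, _, _⟩ := hc; unfold Bhyp; positivity

end Consts

/-- Resolvent identity, with both inverses bounded by `1/μ_g`. -/
theorem norm_inverse_sub_inverse_apply_le {d : ℕ} {c : Consts} (hc : c.Pos)
    {s t : E d →L[ℝ] E d} (hs : Coercive c.μg s)
    (ht : Coercive c.μg t) {v : E d} (hv : ‖v‖ ≤ c.Cf) :
    ‖s.inverse v - t.inverse v‖ ≤ c.μg⁻¹ * (‖t - s‖ * (c.μg⁻¹ * c.Cf)) := by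
  have hμ := inv_nonneg.mpr hc.μg.le
  rw [hs.inverse_sub_inverse_apply hc.μg ht]
  refine (hs.norm_inverse_apply_le hc.μg _).trans (mul_le_mul_of_nonneg_left ?_ hμ)
  refine ((t - s).le_opNorm _).trans (mul_le_mul_of_nonneg_left ?_ (norm_nonneg _))
  exact (ht.norm_inverse_apply_le hc.μg _).trans (mul_le_mul_of_nonneg_left hv hμ)

theorem norm_avg_le {V : Type*} [SeminormedAddCommGroup V] [NormedSpace ℝ V] {m : ℕ} (hm : 1 ≤ m)
    (v : Fin m → V) {C : ℝ} (hv : ∀ i, ‖v i‖ ≤ C) : ‖(1 / (m : ℝ)) • ∑ i, v i‖ ≤ C := by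
  have hm' : (0 : ℝ) < m := by exact_mod_cast hm
  rw [norm_smul, Real.norm_eq_abs, abs_of_pos (by positivity), one_div, inv_mul_le_iff₀ hm']
  simpa using norm_sum_le_of_le Finset.univ fun i _ => hv i

namespace Problem.Regular

variable {m dx dα dy : ℕ} {p : Problem m dx dα dy} {c : Consts} (h : p.Regular c)
include h

theorem hess_coercive (i : Fin m) (x : E dx) : Coercive c.μg (p.hess i x) := h.gyy_coercive i x _

theorem norm_hess_le (hc : c.Pos) (i : Fin m) (x : E dx) : ‖p.hess i x‖ ≤ c.Lg :=
  h.norm_gyy_le hc i x _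

theorem norm_fySol_le (hc : c.Pos) (i : Fin m) (x : E dx) : ‖p.fySol i x‖ ≤ c.Cf :=
  h.norm_fy_le hc i x (h.αSol_mem hc i x) _

theorem norm_dir_le (hc : c.Pos) (i : Fin m) (x : E dx) : ‖p.dir i x‖ ≤ c.μg⁻¹ * c.Cf :=
  ((h.hess_coercive i x).norm_inverse_apply_le hc.μg _).trans
    (mul_le_mul_of_nonneg_left (h.norm_fySol_le hc i x) (inv_nonneg.mpr hc.μg.le))

theorem sol_lip (hc : c.Pos) (i : Fin m) (x x' : E dx) :
    ‖x - x'‖ + ‖p.αSol i x - p.αSol i x'‖ + ‖p.ySol i x - p.ySol i x'‖ ≤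
      c.Lsol * ‖x - x'‖ := by
  have h1 := h.αSol_lip hc i x x'
  have h2 := h.ySol_lip hc i x x'
  rw [Consts.Lsol]
  linarith

theorem hess_lip (hc : c.Pos) (i : Fin m) (x x' : E dx) :
    ‖p.hess i x - p.hess i x'‖ ≤ c.Lgyy * (1 + c.Cy) * ‖x - x'‖ := by
  refine (h.gyy_lip hc i x x' _ _).trans ?_
  rw [mul_assoc]
  have h2 := h.ySol_lip hc i x x'
  exact mul_le_mul_of_nonneg_left (by linarith) hc.Lgyy.le

theorem hess_lip' (hc : c.Pos) (i : Fin m) (x x' : E dx) :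
    ‖p.hess i x - p.hess i x'‖ ≤ c.Lgyy * (c.Lsol * ‖x - x'‖) := by
  refine (h.gyy_lip hc i x x' _ _).trans (mul_le_mul_of_nonneg_left ?_ hc.Lgyy.le)
  have h2 := h.sol_lip hc i x x'
  linarith [norm_nonneg (p.αSol i x - p.αSol i x')]

theorem dir_lip (hc : c.Pos) (i : Fin m) (x x' : E dx) :
    ‖p.dir i x - p.dir i x'‖ ≤ c.Ldir * ‖x - x'‖ := by
  have hμ := inv_nonneg.mpr hc.μg.le
  have h1 : p.dir i x - p.dir i x' = (p.hess i x).inverse (p.fySol i x - p.fySol i x') +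
      ((p.hess i x).inverse (p.fySol i x') - (p.hess i x').inverse (p.fySol i x')) := by
    rw [map_sub, dir, dir]; abel
  have h2 : ‖p.fySol i x - p.fySol i x'‖ ≤ c.Lf * (c.Lsol * ‖x - x'‖) :=
    (h.fy_lip hc i x x' (h.αSol_mem hc i x) (h.αSol_mem hc i x') _ _).trans
      (mul_le_mul_of_nonneg_left (h.sol_lip hc i x x') hc.Lf.le)
  have h3 := norm_inverse_sub_inverse_apply_le hc (h.hess_coercive i x) (h.hess_coercive i x')
    (h.norm_fySol_le hc i x')
  have h4 := h.hess_lip' hc i x' x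
  rw [norm_sub_rev x' x] at h4
  have h5 := ((h.hess_coercive i x).norm_inverse_apply_le hc.μg
    (p.fySol i x - p.fySol i x')).trans (mul_le_mul_of_nonneg_left h2 hμ)
  have h6 : c.μg⁻¹ * (‖p.hess i x' - p.hess i x‖ * (c.μg⁻¹ * c.Cf)) ≤
      c.μg⁻¹ * (c.Lgyy * (c.Lsol * ‖x - x'‖) * (c.μg⁻¹ * c.Cf)) :=
    mul_le_mul_of_nonneg_left (mul_le_mul_of_nonneg_right h4 (mul_nonneg hμ hc.Cf.le)) hμ
  rw [h1]
  refine (norm_add_le _ _).trans ?_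
  rw [Consts.Ldir]
  linarith

/-- One factor is changed at a time, with the Hessian estimate last. The effect of replacing `s` by
`s'` is thus isolated as a difference of two linear solves with the right-hand side at the primed
point; when that point is the exact solution, only the residual in the direction `dir` matters. -/
theorem hyper_sub_le (hc : c.Pos) (i : Fin m) (x x' : E dx) {α α' : E dα} (hα : α ∈ p.A)
    (hα' : α' ∈ p.A) (y y' : E dy) {s : E dy →L[ℝ] E dy} (s' : E dy →L[ℝ] E dy)
    (hs : Coercive c.μg s) :
    ‖p.hyper i x α y s - p.hyper i x' α' y' s'‖ ≤
      c.Lhyp * (‖x - x'‖ + ‖α - α'‖ + ‖y - y'‖) +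
        c.Cgxy * ‖s.inverse (p.fy i x' α' y') - s'.inverse (p.fy i x' α' y')‖ := by
  have hμ := inv_nonneg.mpr hc.μg.le
  set d := ‖x - x'‖ + ‖α - α'‖ + ‖y - y'‖ with hd
  have hd0 : 0 ≤ d := by positivity
  have h1 : p.hyper i x α y s - p.hyper i x' α' y' s' = (p.fx i x α y - p.fx i x' α' y') -
      (p.gxy i x y - p.gxy i x' y') (s.inverse (p.fy i x α y)) -
      p.gxy i x' y' (s.inverse (p.fy i x α y - p.fy i x' α' y')) -
      p.gxy i x' y' (s.inverse (p.fy i x' α' y') - s'.inverse (p.fy i x' α' y')) := by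
    simp only [hyper, sub_apply, map_sub]; abel
  have e1 := h.fx_lip hc i x x' hα hα' y y'
  have e2 : ‖(p.gxy i x y - p.gxy i x' y') (s.inverse (p.fy i x α y))‖ ≤
      (c.Lgxy * d) * (c.μg⁻¹ * c.Cf) := by
    refine ((_ : E dy →L[ℝ] E dx).le_opNorm _).trans (mul_le_mul ?_ ?_ (norm_nonneg _) ?_)
    · refine (h.gxy_lip hc i x x' y y').trans (mul_le_mul_of_nonneg_left ?_ hc.Lgxy.le)
      linarith [norm_nonneg (α - α')]
    · exact (hs.norm_inverse_apply_le hc.μg _).trans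
        (mul_le_mul_of_nonneg_left (h.norm_fy_le hc i x hα y) hμ)
    · exact mul_nonneg hc.Lgxy.le hd0
  have e3 : ‖p.gxy i x' y' (s.inverse (p.fy i x α y - p.fy i x' α' y'))‖ ≤
      c.Cgxy * (c.μg⁻¹ * (c.Lf * d)) := by
    refine ((_ : E dy →L[ℝ] E dx).le_opNorm _).trans (mul_le_mul (h.norm_gxy_le hc i x' y') ?_
      (norm_nonneg _) hc.Cgxy.le)
    exact (hs.norm_inverse_apply_le hc.μg _).trans
      (mul_le_mul_of_nonneg_left (h.fy_lip hc i x x' hα hα' y y') hμ)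
  have e4 : ‖p.gxy i x' y' (s.inverse (p.fy i x' α' y') - s'.inverse (p.fy i x' α' y'))‖ ≤
      c.Cgxy * ‖s.inverse (p.fy i x' α' y') - s'.inverse (p.fy i x' α' y')‖ :=
    ((_ : E dy →L[ℝ] E dx).le_opNorm _).trans
      (mul_le_mul_of_nonneg_right (h.norm_gxy_le hc i x' y') (norm_nonneg _))
  rw [h1]
  refine (norm_sub_le _ _).trans ?_
  have e5 := norm_sub_le (p.fx i x α y - p.fx i x' α' y' -
      (p.gxy i x y - p.gxy i x' y') (s.inverse (p.fy i x α y)))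
      (p.gxy i x' y' (s.inverse (p.fy i x α y - p.fy i x' α' y')))
  have e6 := norm_sub_le (p.fx i x α y - p.fx i x' α' y')
    ((p.gxy i x y - p.gxy i x' y') (s.inverse (p.fy i x α y)))
  rw [Consts.Lhyp]
  linarith

theorem norm_hyper_le (hc : c.Pos) (i : Fin m) (x : E dx) {α : E dα} (hα : α ∈ p.A) (y : E dy)
    {s : E dy →L[ℝ] E dy} (hs : Coercive c.μg s) : ‖p.hyper i x α y s‖ ≤ c.Bhyp := by
  refine (norm_sub_le _ _).trans (add_le_add (h.norm_fx_le hc i x hα y) ?_)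
  refine ((_ : E dy →L[ℝ] E dx).le_opNorm _).trans (mul_le_mul (h.norm_gxy_le hc i x y) ?_
    (norm_nonneg _) hc.Cgxy.le)
  exact (hs.norm_inverse_apply_le hc.μg _).trans
    (mul_le_mul_of_nonneg_left (h.norm_fy_le hc i x hα y) (inv_nonneg.mpr hc.μg.le))

/-- The lower-level solution is differentiable (implicit differentiation of `∇_y g_i = 0`). -/
theorem hasFDerivAt_ySol (hc : c.Pos) (i : Fin m) (x : E dx) :
    HasFDerivAt (p.ySol i) (-((p.hess i x).inverse.comp
      ((fderiv ℝ (fun q : E dx × E dy => p.gy i q.1 q.2) (x, p.ySol i x)).comp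
        (.inl ℝ (E dx) (E dy))))) x := by
  set D := fderiv ℝ (fun q : E dx × E dy => p.gy i q.1 q.2) (x, p.ySol i x) with hD
  have hcont : Tendsto (fun x' => (x', p.ySol i x')) (𝓝 x) (𝓝 (x, p.ySol i x)) := by
    have : Continuous (p.ySol i) :=
      (LipschitzWith.of_dist_le_mul (K := ⟨c.Cy, hc.Cy_pos.le⟩) fun a b => by
        rw [dist_eq_norm, dist_eq_norm]; exact h.ySol_lip hc i a b).continuous
    exact (continuous_id.prodMk this).tendsto x
  have h1 := ((h.differentiable_gy i (x, p.ySol i x)).hasFDerivAt.isLittleO.comp_tendsto hcont)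
  -- The Lipschitz bound already known for `y_i` turns an `o` of the joint displacement into an `o`
  -- of `x' - x`.
  have h2 : (fun x' : E dx => ((x', p.ySol i x') : E dx × E dy) - (x, p.ySol i x)) =O[𝓝 x]
      fun x' => x' - x := by
    refine IsBigO.of_bound (max 1 c.Cy) (Eventually.of_forall fun x' => ?_)
    rw [Prod.mk_sub_mk, Prod.norm_mk]
    refine max_le ?_ ?_
    · exact le_mul_of_one_le_left (norm_nonneg _) (le_max_left _ _)
    · exact (h.ySol_lip hc i x' x).trans
        (mul_le_mul_of_nonneg_right (le_max_right _ _) (norm_nonneg _))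
  have h3 := h1.trans_isBigO h2
  -- The inverse Hessian is applied to the expansion of `∇_y g(x', y(x')) = 0`, which is thereby
  -- solved for `y(x') - y(x)`.
  have h4 := ((p.hess i x).inverse.isBigO_comp (fun x' : E dx => p.gy i x' (p.ySol i x') -
    p.gy i x (p.ySol i x) - D ((x', p.ySol i x') - (x, p.ySol i x))) (𝓝 x)).trans_isLittleO h3
  refine HasFDerivAt.of_isLittleO (h4.neg_left.congr_left fun x' => ?_)
  have h5 : D ((x', p.ySol i x') - (x, p.ySol i x)) =
      D (x' - x, 0) + p.hess i x (p.ySol i x' - p.ySol i x) := by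
    rw [hess, ← h.fderiv_gy_inr, ← hD, ← map_add]
    simp
  rw [h.gy_ySol hc, h.gy_ySol hc, h5, sub_zero, zero_sub, map_neg, map_add,
    (h.hess_coercive i x).inverse_apply hc.μg]
  simp only [neg_neg, neg_apply, ContinuousLinearMap.comp_apply, ContinuousLinearMap.inl_apply]
  abel

theorem hess_inverse_symm (hc : c.Pos) (i : Fin m) (x : E dx) (u v : E dy) :
    inner ℝ ((p.hess i x).inverse u) v = inner ℝ u ((p.hess i x).inverse v) := by
  have hs := h.hess_coercive i x
  conv_lhs => rw [← hs.apply_inverse hc.μg v]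
  conv_rhs => rw [← hs.apply_inverse hc.μg u]
  exact (h.gyy_symm i x _ _ _).symm

/-- The gradient of one block of the objective. -/
theorem hasGradientAt_block (hc : c.Pos) (i : Fin m) (x : E dx) :
    HasGradientAt (fun x => p.f i x (p.αSol i x) (p.ySol i x))
      (p.hyper i x (p.αSol i x) (p.ySol i x) (p.hess i x)) x := by
  have hα := h.αSol_mem hc i x
  set Y := -((p.hess i x).inverse.comp
      ((fderiv ℝ (fun q : E dx × E dy => p.gy i q.1 q.2) (x, p.ySol i x)).comp
        (.inl ℝ (E dx) (E dy)))) with hY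
  have hy : HasFDerivAt (p.ySol i) Y x := h.hasFDerivAt_ySol hc i x
  have hf := h.hasFDerivAt_f i x hα (p.ySol i x)
  set D := fderiv ℝ (fun q : E dx × E dα × E dy => p.f i q.1 q.2.1 q.2.2)
    (x, p.αSol i x, p.ySol i x) with hD
  -- the function with the dual variable frozen
  have hψ : HasFDerivAt (fun x' => p.f i x' (p.αSol i x) (p.ySol i x'))
      (D.comp ((ContinuousLinearMap.id ℝ (E dx)).prod ((0 : E dx →L[ℝ] E dα).prod Y))) x :=
    hf.comp (f := fun x' => (x', p.αSol i x, p.ySol i x')) x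
      ((hasFDerivAt_id x).prodMk ((hasFDerivAt_const (p.αSol i x) x).prodMk hy))
  have hcα : Continuous (p.αSol i) :=
    (LipschitzWith.of_dist_le_mul
      (K := ⟨c.Cα * (1 + c.Cy), by have := hc.Cα_pos; have := hc.Cy_pos; positivity⟩)
      fun a b => by rw [dist_eq_norm, dist_eq_norm]; exact h.αSol_lip hc i a b).continuous
  have hcont : Tendsto (fun x' => (x', p.αSol i x', p.ySol i x')) (𝓝 x)
      (𝓝 (x, p.αSol i x, p.ySol i x)) :=
    tendsto_id.prodMk_nhds ((hcα.tendsto x).prodMk_nhds hy.continuousAt)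
  have hbig : (fun x' : E dx => ((x', p.αSol i x', p.ySol i x') : E dx × E dα × E dy) -
      (x, p.αSol i x, p.ySol i x)) =O[𝓝 x] fun x' => x' - x := by
    refine IsBigO.of_bound c.Lsol (Eventually.of_forall fun x' => ?_)
    refine le_trans ?_ (h.sol_lip hc i x' x)
    rw [Prod.mk_sub_mk, Prod.mk_sub_mk, Prod.norm_mk, Prod.norm_mk]
    have a1 := norm_nonneg (x' - x)
    have a2 := norm_nonneg (p.αSol i x' - p.αSol i x)
    have a3 := norm_nonneg (p.ySol i x' - p.ySol i x)
    exact max_le (by linarith) (max_le (by linarith) (by linarith))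
  have hr1 := (hf.isLittleO.comp_tendsto hcont).trans_isBigO hbig
  have hcont2 : Tendsto (fun x' => (x', p.αSol i x, p.ySol i x')) (𝓝 x)
      (𝓝 (x, p.αSol i x, p.ySol i x)) :=
    tendsto_id.prodMk_nhds (tendsto_const_nhds.prodMk_nhds hy.continuousAt)
  have hbig2 : (fun x' : E dx => ((x', p.αSol i x, p.ySol i x') : E dx × E dα × E dy) -
      (x, p.αSol i x, p.ySol i x)) =O[𝓝 x] fun x' => x' - x := by
    refine IsBigO.of_bound c.Lsol (Eventually.of_forall fun x' => ?_)
    refine le_trans ?_ (h.sol_lip hc i x' x)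
    rw [Prod.mk_sub_mk, Prod.mk_sub_mk, Prod.norm_mk, Prod.norm_mk]
    have a1 := norm_nonneg (x' - x)
    have a2 := norm_nonneg (p.αSol i x' - p.αSol i x)
    have a3 := norm_nonneg (p.ySol i x' - p.ySol i x)
    exact max_le (by linarith) (max_le (by simpa using by linarith) (by linarith))
  have hr2 := (hf.isLittleO.comp_tendsto hcont2).trans_isBigO hbig2
  -- Danskin's argument. The gain from re-optimising `α` is nonnegative by maximality at `x'`; to
  -- first order it is `⟨∇_α f, α(x') - α(x)⟩`, which is nonpositive by the variational inequality
  -- at `x`. So the gain is `o(x' - x)`, without any derivative of `α_i`.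
  have hdiff : (fun x' => p.f i x' (p.αSol i x') (p.ySol i x') -
      p.f i x' (p.αSol i x) (p.ySol i x')) =o[𝓝 x] fun x' => x' - x := by
    refine (IsBigO.of_bound 1 (Eventually.of_forall fun x' => ?_)).trans_isLittleO (hr1.sub hr2)
    have b1 : p.f i x' (p.αSol i x) (p.ySol i x') ≤ p.f i x' (p.αSol i x') (p.ySol i x') :=
      (h.αSol_spec hc i x').2 hα
    have b2 := h.αSol_vi hc i x (h.αSol_mem hc i x')
    have b3 : D ((x', p.αSol i x', p.ySol i x') - (x, p.αSol i x, p.ySol i x)) -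
        D ((x', p.αSol i x, p.ySol i x') - (x, p.αSol i x, p.ySol i x)) =
        inner ℝ (p.fα i x (p.αSol i x) (p.ySol i x)) (p.αSol i x' - p.αSol i x) := by
      rw [← map_sub, hD, h.fderiv_f_apply i x hα]
      simp
    rw [one_mul, Real.norm_eq_abs, Real.norm_eq_abs, abs_of_nonneg (sub_nonneg.mpr b1)]
    refine le_trans ?_ (le_abs_self _)
    simp only [Function.comp_apply]
    linarith
  -- The implicit derivative of `y_i` is moved to the other side of the inner product, by symmetry
  -- of the inverse Hessian and of the mixed second derivatives.
  have hlin : (D.comp ((ContinuousLinearMap.id ℝ (E dx)).prod ((0 : E dx →L[ℝ] E dα).prod Y))) =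
      InnerProductSpace.toDual ℝ _ (p.hyper i x (p.αSol i x) (p.ySol i x) (p.hess i x)) := by
    ext v
    rw [InnerProductSpace.toDual_apply_apply]
    simp only [ContinuousLinearMap.comp_apply, ContinuousLinearMap.prod_apply,
      ContinuousLinearMap.id_apply, zero_apply, hD, h.fderiv_f_apply i x hα, inner_zero_right,
      add_zero, hyper, inner_sub_left, hY, neg_apply, inner_neg_right, h.inner_gxy_eq,
      ContinuousLinearMap.inl_apply]
    rw [← h.hess_inverse_symm hc, real_inner_comm (fderiv ℝ _ _ _)]
    ring
  rw [hasGradientAt_iff_hasFDerivAt, ← hlin]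
  have h9 := hψ.add (f := fun x' => p.f i x' (p.αSol i x) (p.ySol i x'))
    (g := fun x' => p.f i x' (p.αSol i x') (p.ySol i x') -
      p.f i x' (p.αSol i x) (p.ySol i x')) (g' := 0)
    (HasFDerivAt.of_isLittleO (by simpa using hdiff))
  have h10 : (fun x' => p.f i x' (p.αSol i x') (p.ySol i x')) =
      (fun x' => p.f i x' (p.αSol i x) (p.ySol i x')) + fun x' =>
        p.f i x' (p.αSol i x') (p.ySol i x') - p.f i x' (p.αSol i x) (p.ySol i x') := by
    ext; simp
  rw [h10]
  simpa using h9

theorem hasGradientAt_F (hc : c.Pos) (x : E dx) :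
    HasGradientAt p.F ((1 / (m : ℝ)) • ∑ i, p.hyper i x (p.αSol i x) (p.ySol i x) (p.hess i x))
      x := by
  have h1 : HasFDerivAt (fun x => ∑ i, p.f i x (p.αSol i x) (p.ySol i x)) _ x :=
    HasFDerivAt.fun_sum (u := Finset.univ) fun i _ =>
      (h.hasGradientAt_block hc i x).hasFDerivAt
  rw [hasGradientAt_iff_hasFDerivAt, map_smul, map_sum]
  exact h1.const_mul (1 / (m : ℝ))

theorem gradient_F (hc : c.Pos) (x : E dx) : gradient p.F x =
    (1 / (m : ℝ)) • ∑ i, p.hyper i x (p.αSol i x) (p.ySol i x) (p.hess i x) :=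
  (h.hasGradientAt_F hc x).gradient

theorem hyper_sol_lip (hc : c.Pos) (i : Fin m) (x x' : E dx) :
    ‖p.hyper i x (p.αSol i x) (p.ySol i x) (p.hess i x) -
      p.hyper i x' (p.αSol i x') (p.ySol i x') (p.hess i x')‖ ≤ c.Lgrad * ‖x - x'‖ := by
  have hμ := inv_nonneg.mpr hc.μg.le
  have h1 := h.hyper_sub_le hc i x x' (h.αSol_mem hc i x) (h.αSol_mem hc i x') (p.ySol i x)
    (p.ySol i x') (p.hess i x') (h.hess_coercive i x)
  have h2 := norm_inverse_sub_inverse_apply_le hc (h.hess_coercive i x) (h.hess_coercive i x')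
    (h.norm_fySol_le hc i x')
  have h3 := h.hess_lip' hc i x' x
  rw [norm_sub_rev x' x] at h3
  have h4 := h.sol_lip hc i x x'
  have h5 : c.μg⁻¹ * (‖p.hess i x' - p.hess i x‖ * (c.μg⁻¹ * c.Cf)) ≤
      c.μg⁻¹ * (c.Lgyy * (c.Lsol * ‖x - x'‖) * (c.μg⁻¹ * c.Cf)) :=
    mul_le_mul_of_nonneg_left (mul_le_mul_of_nonneg_right h3 (mul_nonneg hμ hc.Cf.le)) hμ
  have h6 := mul_le_mul_of_nonneg_left (h2.trans h5) hc.Cgxy.le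
  have h7 := mul_le_mul_of_nonneg_left h4 hc.Lhyp_pos.le
  rw [fySol] at h6
  rw [Consts.Lgrad]
  linarith

theorem gradient_F_lip (hc : c.Pos) (hm : 1 ≤ m) (x x' : E dx) :
    ‖gradient p.F x - gradient p.F x'‖ ≤ c.Lgrad * ‖x - x'‖ := by
  rw [h.gradient_F hc, h.gradient_F hc, ← smul_sub, ← Finset.sum_sub_distrib]
  exact norm_avg_le hm _ fun i => h.hyper_sol_lip hc i x x'

theorem norm_gradient_F_le (hc : c.Pos) (hm : 1 ≤ m) (x : E dx) :
    ‖gradient p.F x‖ ≤ c.Bhyp := by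
  rw [h.gradient_F hc]
  exact norm_avg_le hm _ fun i =>
    h.norm_hyper_le hc i x (h.αSol_mem hc i x) _ (h.hess_coercive i x)

theorem differentiable_F (hc : c.Pos) : Differentiable ℝ p.F := fun x =>
  (h.hasGradientAt_F hc x).differentiableAt

/-- The descent inequality for `F`. -/
theorem F_descent (hc : c.Pos) (hm : 1 ≤ m) (x x' : E dx) :
    p.F x' ≤ p.F x + inner ℝ (gradient p.F x) (x' - x) + c.Lgrad * ‖x' - x‖ ^ 2 := by
  -- The mean value inequality for `F` minus its linearisation; this gives the coefficient `Lgrad`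
  -- instead of `Lgrad / 2`, which suffices.
  have h1 := (convex_segment x x').norm_image_sub_le_of_norm_hasFDerivWithin_le'
    (f := p.F) (f' := fderiv ℝ p.F) (φ := fderiv ℝ p.F x) (C := c.Lgrad * ‖x' - x‖)
    (fun u _ => (h.differentiable_F hc u).hasFDerivAt.hasFDerivWithinAt)
    (fun u hu => by
      have h2 := h.gradient_F_lip hc hm u x
      rw [gradient, gradient, ← map_sub, LinearIsometryEquiv.norm_map] at h2
      refine h2.trans (mul_le_mul_of_nonneg_left ?_ hc.Lgrad_pos.le)
      have := norm_sub_le_of_mem_segment hu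
      exact this)
    (left_mem_segment ℝ x x') (right_mem_segment ℝ x x')
  rw [← inner_gradient_left'] at h1
  have h3 := le_of_abs_le h1
  linarith

end Problem.Regular

end MinMaxBilevel

/-! ### Bounds on means, and calculus of unbiased estimates. -/

namespace MinMaxBilevel

open Filter Topology Set

/-- `φ` is integrable with integral at most `a`. -/
structure EBound {B : Type*} [MeasurableSpace B] (ν : Measure B) (φ : B → ℝ) (a : ℝ) : Prop where
  integrable : Integrable φ ν
  integral_le : ∫ β, φ β ∂ν ≤ a

namespace EBound

variable {B : Type*} [MeasurableSpace B] {ν : Measure B} {φ ψ : B → ℝ} {a b : ℝ}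

theorem mono (h : EBound ν φ a) (hab : a ≤ b) : EBound ν φ b := ⟨h.1, h.2.trans hab⟩

theorem add (h : EBound ν φ a) (h' : EBound ν ψ b) : EBound ν (fun β => φ β + ψ β) (a + b) :=
  ⟨h.1.add h'.1, by rw [integral_add h.1 h'.1]; exact add_le_add h.2 h'.2⟩

theorem const_mul (h : EBound ν φ a) {k : ℝ} (hk : 0 ≤ k) :
    EBound ν (fun β => k * φ β) (k * a) :=
  ⟨h.1.const_mul k, by rw [integral_const_mul]; exact mul_le_mul_of_nonneg_left h.2 hk⟩

theorem const [IsProbabilityMeasure ν] (a : ℝ) : EBound ν (fun _ => a) a :=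
  ⟨integrable_const a, by simp⟩

theorem sum {ι : Type*} (s : Finset ι) {φ : ι → B → ℝ} {a : ι → ℝ}
    (h : ∀ i ∈ s, EBound ν (φ i) (a i)) : EBound ν (fun β => ∑ i ∈ s, φ i β) (∑ i ∈ s, a i) :=
  ⟨integrable_finsetSum s fun i hi => (h i hi).1, by
    rw [integral_finsetSum s fun i hi => (h i hi).1]
    exact Finset.sum_le_sum fun i hi => (h i hi).2⟩

theorem mono_left (h : EBound ν ψ a) (hm : AEStronglyMeasurable φ ν) (h0 : ∀ β, 0 ≤ φ β)
    (hle : ∀ᵐ β ∂ν, φ β ≤ ψ β) : EBound ν φ a := by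
  have hi : Integrable φ ν := h.1.mono' hm (by
    filter_upwards [hle] with β hβ
    rwa [Real.norm_eq_abs, abs_of_nonneg (h0 β)])
  exact ⟨hi, (integral_mono_ae hi h.1 hle).trans h.2⟩

theorem nonneg_of (h : EBound ν φ a) (h0 : ∀ β, 0 ≤ φ β) : 0 ≤ a :=
  (integral_nonneg h0).trans h.2

theorem comp {B' : Type*} [MeasurableSpace B'] {ν' : Measure B'} {f : B' → B}
    (h : EBound ν φ a) (hf : MeasurePreserving f ν' ν) : EBound ν' (fun β => φ (f β)) a := by
  refine ⟨hf.integrable_comp_of_integrable h.1, ?_⟩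
  have : AEStronglyMeasurable φ (ν'.map f) := by rw [hf.map_eq]; exact h.1.aestronglyMeasurable
  rw [← integral_map hf.measurable.aemeasurable this, hf.map_eq]
  exact h.2

theorem prod_mul {B' : Type*} [MeasurableSpace B'] {ν' : Measure B'} [SFinite ν] [SFinite ν']
    {ψ : B' → ℝ} (h : EBound ν φ a) (h' : EBound ν' ψ b) (h0 : ∀ β, 0 ≤ φ β)
    (h0' : ∀ β, 0 ≤ ψ β) : EBound (ν.prod ν') (fun z => φ z.1 * ψ z.2) (a * b) :=
  ⟨h.1.mul_prod h'.1, by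
    rw [integral_prod_mul]
    exact mul_le_mul h.2 h'.2 (integral_nonneg h0') (h.nonneg_of h0)⟩

end EBound

namespace IsUnbiased

section Normed

variable {B V W : Type*} [MeasurableSpace B] [NormedAddCommGroup V] [NormedSpace ℝ V]
  [NormedAddCommGroup W] [NormedSpace ℝ W] {ν : Measure B} {O : B → V} {v : V} {s : ℝ}

theorem ebound (h : IsUnbiased ν O v s) : EBound ν (fun β => ‖O β - v‖ ^ 2) s :=
  ⟨h.integrable_sq, h.variance⟩

theorem comp {B' : Type*} [MeasurableSpace B'] {ν' : Measure B'} {f : B' → B}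
    (h : IsUnbiased ν O v s) (hf : MeasurePreserving f ν' ν) :
    IsUnbiased ν' (fun β => O (f β)) v s := by
  have h1 := h.ebound.comp hf
  refine ⟨hf.integrable_comp_of_integrable h.1, ?_, h1.1, h1.2⟩
  have : AEStronglyMeasurable O (ν'.map f) := by rw [hf.map_eq]; exact h.1.aestronglyMeasurable
  rw [← integral_map hf.measurable.aemeasurable this, hf.map_eq]
  exact h.mean

theorem clm_comp [CompleteSpace V] [CompleteSpace W] (h : IsUnbiased ν O v s) (T : V →L[ℝ] W)
    {k : ℝ} (hT : ∀ u, ‖T u‖ ≤ k * ‖u‖) :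
    IsUnbiased ν (fun β => T (O β)) (T v) (k ^ 2 * s) := by
  have h1 : EBound ν (fun β => ‖T (O β) - T v‖ ^ 2) (k ^ 2 * s) := by
    refine (h.ebound.const_mul (sq_nonneg k)).mono_left ?_ (fun _ => by positivity)
      (Eventually.of_forall fun β => ?_)
    · exact ((T.continuous.comp_aestronglyMeasurable h.1.aestronglyMeasurable).sub
        aestronglyMeasurable_const).norm.pow 2
    · rw [← map_sub, ← mul_pow]
      exact pow_le_pow_left₀ (norm_nonneg _) (hT _) 2
  exact ⟨T.integrable_comp h.1, by rw [T.integral_comp_comm h.1, h.mean], h1.1, h1.2⟩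

/-- Passes from an operator estimate, whose variance is in the spectral norm, to a vector estimate,
for which inner products are available. -/
theorem apply [CompleteSpace W] {O : B → V →L[ℝ] W} {v : V →L[ℝ] W} (h : IsUnbiased ν O v s)
    (u : V) : IsUnbiased ν (fun β => O β u) (v u) (‖u‖ ^ 2 * s) :=
  h.clm_comp (ContinuousLinearMap.apply ℝ W u) fun T => by
    rw [mul_comm]; exact T.le_opNorm u

/-- The mean deviation is at most `√s`, and the deviation fluctuates around its mean with
variance at most `s`. -/
theorem exists_mean_dev [IsProbabilityMeasure ν] (h : IsUnbiased ν O v s) :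
    ∃ a, 0 ≤ a ∧ a ^ 2 ≤ s ∧ Integrable (fun β => ‖O β - v‖) ν ∧ ∫ β, ‖O β - v‖ ∂ν = a ∧
      EBound ν (fun β => (‖O β - v‖ - a) ^ 2) s := by
  have hi : Integrable (fun β => ‖O β - v‖) ν := (h.1.sub (integrable_const v)).norm
  set a := ∫ β, ‖O β - v‖ ∂ν with ha
  have e1 : ∀ β, (‖O β - v‖ - a) ^ 2 = ‖O β - v‖ ^ 2 + (-(2 * a) * ‖O β - v‖ + a ^ 2) :=
    fun β => by ring
  have hi2 : Integrable (fun β => -(2 * a) * ‖O β - v‖ + a ^ 2) ν :=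
    (hi.const_mul _).add (integrable_const _)
  have e2 : ∫ β, (‖O β - v‖ - a) ^ 2 ∂ν = ∫ β, ‖O β - v‖ ^ 2 ∂ν - a ^ 2 := by
    simp_rw [e1]
    rw [integral_add h.3 hi2, integral_add (hi.const_mul _) (integrable_const _),
      integral_const_mul, ← ha]
    simp only [integral_const, probReal_univ, one_smul]
    ring
  -- The variance of the scalar `‖O - v‖` equals `E‖O - v‖² - a²`; its nonnegativity gives `a² ≤ s`,
  -- and dropping `a²` gives the fluctuation bound.
  have e3 : 0 ≤ ∫ β, (‖O β - v‖ - a) ^ 2 ∂ν := integral_nonneg fun β => sq_nonneg _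
  refine ⟨a, integral_nonneg fun β => norm_nonneg _, by linarith [h.variance], hi, rfl, ?_, ?_⟩
  · simp_rw [e1]; exact h.3.add hi2
  · linarith [h.variance, sq_nonneg a]

end Normed

section Inner

/-- The average of unbiased estimates, of variance at most `s` each. -/
theorem avg {B V : Type*} [MeasurableSpace B] [NormedAddCommGroup V] [InnerProductSpace ℝ V]
    {ν : Measure B} {s : ℝ} {ι : Type*} {I : Finset ι} (hI : I.Nonempty) {O : ι → B → V} {v : ι → V}
    (h : ∀ i ∈ I, IsUnbiased ν (O i) (v i) s) :
    IsUnbiased ν (fun β => (1 / (I.card : ℝ)) • ∑ i ∈ I, O i β)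
      ((1 / (I.card : ℝ)) • ∑ i ∈ I, v i) s := by
  have hc : (0 : ℝ) < I.card := by exact_mod_cast hI.card_pos
  have h1 : EBound ν (fun β => ‖(1 / (I.card : ℝ)) • ∑ i ∈ I, O i β -
      (1 / (I.card : ℝ)) • ∑ i ∈ I, v i‖ ^ 2) ((1 / (I.card : ℝ)) * ∑ i ∈ I, s) := by
    refine ((EBound.sum I fun i hi => (h i hi).ebound).const_mul (by positivity)).mono_left ?_
      (fun _ => by positivity) (Eventually.of_forall fun β => ?_)
    · refine (AEStronglyMeasurable.norm ?_).pow 2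
      refine AEStronglyMeasurable.sub ?_ aestronglyMeasurable_const
      exact ((integrable_finsetSum I fun i hi => (h i hi).1).smul _).aestronglyMeasurable
    · rw [← smul_sub, ← Finset.sum_sub_distrib, norm_smul, mul_pow, Real.norm_eq_abs, sq_abs]
      -- Only convexity of the square is used, not independence between the estimates, so the
      -- variance stays `s` and does not improve with the number of terms.
      have h2 : ‖∑ i ∈ I, (O i β - v i)‖ ^ 2 ≤ I.card * ∑ i ∈ I, ‖O i β - v i‖ ^ 2 :=
        (pow_le_pow_left₀ (norm_nonneg _) (norm_sum_le _ _) 2).trans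
          (sq_sum_le_card_mul_sum_sq)
      calc (1 / (I.card : ℝ)) ^ 2 * ‖∑ i ∈ I, (O i β - v i)‖ ^ 2
          ≤ (1 / (I.card : ℝ)) ^ 2 * (I.card * ∑ i ∈ I, ‖O i β - v i‖ ^ 2) :=
            mul_le_mul_of_nonneg_left h2 (by positivity)
        _ = _ := by field_simp
  refine ⟨(integrable_finsetSum I fun i hi => (h i hi).1).smul _, ?_, h1.1, h1.2.trans ?_⟩
  · rw [integral_smul, integral_finsetSum I fun i hi => (h i hi).1]
    rw [Finset.sum_congr rfl fun i hi => (h i hi).mean]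
  · rw [Finset.sum_const, nsmul_eq_mul]
    field_simp
    exact le_rfl

variable {B V : Type*} [MeasurableSpace B] [NormedAddCommGroup V] [InnerProductSpace ℝ V]
  [CompleteSpace V] {ν : Measure B} [IsProbabilityMeasure ν] {O : B → V} {v : V} {s : ℝ}

/-- Bias-variance decomposition: the cross term is an inner product with a centred variable and
integrates to zero. -/
theorem ebound_norm_add_sq (h : IsUnbiased ν O v s) (a : V) (k : ℝ) :
    EBound ν (fun β => ‖a + k • O β‖ ^ 2) (‖a + k • v‖ ^ 2 + k ^ 2 * s) := by
  have e1 : ∀ β, ‖a + k • O β‖ ^ 2 =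
      k ^ 2 * ‖O β - v‖ ^ 2 + (‖a + k • v‖ ^ 2 + 2 * k * inner ℝ (a + k • v) (O β - v)) := by
    intro β
    have : a + k • O β = (a + k • v) + k • (O β - v) := by module
    rw [this, norm_add_sq_real, norm_smul, inner_smul_right, mul_pow, Real.norm_eq_abs, sq_abs]
    ring
  have hi : Integrable (fun β => O β - v) ν := h.1.sub (integrable_const v)
  have hin := hi.const_inner (𝕜 := ℝ) (a + k • v)
  have h0 : ∫ β, inner ℝ (a + k • v) (O β - v) ∂ν = 0 := by
    rw [integral_inner hi, integral_sub h.1 (integrable_const v), h.mean]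
    simp
  have hi2 : Integrable (fun β => ‖a + k • v‖ ^ 2 + 2 * k * inner ℝ (a + k • v) (O β - v)) ν :=
    (integrable_const _).add (hin.const_mul _)
  simp_rw [e1]
  refine ⟨(h.3.const_mul _).add hi2, ?_⟩
  rw [integral_add (h.3.const_mul _) hi2, integral_add (integrable_const _) (hin.const_mul _),
    integral_const_mul, integral_const_mul, h0]
  have := mul_le_mul_of_nonneg_left h.variance (sq_nonneg k)
  simp only [integral_const, probReal_univ, one_smul]
  linarith

theorem ebound_norm_sq (h : IsUnbiased ν O v s) : EBound ν (fun β => ‖O β‖ ^ 2) (‖v‖ ^ 2 + s) := by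
  simpa using h.ebound_norm_add_sq 0 1

end Inner

end IsUnbiased

/-- The stochastic hypergradient of one block is an unbiased estimate. -/
theorem isUnbiased_sub_apply {B B' V W : Type*} [MeasurableSpace B] [MeasurableSpace B']
    [NormedAddCommGroup V] [InnerProductSpace ℝ V] [CompleteSpace V]
    [NormedAddCommGroup W] [InnerProductSpace ℝ W] [CompleteSpace W]
    {ν : Measure B} {ν' : Measure B'} [IsProbabilityMeasure ν] [IsProbabilityMeasure ν']
    {X : B → V} {Y : B → W} {Z : B' → W →L[ℝ] V} {x : V} {y : W} {z : W →L[ℝ] V} {s : ℝ}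
    (hX : IsUnbiased ν X x s) (hY : IsUnbiased ν Y y s) (hZ : IsUnbiased ν' Z z s)
    (H : W →L[ℝ] W) {k : ℝ} (hk : ‖H‖ ≤ k) :
    IsUnbiased (ν.prod ν') (fun β => X β.1 - Z β.2 (H (Y β.1))) (x - z (H y))
      (3 * s * (1 + k ^ 2 * (‖y‖ ^ 2 + s) + ‖z‖ ^ 2 * k ^ 2)) := by
  have hk0 : 0 ≤ k := (norm_nonneg H).trans hk
  have hX1 := hX.comp (measurePreserving_fst (μ := ν) (ν := ν'))
  have hY1 := hY.comp (measurePreserving_fst (μ := ν) (ν := ν'))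
  have hZ1 := hZ.comp (measurePreserving_snd (μ := ν) (ν := ν'))
  have hHY : ∀ β : B, ‖H (Y β)‖ ≤ k * ‖Y β‖ := fun β =>
    (H.le_opNorm _).trans (mul_le_mul_of_nonneg_right hk (norm_nonneg _))
  have hm : AEStronglyMeasurable (fun β : B × B' => Z β.2 (H (Y β.1))) (ν.prod ν') :=
    isBoundedBilinearMap_apply.continuous.comp_aestronglyMeasurable
      (hZ1.1.aestronglyMeasurable.prodMk
        (H.continuous.comp_aestronglyMeasurable hY1.1.aestronglyMeasurable))
  have hint : Integrable (fun β : B × B' => Z β.2 (H (Y β.1))) (ν.prod ν') := by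
    refine ((hY.1.norm.const_mul k).mul_prod hZ.1.norm).mono' hm
      (Eventually.of_forall fun β => ?_)
    rw [mul_comm]
    exact ((Z β.2).le_opNorm _).trans (mul_le_mul_of_nonneg_left (hHY _) (norm_nonneg _))
  -- The two halves of the batch are independent, so the mean of the product factors: first over the
  -- argument, then over the operator.
  have hmean : ∫ β, Z β.2 (H (Y β.1)) ∂(ν.prod ν') = z (H y) := by
    rw [integral_prod_symm _ hint]
    have e1 : ∀ ζ, ∫ ξ, Z ζ (H (Y ξ)) ∂ν = Z ζ (H y) := fun ζ => by
      have := (((Z ζ).comp H).integral_comp_comm hY.1)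
      rw [hY.mean] at this
      exact this
    simp_rw [e1]
    rw [← ContinuousLinearMap.integral_apply hZ.1, hZ.mean]
  have hb : EBound (ν.prod ν') (fun β => ‖X β.1 - Z β.2 (H (Y β.1)) - (x - z (H y))‖ ^ 2)
      (3 * s * (1 + k ^ 2 * (‖y‖ ^ 2 + s) + ‖z‖ ^ 2 * k ^ 2)) := by
    have b1 := (hX1.ebound.const_mul (k := 3) (by norm_num)).add
      (((hY.ebound_norm_sq.prod_mul hZ.ebound (fun _ => by positivity)
        (fun _ => by positivity)).const_mul (k := 3 * k ^ 2) (by positivity)).add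
      (hY1.ebound.const_mul (k := 3 * (‖z‖ ^ 2 * k ^ 2)) (by positivity)))
    refine (b1.mono (le_of_eq (by ring))).mono_left ?_ (fun _ => by positivity)
      (Eventually.of_forall fun β => ?_)
    · exact ((hX1.1.aestronglyMeasurable.sub hm).sub aestronglyMeasurable_const).norm.pow 2
    · have e1 : X β.1 - Z β.2 (H (Y β.1)) - (x - z (H y)) =
          (X β.1 - x) - (Z β.2 - z) (H (Y β.1)) - z (H (Y β.1 - y)) := by
        simp only [map_sub, sub_apply]; abel
      have e2 : ‖(Z β.2 - z) (H (Y β.1))‖ ≤ ‖Z β.2 - z‖ * (k * ‖Y β.1‖) :=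
        ((Z β.2 - z).le_opNorm _).trans (mul_le_mul_of_nonneg_left (hHY _) (norm_nonneg _))
      have e3 : ‖z (H (Y β.1 - y))‖ ≤ ‖z‖ * (k * ‖Y β.1 - y‖) :=
        (z.le_opNorm _).trans (mul_le_mul_of_nonneg_left ((H.le_opNorm _).trans
          (mul_le_mul_of_nonneg_right hk (norm_nonneg _))) (norm_nonneg _))
      rw [e1]
      set A := ‖X β.1 - x‖
      set B := ‖Z β.2 - z‖ * (k * ‖Y β.1‖) with hB
      set C := ‖z‖ * (k * ‖Y β.1 - y‖) with hC
      have e4 : ‖(X β.1 - x) - (Z β.2 - z) (H (Y β.1)) - z (H (Y β.1 - y))‖ ≤ A + B + C :=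
        (norm_sub_le _ _).trans (add_le_add ((norm_sub_le _ _).trans (add_le_add le_rfl e2)) e3)
      refine (pow_le_pow_left₀ (norm_nonneg _) e4 2).trans ?_
      have e5 : (A + B + C) ^ 2 ≤ 3 * A ^ 2 + (3 * B ^ 2 + 3 * C ^ 2) := by
        nlinarith [sq_nonneg (A - B), sq_nonneg (A - C), sq_nonneg (B - C)]
      refine e5.trans (le_of_eq ?_)
      rw [hB, hC]
      ring
  exact ⟨hX1.1.sub hint, by rw [integral_sub hX1.1 hint, hX1.mean, hmean], hb.1, hb.2⟩

/-! ### Averages over a uniformly random set of blocks. -/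

section Blocks

variable {m : ℕ}

/-- The average of `c` over the sets of `n` blocks. -/
noncomputable def blockAvg (n : ℕ) (c : Finset (Fin m) → ℝ) : ℝ :=
  (1 / (m.choose n : ℝ)) * ∑ I ∈ Finset.powersetCard n Finset.univ, c I

theorem sum_powersetCard_map (n : ℕ) (c : Finset (Fin m) → ℝ) (e : Equiv.Perm (Fin m)) :
    ∑ I ∈ Finset.powersetCard n Finset.univ, c (I.map e.toEmbedding) =
      ∑ I ∈ Finset.powersetCard n Finset.univ, c I := by
  refine Finset.sum_equiv e.finsetCongr (fun I => ?_) fun I _ => rfl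
  simp [Finset.mem_powersetCard]

variable {n : ℕ}

theorem choose_pos' (hn : n ≤ m) : (0 : ℝ) < m.choose n := by
  exact_mod_cast Nat.choose_pos hn

theorem blockAvg_const (hn : n ≤ m) (a : ℝ) : blockAvg (m := m) n (fun _ => a) = a := by
  have := choose_pos' hn
  simp [blockAvg, Finset.card_powersetCard]
  field_simp

theorem blockAvg_add (c d : Finset (Fin m) → ℝ) :
    blockAvg n (fun I => c I + d I) = blockAvg n c + blockAvg n d := by
  simp [blockAvg, Finset.sum_add_distrib, mul_add]

theorem blockAvg_mul (k : ℝ) (c : Finset (Fin m) → ℝ) :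
    blockAvg n (fun I => k * c I) = k * blockAvg n c := by
  simp only [blockAvg, ← Finset.mul_sum]; ring

/-- Transpositions show that all inclusion probabilities agree, and they add up to `n`. -/
theorem blockAvg_mem (hn : n ≤ m) (i : Fin m) :
    blockAvg n (fun I => if i ∈ I then 1 else 0) = (n : ℝ) / m := by
  have hm : (0 : ℝ) < m := by exact_mod_cast i.pos
  have hc := choose_pos' hn
  have h1 : ∀ j : Fin m, blockAvg n (fun I => if j ∈ I then (1 : ℝ) else 0) =
      blockAvg n (fun I => if i ∈ I then 1 else 0) := by
    intro j
    rw [blockAvg, ← sum_powersetCard_map n _ (Equiv.swap i j), blockAvg]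
    congr 1
    refine Finset.sum_congr rfl fun I _ => ?_
    congr 1
    rw [Finset.mem_map_equiv, Equiv.symm_swap, Equiv.swap_apply_right]
  have h2 : ∑ j : Fin m, blockAvg n (fun I => if j ∈ I then (1 : ℝ) else 0) = n := by
    simp only [blockAvg]
    rw [← Finset.mul_sum, Finset.sum_comm]
    have : ∀ I ∈ Finset.powersetCard n (Finset.univ : Finset (Fin m)),
        ∑ j, (if j ∈ I then (1 : ℝ) else 0) = n := by
      intro I hI
      simp [(Finset.mem_powersetCard.mp hI).2]
    rw [Finset.sum_congr rfl this]
    simp [Finset.card_powersetCard]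
    field_simp
  rw [Finset.sum_congr rfl fun j _ => h1 j] at h2
  rw [eq_div_iff hm.ne']
  simpa [mul_comm] using h2

theorem blockAvg_ite (hn : n ≤ m) (i : Fin m) (a b : ℝ) :
    blockAvg n (fun I => if i ∈ I then a else b) = (n : ℝ) / m * a + (1 - (n : ℝ) / m) * b := by
  have h1 : (fun I : Finset (Fin m) => if i ∈ I then a else b) =
      fun I => b + (a - b) * (if i ∈ I then 1 else 0) := by
    ext I; split_ifs <;> ring
  rw [h1, blockAvg_add, blockAvg_mul, blockAvg_const hn, blockAvg_mem hn]
  ring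

/-- Permutations act transitively on ordered pairs of distinct blocks, so the count is the same for
every pair. Its value is not needed, only its sign. -/
theorem exists_card_pair (n : ℕ) : ∃ q : ℝ, 0 ≤ q ∧ ∀ i j : Fin m, i ≠ j →
    ∑ I ∈ Finset.powersetCard n Finset.univ, (if i ∈ I ∧ j ∈ I then (1 : ℝ) else 0) = q := by
  by_cases h : ∃ i j : Fin m, i ≠ j
  · obtain ⟨k, l, hkl⟩ := h
    refine ⟨∑ I ∈ Finset.powersetCard n Finset.univ, (if k ∈ I ∧ l ∈ I then (1 : ℝ) else 0),
      Finset.sum_nonneg fun I _ => by split_ifs <;> norm_num, fun i j hij => ?_⟩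
    have hne : Equiv.swap k i l ≠ i := by
      intro h0
      exact hkl ((Equiv.swap k i).injective (h0.trans (Equiv.swap_apply_left k i).symm)).symm
    set e := (Equiv.swap k i).trans (Equiv.swap (Equiv.swap k i l) j) with he
    have hk : e k = i := by
      rw [he, Equiv.trans_apply, Equiv.swap_apply_left, Equiv.swap_apply_of_ne_of_ne hne.symm hij]
    have hl : e l = j := by
      rw [he, Equiv.trans_apply, Equiv.swap_apply_left]
    rw [← sum_powersetCard_map n _ e]
    refine Finset.sum_congr rfl fun I _ => ?_
    congr 1
    rw [Finset.mem_map_equiv, Finset.mem_map_equiv, ← hk, ← hl, e.symm_apply_apply,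
      e.symm_apply_apply]
  · exact ⟨0, le_rfl, fun i j hij => absurd ⟨i, j, hij⟩ h⟩

/-- Second moment of a sum over a random set of blocks of vectors that add up to zero. -/
theorem blockAvg_norm_sum_sq_le {V : Type*} [NormedAddCommGroup V] [InnerProductSpace ℝ V]
    (hn : n ≤ m) (Y : Fin m → V) (hY : ∑ i, Y i = 0) :
    blockAvg n (fun I => ‖∑ i ∈ I, Y i‖ ^ 2) ≤ (n : ℝ) / m * ∑ i, ‖Y i‖ ^ 2 := by
  obtain ⟨q, hq, hqe⟩ := exists_card_pair (m := m) n
  set P := Finset.powersetCard n (Finset.univ : Finset (Fin m))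
  have hc := choose_pos' hn
  have h1 : ∀ I : Finset (Fin m), ‖∑ i ∈ I, Y i‖ ^ 2 =
      ∑ i, ∑ j, (if i ∈ I ∧ j ∈ I then (1 : ℝ) else 0) * inner ℝ (Y i) (Y j) := by
    intro I
    rw [← real_inner_self_eq_norm_sq, sum_inner]
    simp only [inner_sum]
    rw [← Finset.sum_filter_add_sum_filter_not Finset.univ (· ∈ I)]
    rw [Finset.sum_eq_zero (s := Finset.univ.filter (¬ · ∈ I))]
    · simp only [add_zero, Finset.filter_univ_mem]
      refine Finset.sum_congr rfl fun i hi => ?_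
      simp [hi]
    · intro i hi
      have : i ∉ I := (Finset.mem_filter.mp hi).2
      simp [this]
  have h2 : ∑ I ∈ P, ‖∑ i ∈ I, Y i‖ ^ 2 =
      ∑ i, ∑ j, (∑ I ∈ P, if i ∈ I ∧ j ∈ I then (1 : ℝ) else 0) * inner ℝ (Y i) (Y j) := by
    rw [Finset.sum_congr rfl fun I _ => h1 I, Finset.sum_comm]
    refine Finset.sum_congr rfl fun i _ => ?_
    rw [Finset.sum_comm]
    exact Finset.sum_congr rfl fun j _ => (Finset.sum_mul _ _ _).symm
  have h3 : ∀ i, ∑ j, (∑ I ∈ P, if i ∈ I ∧ j ∈ I then (1 : ℝ) else 0) * inner ℝ (Y i) (Y j) =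
      (∑ I ∈ P, (if i ∈ I then (1 : ℝ) else 0) - q) * ‖Y i‖ ^ 2 := by
    intro i
    -- Off the diagonal the weight is the constant `q`. Written as `q` everywhere plus a diagonal
    -- correction, the constant part pairs `Y i` with `∑ Y j = 0`; what remains is a diagonal with
    -- weight at most the single-inclusion count.
    have e1 : ∀ j, (∑ I ∈ P, if i ∈ I ∧ j ∈ I then (1 : ℝ) else 0) * inner ℝ (Y i) (Y j) =
        q * inner ℝ (Y i) (Y j) + if j = i then
          (∑ I ∈ P, (if i ∈ I then (1 : ℝ) else 0) - q) * ‖Y i‖ ^ 2 else 0 := by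
      intro j
      split_ifs with hij
      · subst hij
        rw [real_inner_self_eq_norm_sq]
        simp only [and_self]
        ring
      · rw [hqe i j (Ne.symm hij), add_zero]
    rw [Finset.sum_congr rfl fun j _ => e1 j, Finset.sum_add_distrib, ← Finset.mul_sum,
      ← inner_sum, hY]
    simp
  have h4 : ∀ i, ∑ I ∈ P, (if i ∈ I then (1 : ℝ) else 0) = m.choose n * ((n : ℝ) / m) := by
    intro i
    have := blockAvg_mem hn i
    rw [blockAvg, one_div, inv_mul_eq_div, div_eq_iff hc.ne'] at this
    rw [this]; ring
  rw [blockAvg, h2, Finset.sum_congr rfl fun i _ => h3 i, one_div, inv_mul_le_iff₀ hc,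
    Finset.mul_sum, Finset.mul_sum]
  refine Finset.sum_le_sum fun i _ => ?_
  rw [h4]
  nlinarith [mul_nonneg hq (sq_nonneg ‖Y i‖)]

/-- The average over a random set of `n` blocks of vectors of norm at most `C`. -/
theorem blockAvg_dev_le {V : Type*} [NormedAddCommGroup V] [InnerProductSpace ℝ V]
    (hn1 : 1 ≤ n) (hn : n ≤ m) (X : Fin m → V) {C : ℝ} (hX : ∀ i, ‖X i‖ ≤ C) :
    blockAvg n (fun I => ‖(1 / (n : ℝ)) • ∑ i ∈ I, X i - (1 / (m : ℝ)) • ∑ i, X i‖ ^ 2) ≤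
      (2 * C) ^ 2 / n := by
  have hn0 : (0 : ℝ) < n := by exact_mod_cast hn1
  have hm0 : (0 : ℝ) < m := by exact_mod_cast hn1.trans hn
  set a := (1 / (m : ℝ)) • ∑ i, X i with ha
  have ha' : ‖a‖ ≤ C := norm_avg_le (hn1.trans hn) X hX
  have h1 : ∑ i, (X i - a) = 0 := by
    rw [Finset.sum_sub_distrib, Finset.sum_const, Finset.card_univ, Fintype.card_fin, ha,
      ← Nat.cast_smul_eq_nsmul ℝ, smul_smul, mul_one_div_cancel hm0.ne', one_smul, sub_self]
  have h2 := blockAvg_norm_sum_sq_le hn _ h1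
  have h3 : ∑ i, ‖X i - a‖ ^ 2 ≤ ∑ _i : Fin m, (2 * C) ^ 2 := Finset.sum_le_sum fun i _ =>
    pow_le_pow_left₀ (norm_nonneg _) ((norm_sub_le _ _).trans (by linarith [hX i])) 2
  simp only [Finset.sum_const, Finset.card_univ, Fintype.card_fin, nsmul_eq_mul] at h3
  have h4 : blockAvg n (fun I => ‖(1 / (n : ℝ)) • ∑ i ∈ I, X i - a‖ ^ 2) =
      (1 / (n : ℝ)) ^ 2 * blockAvg n (fun I => ‖∑ i ∈ I, (X i - a)‖ ^ 2) := by
    rw [← blockAvg_mul, blockAvg, blockAvg]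
    congr 1
    refine Finset.sum_congr rfl fun I hI => ?_
    have hI' := (Finset.mem_powersetCard.mp hI).2
    rw [Finset.sum_sub_distrib, Finset.sum_const, hI', ← Nat.cast_smul_eq_nsmul ℝ]
    have : (1 / (n : ℝ)) • ∑ i ∈ I, X i - a = (1 / (n : ℝ)) • (∑ i ∈ I, X i - (n : ℝ) • a) := by
      rw [smul_sub, smul_smul, one_div_mul_cancel hn0.ne', one_smul]
    rw [this, norm_smul, mul_pow, Real.norm_eq_abs, sq_abs]
  rw [h4]
  calc (1 / (n : ℝ)) ^ 2 * blockAvg n (fun I => ‖∑ i ∈ I, (X i - a)‖ ^ 2)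
      ≤ (1 / (n : ℝ)) ^ 2 * ((n : ℝ) / m * (m * (2 * C) ^ 2)) :=
        mul_le_mul_of_nonneg_left (h2.trans (mul_le_mul_of_nonneg_left h3 (by positivity)))
          (by positivity)
    _ = (2 * C) ^ 2 / n := by field_simp

end Blocks

/-! ### Integration over a random block set and independent batches. -/

section UniformProd

variable {m n : ℕ} {B : Type*} [MeasurableSpace B] {ρ : Measure B} [IsProbabilityMeasure ρ]

instance instMeasurableSingletonClassBlocks (m : ℕ) :
    MeasurableSingletonClass (Finset (Fin m)) := ⟨fun _ => trivial⟩

theorem nonempty_blocks (hn : n ≤ m) : {I : Finset (Fin m) | I.card = n}.Nonempty := by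
  obtain ⟨I, -, hI⟩ := Finset.exists_subset_card_eq (s := (Finset.univ : Finset (Fin m)))
    (n := n) (by simpa using hn)
  exact ⟨I, hI⟩

theorem isProbabilityMeasure_blocks (hn : n ≤ m) :
    IsProbabilityMeasure (uniformOn {I : Finset (Fin m) | I.card = n}) :=
  isProbabilityMeasure_uniformOn (Set.toFinite _) (nonempty_blocks hn)

theorem ae_card_blocks (n : ℕ) :
    ∀ᵐ I ∂(uniformOn {I : Finset (Fin m) | I.card = n}), I.card = n :=
  ae_cond_mem (Set.toFinite _).measurableSet

theorem integral_blocks {V : Type*} [NormedAddCommGroup V] [NormedSpace ℝ V] [CompleteSpace V]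
    (c : Finset (Fin m) → V) :
    ∫ I, c I ∂(uniformOn {I : Finset (Fin m) | I.card = n}) =
      (1 / (m.choose n : ℝ)) • ∑ I ∈ Finset.powersetCard n Finset.univ, c I := by
  have hS : {I : Finset (Fin m) | I.card = n} =
      (Finset.powersetCard n (Finset.univ : Finset (Fin m)) : Set (Finset (Fin m))) := by
    ext I; simp [Finset.mem_powersetCard]
  rw [uniformOn, ProbabilityTheory.cond, integral_smul_measure, hS, Measure.count_apply_finset,
    setIntegral_finset _ (Integrable.of_finite (μ := Measure.count)).integrableOn]
  simp [Finset.card_powersetCard]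

theorem integrable_blocks_prod {V : Type*} [NormedAddCommGroup V] (hn : n ≤ m)
    {φ : Finset (Fin m) × B → V}
    (hφ : ∀ I : Finset (Fin m), I.card = n → Integrable (fun β => φ (I, β)) ρ)
    (hm : AEStronglyMeasurable φ ((uniformOn {I : Finset (Fin m) | I.card = n}).prod ρ)) :
    Integrable φ ((uniformOn {I : Finset (Fin m) | I.card = n}).prod ρ) := by
  have := isProbabilityMeasure_blocks hn
  rw [integrable_prod_iff hm]
  refine ⟨?_, Integrable.of_finite⟩
  filter_upwards [ae_card_blocks n] with I hI using hφ I hI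

theorem integral_blocks_prod {V : Type*} [NormedAddCommGroup V] [NormedSpace ℝ V] [CompleteSpace V]
    (hn : n ≤ m) {φ : Finset (Fin m) × B → V}
    (hφ : ∀ I : Finset (Fin m), I.card = n → Integrable (fun β => φ (I, β)) ρ)
    (hm : AEStronglyMeasurable φ ((uniformOn {I : Finset (Fin m) | I.card = n}).prod ρ)) :
    ∫ z, φ z ∂((uniformOn {I : Finset (Fin m) | I.card = n}).prod ρ) =
      (1 / (m.choose n : ℝ)) • ∑ I ∈ Finset.powersetCard n Finset.univ, ∫ β, φ (I, β) ∂ρ := by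
  have := isProbabilityMeasure_blocks hn
  rw [integral_prod _ (integrable_blocks_prod hn hφ hm), integral_blocks]

theorem ebound_blocks_prod (hn : n ≤ m) {φ : Finset (Fin m) × B → ℝ} {c : Finset (Fin m) → ℝ}
    (hφ : ∀ I : Finset (Fin m), I.card = n → EBound ρ (fun β => φ (I, β)) (c I))
    (hm : AEStronglyMeasurable φ ((uniformOn {I : Finset (Fin m) | I.card = n}).prod ρ)) :
    EBound ((uniformOn {I : Finset (Fin m) | I.card = n}).prod ρ) φ (blockAvg n c) := by
  refine ⟨integrable_blocks_prod hn (fun I hI => (hφ I hI).1) hm, ?_⟩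
  rw [integral_blocks_prod hn (fun I hI => (hφ I hI).1) hm, blockAvg, smul_eq_mul]
  exact mul_le_mul_of_nonneg_left (Finset.sum_le_sum fun I hI =>
    (hφ I (Finset.mem_powersetCard.mp hI).2).2) (by positivity)

end UniformProd

end MinMaxBilevel

/-! ### Measurability of the iteration, and the invariant of admissible states. -/

namespace MinMaxBilevel

open Filter Topology Set

section Measurability

variable {m dx dα dy b : ℕ} {Ξ Z : Type*} [MeasurableSpace Ξ] [MeasurableSpace Z]

/-- The components of a state, as a tuple. -/
noncomputable def State.toProd (u : State m dx dα dy) :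
    E dx × E dx × (Fin m → E dα) × (Fin m → E dy) × (Fin m → (E dy →L[ℝ] E dy)) :=
  (u.x, u.z, u.α, u.y, u.s)

/-- The coarsest structure for which all components are measurable; maps into states are then
checked component by component. -/
noncomputable instance instMeasurableSpaceState : MeasurableSpace (State m dx dα dy) :=
  MeasurableSpace.comap State.toProd inferInstance

theorem State.measurable_toProd : Measurable (State.toProd : State m dx dα dy → _) :=
  comap_measurable _

theorem State.measurable_x : Measurable (State.x : State m dx dα dy → _) :=
  State.measurable_toProd.fst

theorem State.measurable_z : Measurable (State.z : State m dx dα dy → _) :=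
  State.measurable_toProd.snd.fst

theorem State.measurable_α (i : Fin m) : Measurable fun u : State m dx dα dy => u.α i :=
  (measurable_pi_apply i).comp State.measurable_toProd.snd.snd.fst

theorem State.measurable_y (i : Fin m) : Measurable fun u : State m dx dα dy => u.y i :=
  (measurable_pi_apply i).comp State.measurable_toProd.snd.snd.snd.fst

theorem State.measurable_s (i : Fin m) : Measurable fun u : State m dx dα dy => u.s i :=
  (measurable_pi_apply i).comp State.measurable_toProd.snd.snd.snd.snd

theorem State.measurable_of {B : Type*} [MeasurableSpace B] {f : B → State m dx dα dy}
    (hx : Measurable fun β => (f β).x) (hz : Measurable fun β => (f β).z)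
    (hα : ∀ i, Measurable fun β => (f β).α i) (hy : ∀ i, Measurable fun β => (f β).y i)
    (hs : ∀ i, Measurable fun β => (f β).s i) : Measurable f := by
  rw [measurable_comap_iff]
  exact hx.prodMk (hz.prodMk ((measurable_pi_lambda _ hα).prodMk
    ((measurable_pi_lambda _ hy).prodMk (measurable_pi_lambda _ hs))))

/-- Inversion is continuous on the open set of units and takes the default value `0` elsewhere. -/
theorem measurable_inverse (d : ℕ) :
    Measurable (ContinuousLinearMap.inverse : (E d →L[ℝ] E d) → (E d →L[ℝ] E d)) := by
  rw [← ContinuousLinearMap.ringInverse_eq_inverse]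
  have ho : IsOpen {s : E d →L[ℝ] E d | IsUnit s} := Units.isOpen
  have h1 : ContinuousOn (Ring.inverse : (E d →L[ℝ] E d) → _) {s | IsUnit s} := by
    rintro _ ⟨s, rfl⟩
    exact (NormedRing.inverse_continuousAt s).continuousWithinAt
  classical
  have h2 : (Ring.inverse : (E d →L[ℝ] E d) → _) =
      {s : E d →L[ℝ] E d | IsUnit s}.piecewise Ring.inverse 0 := by
    ext1 s
    by_cases hs : s ∈ {s : E d →L[ℝ] E d | IsUnit s}
    · exact (Set.piecewise_eq_of_mem _ _ _ hs).symm
    · exact (Ring.inverse_non_unit _ hs).trans 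
        (Set.piecewise_eq_of_notMem _ Ring.inverse (0 : (E d →L[ℝ] E d) → _) hs).symm
  rw [h2]
  exact h1.measurable_piecewise continuousOn_const ho.measurableSet

theorem measurable_apply_clm {d e : ℕ} {B : Type*} [MeasurableSpace B] {T : B → E d →L[ℝ] E e}
    {v : B → E d} (hT : Measurable T) (hv : Measurable v) : Measurable fun β => T β (v β) :=
  ContinuousLinearMap.measurable_apply₂.comp (hT.prodMk hv)

theorem measurableSet_mem_block {B : Type*} [MeasurableSpace B] {J : B → Finset (Fin m)}
    (hJ : Measurable J) (i : Fin m) : MeasurableSet {β | i ∈ J β} :=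
  hJ (show MeasurableSet {I : Finset (Fin m) | i ∈ I} from trivial)

variable {p : Problem m dx dα dy} {c : Consts} {o : Oracles m dx dα dy b Ξ Z}

theorem measurable_gradEst (hv : o.Valid p c) :
    Measurable fun q : State m dx dα dy × Draw m b Ξ Z => gradEst o q.1 q.2 := by
  have hJ : Measurable fun q : State m dx dα dy × Draw m b Ξ Z => q.2.1 :=
    measurable_fst.comp measurable_snd
  have h1 : (fun q : State m dx dα dy × Draw m b Ξ Z => gradEst o q.1 q.2) = fun q =>
      (1 / (q.2.1.card : ℝ)) • ∑ i, if i ∈ q.2.1 then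
        (o.fx i q.1.x (q.1.α i) (q.1.y i) (q.2.2.1 i) -
          o.gxy i q.1.x (q.1.y i) (q.2.2.2 i)
            (q.1.H i (o.fy i q.1.x (q.1.α i) (q.1.y i) (q.2.2.1 i)))) else 0 := by
    ext1 q
    rw [gradEst, Finset.sum_ite_mem, Finset.univ_inter]
  rw [h1]
  have hc : Measurable fun q : State m dx dα dy × Draw m b Ξ Z => 1 / (q.2.1.card : ℝ) :=
    (measurable_from_top (f := fun I : Finset (Fin m) => 1 / (I.card : ℝ))).comp hJ
  refine hc.smul (Finset.measurable_fun_sum _ fun i _ => ?_)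
  refine Measurable.ite (measurableSet_mem_block hJ i) ?_ measurable_const
  have hx := State.measurable_x.comp
    (measurable_fst : Measurable (Prod.fst : State m dx dα dy × Draw m b Ξ Z → _))
  have hα := (State.measurable_α i).comp
    (measurable_fst : Measurable (Prod.fst : State m dx dα dy × Draw m b Ξ Z → _))
  have hy := (State.measurable_y i).comp
    (measurable_fst : Measurable (Prod.fst : State m dx dα dy × Draw m b Ξ Z → _))
  have hs := (State.measurable_s i).comp
    (measurable_fst : Measurable (Prod.fst : State m dx dα dy × Draw m b Ξ Z → _))
  have hξ : Measurable fun q : State m dx dα dy × Draw m b Ξ Z => q.2.2.1 i :=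
    (measurable_pi_apply i).comp (measurable_fst.comp (measurable_snd.comp measurable_snd))
  have hζ : Measurable fun q : State m dx dα dy × Draw m b Ξ Z => q.2.2.2 i :=
    (measurable_pi_apply i).comp (measurable_snd.comp (measurable_snd.comp measurable_snd))
  exact ((hv.fx_meas i).comp (hx.prodMk (hα.prodMk (hy.prodMk hξ)))).sub
    (measurable_apply_clm ((hv.gxy_meas i).comp (hx.prodMk (hy.prodMk hζ)))
      (measurable_apply_clm ((measurable_inverse dy).comp hs)
        ((hv.fy_meas i).comp (hx.prodMk (hα.prodMk (hy.prodMk hξ))))))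

theorem measurable_step (h : p.Regular c) (hv : o.Valid p c) (k : Steps) :
    Measurable fun q : State m dx dα dy × Draw m b Ξ Z => step p.A o k q.1 q.2 := by
  have hJ : Measurable fun q : State m dx dα dy × Draw m b Ξ Z => q.2.1 :=
    measurable_fst.comp measurable_snd
  have hf : Measurable (Prod.fst : State m dx dα dy × Draw m b Ξ Z → _) := measurable_fst
  have hx := State.measurable_x.comp hf
  have hz : Measurable fun q : State m dx dα dy × Draw m b Ξ Z => nextZ o k q.1 q.2 :=
    ((State.measurable_z.comp hf).const_smul (1 - k.β₀)).add
      ((measurable_gradEst hv).const_smul k.β₀)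
  have hξ : ∀ i, Measurable fun q : State m dx dα dy × Draw m b Ξ Z => q.2.2.1 i := fun i =>
    (measurable_pi_apply i).comp (measurable_fst.comp (measurable_snd.comp measurable_snd))
  have hζ : ∀ i, Measurable fun q : State m dx dα dy × Draw m b Ξ Z => q.2.2.2 i := fun i =>
    (measurable_pi_apply i).comp (measurable_snd.comp (measurable_snd.comp measurable_snd))
  refine State.measurable_of (hx.sub (hz.const_smul k.η₀)) hz (fun i => ?_) (fun i => ?_)
    (fun i => ?_)
  · have hα := (State.measurable_α i).comp hf
    have hy := (State.measurable_y i).comp hf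
    exact Measurable.ite (measurableSet_mem_block hJ i)
      ((continuous_proj h.A_nonempty h.A_closed h.A_convex).measurable.comp
        (hα.add (((hv.fα_meas i).comp
          (hx.prodMk (hα.prodMk (hy.prodMk (hξ i))))).const_smul k.η₁))) hα
  · have hy := (State.measurable_y i).comp hf
    exact Measurable.ite (measurableSet_mem_block hJ i)
      (hy.sub (((hv.gy_meas i).comp (hx.prodMk (hy.prodMk (hζ i)))).const_smul k.η₂)) hy
  · have hy := (State.measurable_y i).comp hf
    have hs := (State.measurable_s i).comp hf
    exact Measurable.ite (measurableSet_mem_block hJ i)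
      ((hs.const_smul (1 - k.β₁)).add
        (((hv.gyy_meas i).comp (hx.prodMk (hy.prodMk (hζ i)))).const_smul k.β₁)) hs

theorem measurable_step_right (h : p.Regular c) (hv : o.Valid p c) (k : Steps)
    (u : State m dx dα dy) : Measurable fun w : Draw m b Ξ Z => step p.A o k u w :=
  (measurable_step h hv k).comp measurable_prodMk_left

end Measurability

section Adm

variable {m dx dα dy b : ℕ} {Ξ Z : Type*} [MeasurableSpace Ξ] [MeasurableSpace Z]

/-- The invariant of the iteration: dual variables in `A` and coercive Hessian estimates. -/
structure State.Adm (u : State m dx dα dy) (A : Set (E dα)) (c : Consts) : Prop where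
  α_mem : ∀ i, u.α i ∈ A
  coercive : ∀ i, Coercive c.μg (u.s i)

theorem State.Admissible.adm {u : State m dx dα dy} {A : Set (E dα)} {c : Consts}
    (hu : u.Admissible A c) : u.Adm A c :=
  ⟨hu.α_mem, fun i => coercive_of_isPositive (hu.s_lower i)⟩

variable {p : Problem m dx dα dy} {c : Consts} {o : Oracles m dx dα dy b Ξ Z}

/-- The projection returns to `A`, and for `0 ≤ β₁ ≤ 1` the Hessian update averages two coercive
operators. So the oracles are only queried where their guarantees hold. -/
theorem State.Adm.step (h : p.Regular c) (hv : o.Valid p c) {k : Steps} (h0 : 0 ≤ k.β₁)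
    (h1 : k.β₁ ≤ 1) {u : State m dx dα dy} (hu : u.Adm p.A c) (w : Draw m b Ξ Z) :
    (step p.A o k u w).Adm p.A c := by
  refine ⟨fun i => ?_, fun i => ?_⟩
  · simp only [MinMaxBilevel.step]
    split_ifs
    · exact (proj_spec h.A_nonempty h.A_closed h.A_convex _).1
    · exact hu.α_mem i
  · simp only [MinMaxBilevel.step]
    split_ifs
    · exact (hu.coercive i).convexComb (coercive_of_isPositive (hv.gyy_lower i _ _ _)) h0 h1
    · exact hu.coercive i

theorem State.Adm.run (h : p.Regular c) (hv : o.Valid p c) {k : Steps} (h0 : 0 ≤ k.β₁)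
    (h1 : k.β₁ ≤ 1) {u : State m dx dα dy} (hu : u.Adm p.A c) (w : ℕ → Draw m b Ξ Z) (t : ℕ) :
    (run p.A o k u w t).Adm p.A c := by
  induction t with
  | zero => exact hu
  | succ t ih => exact ih.step h hv h0 h1 (w t)

end Adm

end MinMaxBilevel

/-! ### Conditional means after one iteration, at a fixed state. -/

namespace MinMaxBilevel

open Filter Topology Set

theorem IsUnbiased.mono {B V : Type*} [MeasurableSpace B] [NormedAddCommGroup V] [NormedSpace ℝ V]
    {ν : Measure B} {O : B → V} {v : V} {s s' : ℝ} (h : IsUnbiased ν O v s) (hs : s ≤ s') :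
    IsUnbiased ν O v s' := ⟨h.1, h.2, h.3, h.4.trans hs⟩

theorem sum_powersetCard_sum {V : Type*} [AddCommGroup V] [Module ℝ V] {m n : ℕ} (hn : n ≤ m)
    (v : Fin m → V) : ∑ I ∈ Finset.powersetCard n (Finset.univ : Finset (Fin m)), ∑ i ∈ I, v i =
      ((m.choose n : ℝ) * ((n : ℝ) / m)) • ∑ i, v i := by
  have hc := choose_pos' hn
  have h4 : ∀ i : Fin m, ∑ I ∈ Finset.powersetCard n (Finset.univ : Finset (Fin m)),
      (if i ∈ I then (1 : ℝ) else 0) = m.choose n * ((n : ℝ) / m) := by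
    intro i
    have := blockAvg_mem hn i
    rw [blockAvg, one_div, inv_mul_eq_div, div_eq_iff hc.ne'] at this
    rw [this]; ring
  have h5 : ∀ I : Finset (Fin m), ∑ i ∈ I, v i = ∑ i, (if i ∈ I then (1 : ℝ) else 0) • v i := by
    intro I
    simp only [ite_smul, one_smul, zero_smul, Finset.sum_ite_mem, Finset.univ_inter]
  rw [Finset.sum_congr rfl fun I _ => h5 I, Finset.sum_comm, Finset.smul_sum]
  refine Finset.sum_congr rfl fun i _ => ?_
  rw [← Finset.sum_smul, h4]

namespace Consts

variable (c : Consts)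

/-- A bound for the variance of the stochastic hypergradient, relative to `1 / min {n, b}`. -/
noncomputable def Vgrad : ℝ :=
  3 * c.σ ^ 2 * (1 + c.μg⁻¹ ^ 2 * (c.Cf ^ 2 + c.σ ^ 2) + c.Cgxy ^ 2 * c.μg⁻¹ ^ 2) +
    (2 * c.Bhyp) ^ 2

/-- A bound for the mean norm of the Hessian oracle. -/
noncomputable def Khess : ℝ := c.Lg + c.σ

/-- The factor of the lower-level error in the recursion for the dual variables. -/
noncomputable def κα : ℝ := 2 * c.Lf ^ 2 / c.μf + c.μf

variable {c}

theorem Pos.Vgrad_pos (hc : c.Pos) : 0 < c.Vgrad := by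
  have := hc.Bhyp_pos; obtain ⟨_, _, _, _, _, _, _, _, _⟩ := hc; unfold Vgrad; positivity

theorem Pos.Khess_pos (hc : c.Pos) : 0 < c.Khess := add_pos hc.Lg hc.σ

theorem Pos.κα_pos (hc : c.Pos) : 0 < c.κα := by
  obtain ⟨_, _, _, _, _, _, _, _, _⟩ := hc; unfold κα; positivity

end Consts

/-- A cutoff that equals `1` up to `2 K` and `0` from `3 K` on. -/
noncomputable def cut (K M : ℝ) : ℝ := max 0 (min 1 (3 - M / K))

theorem cut_nonneg (K M : ℝ) : 0 ≤ cut K M := le_max_left _ _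

theorem cut_le_one (K M : ℝ) : cut K M ≤ 1 := max_le zero_le_one (min_le_left _ _)

theorem cut_eq_one {K M : ℝ} (hK : 0 < K) (h : M ≤ 2 * K) : cut K M = 1 := by
  have : M / K ≤ 2 := by rwa [div_le_iff₀ hK]
  rw [cut, min_eq_left (by linarith), max_eq_right zero_le_one]

theorem cut_eq_zero {K M : ℝ} (hK : 0 < K) (h : 3 * K ≤ M) : cut K M = 0 := by
  have : 3 ≤ M / K := by rwa [le_div_iff₀ hK]
  rw [cut, max_eq_left ((min_le_right _ _).trans (by linarith))]

/-- The cutoff is Lipschitz in the norm, with constant `1/K`. -/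
theorem cut_sub_le {K : ℝ} (hK : 0 < K) (M M' : ℝ) : cut K M' - cut K M ≤ |M' - M| / K := by
  have e0 : |M' - M| / K = |M' / K - M / K| := by rw [← sub_div, abs_div, abs_of_pos hK]
  have e1 := neg_abs_le (M' / K - M / K)
  have e2 := abs_nonneg (M' / K - M / K)
  rw [e0, sub_le_iff_le_add]
  refine max_le (add_nonneg e2 (cut_nonneg _ _)) ?_
  rcases le_total 1 (3 - M / K) with h1 | h1
  · have : 1 ≤ cut K M := le_max_of_le_right (le_min le_rfl h1)
    exact (min_le_left _ _).trans (by linarith)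
  · have : 3 - M / K ≤ cut K M := le_max_of_le_right (le_min h1 le_rfl)
    exact (min_le_right _ _).trans (by linarith)

@[fun_prop]
theorem continuous_cut (K : ℝ) : Continuous (cut K) := by
  unfold cut; fun_prop

section OneStep

variable {m dx dα dy b n : ℕ} {Ξ Z : Type*} [MeasurableSpace Ξ] [MeasurableSpace Z]
variable {p : Problem m dx dα dy} {c : Consts} {o : Oracles m dx dα dy b Ξ Z}

theorem Oracles.Valid.prob_batchP (hv : o.Valid p c) (i : Fin m) :
    IsProbabilityMeasure (o.batchP i) := by
  have := hv.P_prob i; unfold Oracles.batchP; infer_instance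

theorem Oracles.Valid.prob_batchQ (hv : o.Valid p c) (i : Fin m) :
    IsProbabilityMeasure (o.batchQ i) := by
  have := hv.Q_prob i; unfold Oracles.batchQ; infer_instance

/-- The joint law of all batches. -/
noncomputable def Oracles.batches (o : Oracles m dx dα dy b Ξ Z) :
    Measure ((Fin m → Fin b → Ξ) × (Fin m → Fin b → Z)) :=
  (Measure.pi fun i => o.batchP i).prod (Measure.pi fun i => o.batchQ i)

theorem Oracles.Valid.prob_batches (hv : o.Valid p c) : IsProbabilityMeasure o.batches := by
  have := hv.prob_batchP; have := hv.prob_batchQ; unfold Oracles.batches; infer_instance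

theorem Oracles.Valid.prob_drawLaw (hv : o.Valid p c) (hn : n ≤ m) :
    IsProbabilityMeasure (o.drawLaw n) := by
  have := hv.prob_batches
  have := isProbabilityMeasure_blocks hn
  change IsProbabilityMeasure ((uniformOn {I : Finset (Fin m) | I.card = n}).prod o.batches)
  infer_instance

theorem Oracles.Valid.measurePreserving_batch (hv : o.Valid p c) (i : Fin m) :
    MeasurePreserving (fun β : (Fin m → Fin b → Ξ) × (Fin m → Fin b → Z) => (β.1 i, β.2 i))
      o.batches ((o.batchP i).prod (o.batchQ i)) := by
  have := hv.prob_batchP; have := hv.prob_batchQ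
  exact (measurePreserving_eval (fun i => o.batchP i) i).prod
    (measurePreserving_eval (fun i => o.batchQ i) i)

/-- Block `i` is drawn with probability `n/m`, independently of its batch; otherwise its variable is
unchanged. Every recursion for one block passes through this mixture. -/
theorem Oracles.Valid.ebound_block (hv : o.Valid p c) (hn : n ≤ m) (i : Fin m)
    {ψ : (Fin b → Ξ) × (Fin b → Z) → ℝ} {a : ℝ} (d : ℝ)
    (hψ : EBound ((o.batchP i).prod (o.batchQ i)) ψ a) :
    EBound (o.drawLaw n) (fun w => if i ∈ w.1 then ψ (w.2.1 i, w.2.2 i) else d)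
      ((n : ℝ) / m * a + (1 - (n : ℝ) / m) * d) := by
  have := hv.prob_batches
  have := isProbabilityMeasure_blocks hn
  have hψ' := hψ.comp (hv.measurePreserving_batch i)
  rw [← blockAvg_ite hn i]
  refine ebound_blocks_prod (ρ := o.batches)
    (φ := fun w => if i ∈ w.1 then ψ (w.2.1 i, w.2.2 i) else d) hn (fun I _ => ?_) ?_
  · by_cases hi : i ∈ I
    · simpa only [hi, if_true] using hψ'
    · simpa only [hi, if_false] using EBound.const d
  · have h1 : (fun w : Draw m b Ξ Z => if i ∈ w.1 then ψ (w.2.1 i, w.2.2 i) else d) =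
        fun w => d + (if i ∈ w.1 then (1 : ℝ) else 0) * (ψ (w.2.1 i, w.2.2 i) - d) := by
      ext w; split_ifs <;> ring
    rw [h1]
    refine aestronglyMeasurable_const.add (AEStronglyMeasurable.mul ?_ ?_)
    · exact (Measurable.ite (measurableSet_mem_block measurable_fst i) measurable_const
        measurable_const).aestronglyMeasurable
    · exact (hψ'.1.aestronglyMeasurable.comp_snd).sub aestronglyMeasurable_const

theorem var_le (c : Consts) (hb : 1 ≤ b) : c.σ ^ 2 / b ≤ c.σ ^ 2 :=
  div_le_self (sq_nonneg _) (by exact_mod_cast hb)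

variable {u : State m dx dα dy}

/-- The stochastic gradient estimate has mean `(1/m) ∑_i hyper_i` and variance of order
`1 / min {n, b}`. -/
theorem isUnbiased_gradEst (hc : c.Pos) (h : p.Regular c) (hv : o.Valid p c) (hn1 : 1 ≤ n)
    (hn : n ≤ m) (hb : 1 ≤ b) (hu : u.Adm p.A c) :
    IsUnbiased (o.drawLaw n) (gradEst o u)
      ((1 / (m : ℝ)) • ∑ i, p.hyper i u.x (u.α i) (u.y i) (u.s i))
      (c.Vgrad / min (n : ℝ) (b : ℝ)) := by
  have := hv.prob_batches
  have hP := hv.prob_batchP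
  have hQ := hv.prob_batchQ
  have hn0 : (0 : ℝ) < n := by exact_mod_cast hn1
  have hm0 : (0 : ℝ) < m := by exact_mod_cast hn1.trans hn
  have hb0 : (0 : ℝ) < b := by exact_mod_cast hb
  have hμ := inv_pos.mpr hc.μg
  set V := 3 * c.σ ^ 2 * (1 + c.μg⁻¹ ^ 2 * (c.Cf ^ 2 + c.σ ^ 2) + c.Cgxy ^ 2 * c.μg⁻¹ ^ 2) with hV
  have hV0 : 0 ≤ V := by positivity
  set G := fun i => p.hyper i u.x (u.α i) (u.y i) (u.s i) with hG
  set X := fun (i : Fin m) (β : (Fin m → Fin b → Ξ) × (Fin m → Fin b → Z)) =>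
    o.fx i u.x (u.α i) (u.y i) (β.1 i) -
      o.gxy i u.x (u.y i) (β.2 i) (u.H i (o.fy i u.x (u.α i) (u.y i) (β.1 i))) with hXdef
  have hX : ∀ i, IsUnbiased o.batches (X i) (G i) (V / b) := by
    intro i
    have h1 := isUnbiased_sub_apply (hv.fx_unbiased i u.x _ (hu.α_mem i) (u.y i))
      (hv.fy_unbiased i u.x _ (hu.α_mem i) (u.y i)) (hv.gxy_unbiased i u.x (u.y i)) (u.H i)
      ((hu.coercive i).norm_inverse_le hc.μg)
    refine (h1.comp (hv.measurePreserving_batch i)).mono ?_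
    have e1 : ‖p.fy i u.x (u.α i) (u.y i)‖ ^ 2 ≤ c.Cf ^ 2 :=
      pow_le_pow_left₀ (norm_nonneg _) (h.norm_fy_le hc i u.x (hu.α_mem i) _) 2
    have e2 := h.gxy_bound i u.x (u.y i)
    have e3 := var_le c hb
    calc 3 * (c.σ ^ 2 / b) * (1 + c.μg⁻¹ ^ 2 * (‖p.fy i u.x (u.α i) (u.y i)‖ ^ 2 + c.σ ^ 2 / b) +
          ‖p.gxy i u.x (u.y i)‖ ^ 2 * c.μg⁻¹ ^ 2)
        ≤ 3 * (c.σ ^ 2 / b) * (1 + c.μg⁻¹ ^ 2 * (c.Cf ^ 2 + c.σ ^ 2) +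
          c.Cgxy ^ 2 * c.μg⁻¹ ^ 2) := by gcongr
      _ = V / b := by rw [hV]; ring
  -- Given the block set, the estimate has variance of order `1/b`.
  have hI : ∀ I : Finset (Fin m), I.card = n →
      IsUnbiased o.batches (fun β => gradEst o u (I, β)) ((1 / (n : ℝ)) • ∑ i ∈ I, G i)
        (V / b) := by
    intro I hI
    have hne : I.Nonempty := by rw [← Finset.card_pos]; omega
    have := IsUnbiased.avg hne fun i _ => hX i
    rw [hI] at this
    simpa only [gradEst, hI] using this
  have hmeas : AEStronglyMeasurable (gradEst o u)
      ((uniformOn {I : Finset (Fin m) | I.card = n}).prod o.batches) :=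
    ((measurable_gradEst hv).comp measurable_prodMk_left).aestronglyMeasurable
  have hint := integrable_blocks_prod hn (fun I hI' => (hI I hI').1) hmeas
  have hmean := integral_blocks_prod hn (fun I hI' => (hI I hI').1) hmeas
  have hB : ∀ i, ‖G i‖ ≤ c.Bhyp := fun i =>
    h.norm_hyper_le hc i u.x (hu.α_mem i) _ (hu.coercive i)
  -- Conditionally on the block set the error splits into sampling noise of the batches and the
  -- deviation of the block average from the full average. The latter has order `1/n`, since `hyper`
  -- is uniformly bounded at admissible states.
  have hvar : EBound ((uniformOn {I : Finset (Fin m) | I.card = n}).prod o.batches)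
      (fun w => ‖gradEst o u w - (1 / (m : ℝ)) • ∑ i, G i‖ ^ 2) (blockAvg n fun I =>
        ‖(1 / (n : ℝ)) • ∑ i ∈ I, G i - (1 / (m : ℝ)) • ∑ i, G i‖ ^ 2 + V / b) := by
    refine ebound_blocks_prod hn (fun I hI' => ?_)
      ((hmeas.sub aestronglyMeasurable_const).norm.pow 2)
    have := (hI I hI').ebound_norm_add_sq (-((1 / (m : ℝ)) • ∑ i, G i)) 1
    simpa only [one_smul, neg_add_eq_sub, one_pow, one_mul] using this
  rw [blockAvg_add, blockAvg_const hn] at hvar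
  refine ⟨hint, ?_, hvar.1, hvar.2.trans ?_⟩
  · refine hmean.trans ?_
    rw [Finset.sum_congr rfl fun I hI' => (hI I (Finset.mem_powersetCard.mp hI').2).mean,
      ← Finset.smul_sum, sum_powersetCard_sum hn, smul_smul, smul_smul]
    congr 1
    have := choose_pos' hn
    field_simp
  · have e1 := blockAvg_dev_le hn1 hn G hB
    have e2 : (0 : ℝ) < min (n : ℝ) (b : ℝ) := lt_min hn0 hb0
    have e3 : (2 * c.Bhyp) ^ 2 / n ≤ (2 * c.Bhyp) ^ 2 / min (n : ℝ) (b : ℝ) :=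
      div_le_div_of_nonneg_left (by positivity) e2 (min_le_left _ _)
    have e4 : V / b ≤ V / min (n : ℝ) (b : ℝ) :=
      div_le_div_of_nonneg_left hV0 e2 (min_le_right _ _)
    have e5 : c.Vgrad / min (n : ℝ) (b : ℝ) =
        V / min (n : ℝ) (b : ℝ) + (2 * c.Bhyp) ^ 2 / min (n : ℝ) (b : ℝ) := by
      rw [Consts.Vgrad, ← hV, add_div]
    linarith

/-- A deterministic gradient step: monotonicity yields `-2ημ_g`, and the quadratic term costs
`η²L_g² ≤ ημ_g`. -/
theorem norm_sub_smul_gy_sq_le (hc : c.Pos) (h : p.Regular c) {η : ℝ} (h0 : 0 ≤ η)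
    (h1 : η * c.Lg ^ 2 ≤ c.μg) (i : Fin m) (x : E dx) (y : E dy) :
    ‖(y - p.ySol i x) + (-η) • p.gy i x y‖ ^ 2 ≤ (1 - η * c.μg) * ‖y - p.ySol i x‖ ^ 2 := by
  have e1 := h.gy_mono i x y (p.ySol i x)
  have e2 := h.gy_lip hc i x x y (p.ySol i x)
  rw [h.gy_ySol hc, sub_zero] at e1 e2
  rw [sub_self, norm_zero, zero_add] at e2
  set a := y - p.ySol i x
  set g := p.gy i x y
  have e3 : ‖g‖ ^ 2 ≤ c.Lg ^ 2 * ‖a‖ ^ 2 := by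
    rw [← mul_pow]; exact pow_le_pow_left₀ (norm_nonneg _) e2 2
  rw [norm_add_sq_real, norm_smul, inner_smul_right, mul_pow, Real.norm_eq_abs, sq_abs,
    real_inner_comm a g] at *
  have e4 := mul_le_mul_of_nonneg_left e1 h0
  have e5 := mul_le_mul_of_nonneg_left e3 (sq_nonneg η)
  have e6 := mul_le_mul_of_nonneg_right h1 (mul_nonneg h0 (sq_nonneg ‖a‖))
  nlinarith

theorem ebound_y (hc : c.Pos) (h : p.Regular c) (hv : o.Valid p c) (hn : n ≤ m)
    {k : Steps} (h0 : 0 ≤ k.η₂) (h1 : k.η₂ * c.Lg ^ 2 ≤ c.μg) (u : State m dx dα dy) (i : Fin m) :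
    EBound (o.drawLaw n) (fun w => ‖(step p.A o k u w).y i - p.ySol i u.x‖ ^ 2)
      ((1 - (n : ℝ) / m * (k.η₂ * c.μg)) * ‖u.y i - p.ySol i u.x‖ ^ 2 +
        (n : ℝ) / m * (k.η₂ ^ 2 * (c.σ ^ 2 / b))) := by
  have := hv.prob_batchP
  have := hv.prob_batchQ
  have e1 := ((hv.gy_unbiased i u.x (u.y i)).ebound_norm_add_sq (u.y i - p.ySol i u.x)
    (-k.η₂)).comp (measurePreserving_snd (μ := o.batchP i) (ν := o.batchQ i))
  have e2 := hv.ebound_block hn i (‖u.y i - p.ySol i u.x‖ ^ 2) e1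
  have e3 : (fun w : Draw m b Ξ Z => ‖(step p.A o k u w).y i - p.ySol i u.x‖ ^ 2) = fun w =>
      if i ∈ w.1 then ‖u.y i - p.ySol i u.x + (-k.η₂) • o.gy i u.x (u.y i) (w.2.2 i)‖ ^ 2
      else ‖u.y i - p.ySol i u.x‖ ^ 2 := by
    ext w
    simp only [step]
    split_ifs
    · congr 2; module
    · rfl
  rw [e3]
  refine e2.mono ?_
  have e4 := mul_le_mul_of_nonneg_left (norm_sub_smul_gy_sq_le hc h h0 h1 i u.x (u.y i))
    (show (0 : ℝ) ≤ (n : ℝ) / m by positivity)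
  rw [neg_sq]
  linarith

/-- The same for ascent in `α`, but the gradient is evaluated at an inexact `y`. Of the contraction
`2ημ_f`, one half pays for the quadratic term, a quarter for the error in `y` through Young's
inequality, and a quarter is kept. -/
theorem norm_add_smul_fα_sq_le (hc : c.Pos) (h : p.Regular c) {η : ℝ} (h0 : 0 ≤ η)
    (h1 : η * c.Lf ^ 2 ≤ c.μf) (i : Fin m) (x : E dx) {α : E dα} (hα : α ∈ p.A) (y : E dy) :
    ‖(α - (p.αSol i x + η • p.fα i x (p.αSol i x) (p.ySol i x))) + η • p.fα i x α y‖ ^ 2 ≤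
      (1 - η * c.μf / 2) * ‖α - p.αSol i x‖ ^ 2 + η * c.κα * ‖y - p.ySol i x‖ ^ 2 := by
  have hα' := h.αSol_mem hc i x
  have e1 := h.fα_mono i x hα hα' y
  have e2 := h.fα_lip hc i x x hα' hα' y (p.ySol i x)
  have e3 := h.f_smooth i x x α hα _ hα' y (p.ySol i x)
  simp only [sub_self, norm_zero, zero_add, ne_eq, OfNat.ofNat_ne_zero, not_false_eq_true,
    zero_pow] at e2 e3
  set α' := p.αSol i x
  set y' := p.ySol i x
  set g := p.fα i x α y - p.fα i x α' y' with hg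
  have e4 : (α - (α' + η • p.fα i x α' y')) + η • p.fα i x α y = (α - α') + η • g := by
    rw [hg]; module
  have e5 : inner ℝ (α - α') g ≤ -(c.μf * ‖α - α'‖ ^ 2) + c.Lf * ‖y - y'‖ * ‖α - α'‖ := by
    have e6 : g = (p.fα i x α y - p.fα i x α' y) + (p.fα i x α' y - p.fα i x α' y') := by
      rw [hg]; abel
    rw [real_inner_comm, e6, inner_add_left]
    exact add_le_add e1 ((real_inner_le_norm _ _).trans
      (mul_le_mul_of_nonneg_right e2 (norm_nonneg _)))
  have e7 : ‖g‖ ^ 2 ≤ c.Lf ^ 2 * (‖α - α'‖ ^ 2 + ‖y - y'‖ ^ 2) := by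
    nlinarith [sq_nonneg ‖p.fx i x α y - p.fx i x α' y'‖,
      sq_nonneg ‖p.fy i x α y - p.fy i x α' y'‖]
  rw [e4, norm_add_sq_real, norm_smul, inner_smul_right, mul_pow, Real.norm_eq_abs, sq_abs]
  set A := ‖α - α'‖
  set Y := ‖y - y'‖
  -- Young's inequality, weighted so that the dual error costs only `μ_f / 2`.
  have e8 : 2 * (c.Lf * Y * A) ≤ c.μf / 2 * A ^ 2 + 2 * c.Lf ^ 2 / c.μf * Y ^ 2 := by
    have := hc.μf
    have e9 : c.μf / 2 * A ^ 2 + 2 * c.Lf ^ 2 / c.μf * Y ^ 2 - 2 * (c.Lf * Y * A) =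
        (c.μf * A - 2 * c.Lf * Y) ^ 2 / (2 * c.μf) := by field_simp; ring
    have e10 : 0 ≤ (c.μf * A - 2 * c.Lf * Y) ^ 2 / (2 * c.μf) := by positivity
    linarith
  have f1 := mul_le_mul_of_nonneg_left e5 h0
  have f2 := mul_le_mul_of_nonneg_left e8 h0
  have f3 := mul_le_mul_of_nonneg_left e7 (sq_nonneg η)
  have f4 := mul_le_mul_of_nonneg_right h1
    (mul_nonneg h0 (add_nonneg (sq_nonneg A) (sq_nonneg Y)))
  have f5 : η ^ 2 * (c.Lf ^ 2 * (A ^ 2 + Y ^ 2)) = η * c.Lf ^ 2 * (η * (A ^ 2 + Y ^ 2)) := by ring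
  rw [Consts.κα]
  linarith

theorem ebound_α (hc : c.Pos) (h : p.Regular c) (hv : o.Valid p c) (hn : n ≤ m)
    {k : Steps} (h0 : 0 ≤ k.η₁) (h1 : k.η₁ * c.Lf ^ 2 ≤ c.μf) (hu : u.Adm p.A c) (i : Fin m) :
    EBound (o.drawLaw n) (fun w => ‖(step p.A o k u w).α i - p.αSol i u.x‖ ^ 2)
      ((1 - (n : ℝ) / m * (k.η₁ * c.μf / 2)) * ‖u.α i - p.αSol i u.x‖ ^ 2 +
        (n : ℝ) / m * (k.η₁ * c.κα) * ‖u.y i - p.ySol i u.x‖ ^ 2 +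
        (n : ℝ) / m * (k.η₁ ^ 2 * (c.σ ^ 2 / b))) := by
  have := hv.prob_batchP
  have := hv.prob_batchQ
  have hsol := h.αSol_mem hc i u.x
  set g := p.fα i u.x (p.αSol i u.x) (p.ySol i u.x) with hg
  have e1 := (hv.fα_unbiased i u.x _ (hu.α_mem i) (u.y i)).ebound_norm_add_sq
    (u.α i - (p.αSol i u.x + k.η₁ • g)) k.η₁
  have hOm : Measurable (o.fα i u.x (u.α i) (u.y i)) :=
    (hv.fα_meas i).comp (f := fun ξ => (u.x, u.α i, u.y i, ξ))
      (measurable_const.prodMk (measurable_const.prodMk (measurable_const.prodMk measurable_id)))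
  have e2 : EBound (o.batchP i) (fun ξ => ‖proj p.A (u.α i + k.η₁ • o.fα i u.x (u.α i) (u.y i) ξ) -
      p.αSol i u.x‖ ^ 2) (‖(u.α i - (p.αSol i u.x + k.η₁ • g)) +
        k.η₁ • p.fα i u.x (u.α i) (u.y i)‖ ^ 2 + k.η₁ ^ 2 * (c.σ ^ 2 / b)) := by
    refine e1.mono_left ?_ (fun _ => by positivity) (Eventually.of_forall fun ξ => ?_)
    · exact ((((continuous_proj h.A_nonempty h.A_closed h.A_convex).measurable.comp
        ((hOm.const_smul k.η₁).const_add _)).sub_const _).norm.pow_const 2).aestronglyMeasurable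
    · refine pow_le_pow_left₀ (norm_nonneg _) ?_ 2
      -- By its variational inequality `α_i(x)` is the projection of `α_i(x) + η₁ g`, so the two
      -- points before projection may be compared.
      refine (norm_proj_sub_le h.A_nonempty h.A_closed h.A_convex hsol (g := k.η₁ • g)
        fun b hb => ?_).trans (le_of_eq ?_)
      · rw [real_inner_smul_left]
        exact mul_nonpos_of_nonneg_of_nonpos h0 (h.αSol_vi hc i u.x hb)
      · congr 1; module
  have e3 := hv.ebound_block hn i (‖u.α i - p.αSol i u.x‖ ^ 2)
    (e2.comp (measurePreserving_fst (μ := o.batchP i) (ν := o.batchQ i)))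
  have e4 : (fun w : Draw m b Ξ Z => ‖(step p.A o k u w).α i - p.αSol i u.x‖ ^ 2) = fun w =>
      if i ∈ w.1 then ‖proj p.A (u.α i + k.η₁ • o.fα i u.x (u.α i) (u.y i) (w.2.1 i)) -
        p.αSol i u.x‖ ^ 2
      else ‖u.α i - p.αSol i u.x‖ ^ 2 := by
    ext w
    simp only [step]
    split_ifs <;> rfl
  rw [e4]
  refine e3.mono ?_
  have e5 := mul_le_mul_of_nonneg_left
    (norm_add_smul_fα_sq_le hc h h0 h1 i u.x (hu.α_mem i) (u.y i))
    (show (0 : ℝ) ≤ (n : ℝ) / m by positivity)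
  linarith

/-- The matrix recursion tested on the fixed vector `dir`, with `x` held fixed. There the oracle is
an unbiased vector estimate, so its noise enters with `β₁²` and no dimension appears; its mean
`∇²_{yy} g(x, y)` is off by the error in `y`. -/
theorem ebound_s_dir (hc : c.Pos) (h : p.Regular c) (hv : o.Valid p c) (hn : n ≤ m)
    {k : Steps} (h0 : 0 ≤ k.β₁) (h1 : k.β₁ ≤ 1) (u : State m dx dα dy) (i : Fin m) :
    EBound (o.drawLaw n)
      (fun w => ‖((step p.A o k u w).s i - p.hess i u.x) (p.dir i u.x)‖ ^ 2)
      ((1 - (n : ℝ) / m * k.β₁) * ‖(u.s i - p.hess i u.x) (p.dir i u.x)‖ ^ 2 +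
        (n : ℝ) / m * (k.β₁ * ((c.Lgyy * (c.μg⁻¹ * c.Cf)) ^ 2 * ‖u.y i - p.ySol i u.x‖ ^ 2)) +
        (n : ℝ) / m * (k.β₁ ^ 2 * ((c.μg⁻¹ * c.Cf) ^ 2 * (c.σ ^ 2 / b)))) := by
  have := hv.prob_batchP
  have := hv.prob_batchQ
  set v := p.dir i u.x with hvdef
  set S := p.hess i u.x with hS
  have hvn : ‖v‖ ≤ c.μg⁻¹ * c.Cf := h.norm_dir_le hc i u.x
  have e1 := (((hv.gyy_unbiased i u.x (u.y i)).apply v).ebound_norm_add_sq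
    ((1 - k.β₁) • u.s i v - S v) k.β₁).comp
      (measurePreserving_snd (μ := o.batchP i) (ν := o.batchQ i))
  have e2 := hv.ebound_block hn i (‖(u.s i - S) v‖ ^ 2) e1
  have e3 : (fun w : Draw m b Ξ Z => ‖((step p.A o k u w).s i - S) v‖ ^ 2) = fun w =>
      if i ∈ w.1 then ‖(1 - k.β₁) • u.s i v - S v + k.β₁ • o.gyy i u.x (u.y i) (w.2.2 i) v‖ ^ 2
      else ‖(u.s i - S) v‖ ^ 2 := by
    ext w
    simp only [step]
    split_ifs
    · simp only [sub_apply, add_apply, smul_apply]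
      congr 2; module
    · rfl
  rw [e3]
  refine e2.mono ?_
  -- Convexity of the squared norm, without a Young factor.
  have e4 : ‖(1 - k.β₁) • u.s i v - S v + k.β₁ • p.gyy i u.x (u.y i) v‖ ^ 2 ≤
      (1 - k.β₁) * ‖(u.s i - S) v‖ ^ 2 + k.β₁ * ‖(p.gyy i u.x (u.y i) - S) v‖ ^ 2 := by
    have : (1 - k.β₁) • u.s i v - S v + k.β₁ • p.gyy i u.x (u.y i) v =
        (1 - k.β₁) • (u.s i - S) v + k.β₁ • (p.gyy i u.x (u.y i) - S) v := by
      simp only [sub_apply]; module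
    rw [this]
    have hconv := (convexOn_univ_norm (E := E dy)).pow (fun _ _ => norm_nonneg _) 2
    have := hconv.2 (mem_univ ((u.s i - S) v)) (mem_univ ((p.gyy i u.x (u.y i) - S) v))
      (sub_nonneg.mpr h1) h0 (by ring)
    simpa using this
  have e5 : ‖(p.gyy i u.x (u.y i) - S) v‖ ^ 2 ≤
      (c.Lgyy * (c.μg⁻¹ * c.Cf)) ^ 2 * ‖u.y i - p.ySol i u.x‖ ^ 2 := by
    rw [← mul_pow]
    refine pow_le_pow_left₀ (norm_nonneg _) ?_ 2
    have e6 := h.gyy_lip hc i u.x u.x (u.y i) (p.ySol i u.x)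
    rw [sub_self, norm_zero, zero_add] at e6
    calc ‖(p.gyy i u.x (u.y i) - S) v‖ ≤ ‖p.gyy i u.x (u.y i) - S‖ * ‖v‖ :=
          ContinuousLinearMap.le_opNorm _ _
      _ ≤ (c.Lgyy * ‖u.y i - p.ySol i u.x‖) * (c.μg⁻¹ * c.Cf) :=
          mul_le_mul e6 hvn (norm_nonneg _) (mul_nonneg hc.Lgyy.le (norm_nonneg _))
      _ = _ := by ring
  have e7 : ‖v‖ ^ 2 ≤ (c.μg⁻¹ * c.Cf) ^ 2 := pow_le_pow_left₀ (norm_nonneg _) hvn 2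
  have hr : (0 : ℝ) ≤ (n : ℝ) / m := by positivity
  have f1 := mul_le_mul_of_nonneg_left e4 hr
  have f2 := mul_le_mul_of_nonneg_left e5 (mul_nonneg hr h0)
  have f3 := mul_le_mul_of_nonneg_left e7
    (show 0 ≤ (n : ℝ) / m * (k.β₁ ^ 2 * (c.σ ^ 2 / b)) by positivity)
  linarith

/-- The excess of the norm of a Hessian estimate over `Khess`. -/
noncomputable def Consts.excess (c : Consts) {d : ℕ} (s : E d →L[ℝ] E d) : ℝ :=
  max (‖s‖ - c.Khess) 0

theorem Consts.excess_nonneg (c : Consts) {d : ℕ} (s : E d →L[ℝ] E d) : 0 ≤ c.excess s :=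
  le_max_right _ _

theorem Consts.continuous_excess (c : Consts) (d : ℕ) :
    Continuous (c.excess : (E d →L[ℝ] E d) → ℝ) := by
  unfold Consts.excess; fun_prop

theorem measurable_step_s (h : p.Regular c) (hv : o.Valid p c) (k : Steps)
    (u : State m dx dα dy) (i : Fin m) :
    Measurable fun w : Draw m b Ξ Z => (step p.A o k u w).s i :=
  (State.measurable_s i).comp (measurable_step_right h hv k u)

/-- A scalar recursion obtained from the triangle inequality in the spectral norm. The threshold
`L_g + σ` exceeds the mean of `L_g + ‖O - G‖`, so the new excess is dominated by the contracted old
one plus centred noise of size `β₁`. -/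
theorem ebound_excess (hc : c.Pos) (h : p.Regular c) (hv : o.Valid p c) (hn : n ≤ m) (hb : 1 ≤ b)
    {k : Steps} (h0 : 0 ≤ k.β₁) (h1 : k.β₁ ≤ 1) (u : State m dx dα dy) (i : Fin m) :
    EBound (o.drawLaw n) (fun w => c.excess ((step p.A o k u w).s i) ^ 2)
      ((1 - (n : ℝ) / m * k.β₁) * c.excess (u.s i) ^ 2 +
        (n : ℝ) / m * (k.β₁ ^ 2 * (c.σ ^ 2 / b))) := by
  have := hv.prob_batchP
  have := hv.prob_batchQ
  obtain ⟨a, ha0, ha, hi, hia, hdev⟩ := (hv.gyy_unbiased i u.x (u.y i)).exists_mean_dev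
  have haσ : a ≤ c.σ := (abs_le_of_sq_le_sq' (ha.trans (var_le c hb)) hc.σ.le).2
  set O := o.gyy i u.x (u.y i)
  set G := p.gyy i u.x (u.y i) with hG
  set W := c.excess (u.s i) with hW
  have hW0 : 0 ≤ W := c.excess_nonneg _
  have e1 : EBound (o.batchQ i)
      (fun ζ => ((1 - k.β₁) * W + k.β₁ * (‖O ζ - G‖ - a)) ^ 2)
      ((1 - k.β₁) * W ^ 2 + k.β₁ ^ 2 * (c.σ ^ 2 / b)) := by
    have hz : Integrable (fun ζ => ‖O ζ - G‖ - a) (o.batchQ i) := hi.sub (integrable_const a)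
    have hz0 : ∫ ζ, (‖O ζ - G‖ - a) ∂(o.batchQ i) = 0 := by
      rw [integral_sub hi (integrable_const a), hia]; simp
    have f1 : EBound (o.batchQ i)
        (fun ζ => 2 * ((1 - k.β₁) * W) * k.β₁ * (‖O ζ - G‖ - a)) 0 :=
      ⟨hz.const_mul _, by rw [integral_const_mul, hz0, mul_zero]⟩
    have f2 := (EBound.const (ν := o.batchQ i) (((1 - k.β₁) * W) ^ 2)).add
      (f1.add (hdev.const_mul (sq_nonneg k.β₁)))
    have f3 : (fun ζ => ((1 - k.β₁) * W + k.β₁ * (‖O ζ - G‖ - a)) ^ 2) = fun ζ =>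
        ((1 - k.β₁) * W) ^ 2 + (2 * ((1 - k.β₁) * W) * k.β₁ * (‖O ζ - G‖ - a) +
          k.β₁ ^ 2 * (‖O ζ - G‖ - a) ^ 2) := by ext; ring
    rw [f3]
    refine f2.mono ?_
    have : ((1 - k.β₁) * W) ^ 2 ≤ (1 - k.β₁) * W ^ 2 := by
      rw [mul_pow]
      exact mul_le_mul_of_nonneg_right (by nlinarith) (sq_nonneg _)
    linarith
  have e2 := hv.ebound_block hn i (W ^ 2)
    (e1.comp (measurePreserving_snd (μ := o.batchP i) (ν := o.batchQ i)))
  refine (e2.mono (le_of_eq (by ring))).mono_left ?_ (fun _ => sq_nonneg _)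
    (Eventually.of_forall fun w => ?_)
  · exact (((c.continuous_excess dy).measurable.comp
      (measurable_step_s h hv k u i)).pow_const 2).aestronglyMeasurable
  · simp only [step]
    split_ifs with hiw
    · set ζ := w.2.2 i
      have g1 : ‖O ζ‖ ≤ c.Lg + ‖O ζ - G‖ := by
        have := norm_le_norm_add_norm_sub' (O ζ) G
        have := h.norm_gyy_le hc i u.x (u.y i)
        linarith
      have g2 : ‖(1 - k.β₁) • u.s i + k.β₁ • O ζ‖ ≤ (1 - k.β₁) * ‖u.s i‖ + k.β₁ * ‖O ζ‖ := by
        refine (norm_add_le _ _).trans (le_of_eq ?_)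
        rw [norm_smul, norm_smul, Real.norm_of_nonneg (sub_nonneg.mpr h1), Real.norm_of_nonneg h0]
      have g3 : ‖u.s i‖ - c.Khess ≤ W := le_max_left _ _
      -- Subtracting the mean deviation `a ≤ σ` leaves a noise of mean zero, so the square has no
      -- cross term.
      have g4 : ‖(1 - k.β₁) • u.s i + k.β₁ • O ζ‖ - c.Khess ≤
          (1 - k.β₁) * W + k.β₁ * (‖O ζ - G‖ - a) := by
        have f1 := mul_le_mul_of_nonneg_left g3 (sub_nonneg.mpr h1)
        have f2 : ‖O ζ‖ - c.Khess ≤ ‖O ζ - G‖ - a := by rw [Consts.Khess]; linarith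
        have f3 := mul_le_mul_of_nonneg_left f2 h0
        linarith
      have g5 : c.excess ((1 - k.β₁) • u.s i + k.β₁ • O ζ) ≤
          |(1 - k.β₁) * W + k.β₁ * (‖O ζ - G‖ - a)| :=
        max_le (g4.trans (le_abs_self _)) (abs_nonneg _)
      have g6 := pow_le_pow_left₀ (c.excess_nonneg _) g5 2
      rwa [sq_abs] at g6
    · exact le_rfl

/-- The cutoff can rise only if it was below `1`, that is if `‖s‖ > 2K`. The rise is then of order
`β₁ (K + ‖s‖) / K` in the mean, and the excess, being larger than `K`, dominates it quadratically.
-/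
theorem ebound_cut (hc : c.Pos) (h : p.Regular c) (hv : o.Valid p c) (hn : n ≤ m) (hb : 1 ≤ b)
    {k : Steps} (h0 : 0 ≤ k.β₁) (u : State m dx dα dy) (i : Fin m) :
    EBound (o.drawLaw n)
      (fun w => max (cut c.Khess ‖(step p.A o k u w).s i‖ - cut c.Khess ‖u.s i‖) 0)
      ((n : ℝ) / m * (3 * k.β₁ / c.Khess ^ 2 * c.excess (u.s i) ^ 2)) := by
  have := hv.prob_batchP
  have := hv.prob_batchQ
  have := hv.prob_drawLaw (n := n) hn
  have hK := hc.Khess_pos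
  have hmeas : AEStronglyMeasurable (fun w =>
      max (cut c.Khess ‖(step p.A o k u w).s i‖ - cut c.Khess ‖u.s i‖) 0) (o.drawLaw n) :=
    ((((continuous_cut _).measurable.comp (measurable_step_s h hv k u i).norm).sub_const _).max
      measurable_const).aestronglyMeasurable
  have hnn : ∀ w : Draw m b Ξ Z,
      0 ≤ max (cut c.Khess ‖(step p.A o k u w).s i‖ - cut c.Khess ‖u.s i‖) 0 :=
    fun w => le_max_right _ _
  by_cases hs : ‖u.s i‖ ≤ 2 * c.Khess
  · refine ((EBound.const (ν := o.drawLaw n) 0).mono (by positivity)).mono_left hmeas hnn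
      (Eventually.of_forall fun w => ?_)
    rw [cut_eq_one hK hs]
    exact max_le (sub_nonpos.mpr (cut_le_one _ _)) le_rfl
  push Not at hs
  obtain ⟨a, ha0, ha, hi, hia, -⟩ := (hv.gyy_unbiased i u.x (u.y i)).exists_mean_dev
  have haσ : a ≤ c.σ := (abs_le_of_sq_le_sq' (ha.trans (var_le c hb)) hc.σ.le).2
  set O := o.gyy i u.x (u.y i)
  set G := p.gyy i u.x (u.y i) with hG
  have e1 : EBound (o.batchQ i) (fun ζ => k.β₁ / c.Khess * (‖O ζ - G‖ + (c.Lg + ‖u.s i‖)))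
      (k.β₁ / c.Khess * (a + (c.Lg + ‖u.s i‖))) :=
    (EBound.add ⟨hi, hia.le⟩ (EBound.const _)).const_mul (by positivity)
  have e2 := hv.ebound_block hn i 0
    (e1.comp (measurePreserving_snd (μ := o.batchP i) (ν := o.batchQ i)))
  refine (e2.mono ?_).mono_left hmeas hnn (Eventually.of_forall fun w => ?_)
  · have f1 : c.excess (u.s i) = ‖u.s i‖ - c.Khess := max_eq_left (by linarith)
    have f2 : k.β₁ / c.Khess * (a + (c.Lg + ‖u.s i‖)) ≤
        3 * k.β₁ / c.Khess ^ 2 * c.excess (u.s i) ^ 2 := by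
      rw [f1, show 3 * k.β₁ / c.Khess ^ 2 * (‖u.s i‖ - c.Khess) ^ 2 =
        k.β₁ / c.Khess * (3 * (‖u.s i‖ - c.Khess) ^ 2 / c.Khess) by field_simp]
      refine mul_le_mul_of_nonneg_left ?_ (by positivity)
      rw [le_div_iff₀ hK]
      -- With `e = ‖s‖ - K > K` one has `K + ‖s‖ = 2K + e ≤ 3e ≤ 3e²/K`, whence the factor `3`.
      have f3 : a + (c.Lg + ‖u.s i‖) ≤ c.Khess + ‖u.s i‖ := by rw [Consts.Khess]; linarith
      nlinarith
    rw [mul_zero, add_zero]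
    exact mul_le_mul_of_nonneg_left f2 (by positivity)
  · simp only [step]
    split_ifs with hiw
    · set ζ := w.2.2 i
      have g1 : ‖O ζ‖ ≤ c.Lg + ‖O ζ - G‖ := by
        have := norm_le_norm_add_norm_sub' (O ζ) G
        have := h.norm_gyy_le hc i u.x (u.y i)
        linarith
      refine max_le ((cut_sub_le hK _ _).trans ?_)
        (mul_nonneg (div_nonneg h0 hK.le) (by have := hc.Lg; positivity))
      have g2 : |‖(1 - k.β₁) • u.s i + k.β₁ • O ζ‖ - ‖u.s i‖| ≤ k.β₁ * (‖O ζ‖ + ‖u.s i‖) := by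
        refine (abs_norm_sub_norm_le _ _).trans ?_
        rw [show (1 - k.β₁) • u.s i + k.β₁ • O ζ - u.s i = k.β₁ • (O ζ - u.s i) by module,
          norm_smul, Real.norm_of_nonneg h0]
        exact mul_le_mul_of_nonneg_left (norm_sub_le _ _) h0
      rw [div_mul_eq_mul_div]
      refine div_le_div_of_nonneg_right (g2.trans ?_) hK.le
      exact mul_le_mul_of_nonneg_left (by linarith) h0
    · simp

end OneStep

end MinMaxBilevel

/-! ### The Hessian error `hessErr`, the bias of the hypergradient, and the drift of the errors with
`x`. -/

namespace MinMaxBilevel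

open Filter Topology Set

theorem add_sq_le_young {a x y : ℝ} (h0 : 0 < a) (h1 : a ≤ 1) :
    (x + y) ^ 2 ≤ (1 + a) * x ^ 2 + 2 / a * y ^ 2 := by
  have e1 : (1 + a) * x ^ 2 + 2 / a * y ^ 2 - (x + y) ^ 2 =
      ((a * x - y) ^ 2 + (1 - a) * y ^ 2) / a := by field_simp; ring
  have e2 : 0 ≤ ((a * x - y) ^ 2 + (1 - a) * y ^ 2) / a :=
    div_nonneg (add_nonneg (sq_nonneg _) (mul_nonneg (sub_nonneg.mpr h1) (sq_nonneg _))) h0.le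
  linarith

theorem norm_sub_sq_le_young {V : Type*} [SeminormedAddCommGroup V] {a L : ℝ} (h0 : 0 < a)
    (h1 : a ≤ 1) (x y z : V) (hL : ‖y - z‖ ≤ L) :
    ‖x - z‖ ^ 2 ≤ (1 + a) * ‖x - y‖ ^ 2 + 2 / a * L ^ 2 := by
  refine (pow_le_pow_left₀ (norm_nonneg _)
    ((norm_sub_le_norm_sub_add_norm_sub x y z).trans (add_le_add_right hL _)) 2).trans ?_
  exact add_sq_le_young h0 h1

/-- Drift and bias together are written as `β t`, and convexity gives `(1 - β) e² + β t²`. Thus the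
old error keeps the factor `1 - β`, the drift is divided by `β`, and the bias is multiplied by it.
-/
theorem convex_add_sq_le {β e d b : ℝ} (h0 : 0 < β) (h1 : β ≤ 1) (hd : 0 ≤ d) (hb : 0 ≤ b) :
    ((1 - β) * e + (1 - β) * d + β * b) ^ 2 ≤
      (1 - β) * e ^ 2 + 2 / β * d ^ 2 + 2 * β * b ^ 2 := by
  have h2 := sub_nonneg.mpr h1
  set t := ((1 - β) * d + β * b) / β with ht
  have e1 : β * t = (1 - β) * d + β * b := by rw [ht]; field_simp
  have e2 : ((1 - β) * e + β * t) ^ 2 ≤ (1 - β) * e ^ 2 + β * t ^ 2 := by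
    nlinarith [mul_nonneg (mul_nonneg h2 h0.le) (sq_nonneg (e - t))]
  have e3 : (β * t) ^ 2 ≤ 2 * d ^ 2 + 2 * (β * b) ^ 2 := by
    have : β * t ≤ d + β * b := by rw [e1]; nlinarith
    have h3 : 0 ≤ β * t := by rw [e1]; positivity
    nlinarith [sq_nonneg (d - β * b), mul_nonneg h0.le hb]
  have e4 : β * t ^ 2 ≤ 2 / β * d ^ 2 + 2 * β * b ^ 2 := by
    have : 2 / β * d ^ 2 + 2 * β * b ^ 2 = (2 * d ^ 2 + 2 * (β * b) ^ 2) / β := by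
      field_simp
    rw [this, le_div_iff₀ h0]
    linarith
  have e5 : (1 - β) * e + (1 - β) * d + β * b = (1 - β) * e + β * t := by rw [e1]; ring
  rw [e5]
  linarith

namespace Consts

variable (c : Consts)

/-- A bound for `Problem.dir`. -/
noncomputable def Bdir : ℝ := c.μg⁻¹ * c.Cf

/-- The weight of `Consts.excess` in `hessErr`. -/
noncomputable def lam : ℝ := 192 * c.Bdir ^ 2

/-- The factor of the lower-level error in the recursion for `hessErr`. -/
noncomputable def κy : ℝ := (c.Lgyy * c.Bdir) ^ 2

/-- The factor of the oracle variance in the recursion for `hessErr`. -/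
noncomputable def κs : ℝ := 194 * c.Bdir ^ 2

/-- The factor of `hessErr` in the error of the linear solve. -/
noncomputable def κq : ℝ := c.μg⁻¹ ^ 2 + (c.Khess ^ 2)⁻¹

/-- The factor of the squared Hessian error in a bound for `hessErr`. -/
noncomputable def κi : ℝ := 193 * c.Bdir ^ 2

/-- A bound for the residual of a Hessian estimate below the cutoff. -/
noncomputable def Bcut : ℝ := 4 * c.Khess * c.Bdir

/-- A Lipschitz constant, in `x`, of the residual of a Hessian estimate below the cutoff. -/
noncomputable def Lcut : ℝ := 4 * c.Khess * c.Ldir + c.Lgyy * (1 + c.Cy) * c.Bdir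

/-- The factor of the inner errors in the squared bias. -/
noncomputable def Kin : ℝ := 3 * c.Lhyp ^ 2

/-- The factor of `hessErr` in the squared bias. -/
noncomputable def Kh : ℝ := 3 * c.Cgxy ^ 2 * c.κq

/-- The weight of the dual error in the Lyapunov function. -/
noncomputable def wα : ℝ := 4 * c.Kin

/-- The weight of the Hessian error in the Lyapunov function. -/
noncomputable def ws : ℝ := 4 * c.Kh

/-- The weight of the lower-level error in the Lyapunov function. -/
noncomputable def wy : ℝ := 4 * c.Kin + 8 * c.κα / c.μf * c.wα + 4 * c.κy * c.ws

variable {c}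

theorem Pos.Bdir_pos (hc : c.Pos) : 0 < c.Bdir := mul_pos (inv_pos.mpr hc.μg) hc.Cf

theorem Pos.lam_pos (hc : c.Pos) : 0 < c.lam := by
  have := hc.Bdir_pos; unfold lam; positivity

theorem Pos.κy_pos (hc : c.Pos) : 0 < c.κy := by
  have := hc.Bdir_pos; have := hc.Lgyy; unfold κy; positivity

theorem Pos.κs_pos (hc : c.Pos) : 0 < c.κs := by
  have := hc.Bdir_pos; unfold κs; positivity

theorem Pos.κq_pos (hc : c.Pos) : 0 < c.κq := by
  have := hc.Khess_pos; have := hc.μg; unfold κq; positivity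

theorem Pos.κi_pos (hc : c.Pos) : 0 < c.κi := by
  have := hc.Bdir_pos; unfold κi; positivity

theorem Pos.Lcut_pos (hc : c.Pos) : 0 < c.Lcut := by
  have := hc.Bdir_pos; have := hc.Khess_pos; have := hc.Ldir_pos; have := hc.Lgyy
  have := hc.Cy_pos; unfold Lcut; positivity

theorem Pos.Kin_pos (hc : c.Pos) : 0 < c.Kin := by
  have := hc.Lhyp_pos; unfold Kin; positivity

theorem Pos.Kh_pos (hc : c.Pos) : 0 < c.Kh := by
  have := hc.κq_pos; have := hc.Cgxy; unfold Kh; positivity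

theorem Pos.wα_pos (hc : c.Pos) : 0 < c.wα := by
  have := hc.Kin_pos; unfold wα; positivity

theorem Pos.ws_pos (hc : c.Pos) : 0 < c.ws := by
  have := hc.Kh_pos; unfold ws; positivity

theorem Pos.wy_pos (hc : c.Pos) : 0 < c.wy := by
  have := hc.Kin_pos; have := hc.κα_pos; have := hc.wα_pos; have := hc.κy_pos
  have := hc.ws_pos; have := hc.μf; unfold wy; positivity

end Consts

section Errors

variable {m dx dα dy : ℕ}

/-- The Lyapunov function of a Hessian estimate: the squared residual in the direction that enters
the hypergradient, cut off where the norm of the estimate is large, plus a multiple of the squared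
excess of that norm. -/
noncomputable def hessErr (p : Problem m dx dα dy) (c : Consts) (i : Fin m)
    (u : State m dx dα dy) : ℝ :=
  cut c.Khess ‖u.s i‖ * ‖(u.s i - p.hess i u.x) (p.dir i u.x)‖ ^ 2 +
    c.lam * c.excess (u.s i) ^ 2

/-- A bound for the squared error of the hypergradient of block `i`. -/
noncomputable def biasBound (p : Problem m dx dα dy) (c : Consts) (i : Fin m)
    (u : State m dx dα dy) : ℝ :=
  c.Kin * ‖u.α i - p.αSol i u.x‖ ^ 2 + c.Kin * ‖u.y i - p.ySol i u.x‖ ^ 2 +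
    c.Kh * hessErr p c i u

variable {p : Problem m dx dα dy} {c : Consts} {u : State m dx dα dy}

theorem hessErr_nonneg (hc : c.Pos) (i : Fin m) (u : State m dx dα dy) : 0 ≤ hessErr p c i u :=
  add_nonneg (mul_nonneg (cut_nonneg _ _) (sq_nonneg _)) (mul_nonneg hc.lam_pos.le (sq_nonneg _))

theorem biasBound_nonneg (hc : c.Pos) (i : Fin m) (u : State m dx dα dy) :
    0 ≤ biasBound p c i u := by
  have := hessErr_nonneg (p := p) hc i u; have := hc.Kin_pos; have := hc.Kh_pos
  unfold biasBound; positivity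

theorem hessErr_le (hc : c.Pos) (h : p.Regular c) (i : Fin m) (u : State m dx dα dy) :
    hessErr p c i u ≤ c.κi * ‖u.s i - p.hess i u.x‖ ^ 2 := by
  have e1 : ‖(u.s i - p.hess i u.x) (p.dir i u.x)‖ ^ 2 ≤
      ‖u.s i - p.hess i u.x‖ ^ 2 * c.Bdir ^ 2 := by
    rw [← mul_pow]
    exact pow_le_pow_left₀ (norm_nonneg _) ((ContinuousLinearMap.le_opNorm _ _).trans
      (mul_le_mul_of_nonneg_left (h.norm_dir_le hc i u.x) (norm_nonneg _))) 2
  have e2 : c.excess (u.s i) ≤ ‖u.s i - p.hess i u.x‖ := by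
    refine max_le ?_ (norm_nonneg _)
    have := norm_le_norm_add_norm_sub' (u.s i) (p.hess i u.x)
    have := h.norm_hess_le hc i u.x
    rw [Consts.Khess]
    linarith [hc.σ]
  have e3 := mul_le_mul_of_nonneg_left (pow_le_pow_left₀ (c.excess_nonneg _) e2 2) hc.lam_pos.le
  have e4 := mul_le_mul_of_nonneg_right (cut_le_one c.Khess ‖u.s i‖)
    (sq_nonneg ‖(u.s i - p.hess i u.x) (p.dir i u.x)‖)
  rw [hessErr, Consts.κi]
  rw [Consts.lam] at *
  linarith

/-- If `‖s‖ ≤ 2K`, the cutoff is `1` and the resolvent identity bounds the error by the residual.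
Otherwise both solves are bounded by `Bdir`, and the excess is at least `K`, so that its term in
`hessErr` dominates `4 Bdir²`. -/
theorem norm_solve_sub_sq_le (hc : c.Pos) (h : p.Regular c) (hu : u.Adm p.A c) (i : Fin m) :
    ‖(u.s i).inverse (p.fySol i u.x) - (p.hess i u.x).inverse (p.fySol i u.x)‖ ^ 2 ≤
      c.κq * hessErr p c i u := by
  have hμ := inv_pos.mpr hc.μg
  have hK := hc.Khess_pos
  have hs := hu.coercive i
  have hS := h.hess_coercive i u.x
  have hl := hc.lam_pos
  have hB := hc.Bdir_pos
  rw [Consts.κq, hessErr]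
  by_cases hn : ‖u.s i‖ ≤ 2 * c.Khess
  · rw [cut_eq_one hK hn, one_mul, hs.inverse_sub_inverse_apply hc.μg hS]
    have e1 := pow_le_pow_left₀ (norm_nonneg _) (hs.norm_inverse_apply_le hc.μg
      ((p.hess i u.x - u.s i) ((p.hess i u.x).inverse (p.fySol i u.x)))) 2
    have e2 : ‖(p.hess i u.x - u.s i) ((p.hess i u.x).inverse (p.fySol i u.x))‖ =
        ‖(u.s i - p.hess i u.x) (p.dir i u.x)‖ := by
      rw [← neg_sub (u.s i), neg_apply, norm_neg]; rfl
    rw [mul_pow, e2] at e1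
    have e3 : 0 ≤ (c.Khess ^ 2)⁻¹ * ‖(u.s i - p.hess i u.x) (p.dir i u.x)‖ ^ 2 := by positivity
    have e4 : 0 ≤ (c.μg⁻¹ ^ 2 + (c.Khess ^ 2)⁻¹) * (c.lam * c.excess (u.s i) ^ 2) := by positivity
    linarith
  · push Not at hn
    have e1 : ‖(u.s i).inverse (p.fySol i u.x) - (p.hess i u.x).inverse (p.fySol i u.x)‖ ≤
        2 * c.Bdir := by
      have f1 := (hs.norm_inverse_apply_le hc.μg (p.fySol i u.x)).trans
        (mul_le_mul_of_nonneg_left (h.norm_fySol_le hc i u.x) hμ.le)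
      have f2 := (hS.norm_inverse_apply_le hc.μg (p.fySol i u.x)).trans
        (mul_le_mul_of_nonneg_left (h.norm_fySol_le hc i u.x) hμ.le)
      refine (norm_sub_le _ _).trans ?_
      rw [Consts.Bdir]
      linarith
    have e2 := pow_le_pow_left₀ (norm_nonneg _) e1 2
    have e3 : c.Khess ≤ c.excess (u.s i) := le_max_of_le_left (by linarith)
    have e4 : 1 ≤ (c.Khess ^ 2)⁻¹ * c.excess (u.s i) ^ 2 := by
      rw [inv_mul_eq_div, one_le_div (by positivity)]
      exact pow_le_pow_left₀ hK.le e3 2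
    have e5 : c.lam ≤ c.lam * ((c.Khess ^ 2)⁻¹ * c.excess (u.s i) ^ 2) :=
      le_mul_of_one_le_right hl.le e4
    have e6 : 0 ≤ (c.μg⁻¹ ^ 2 + (c.Khess ^ 2)⁻¹) *
        (cut c.Khess ‖u.s i‖ * ‖(u.s i - p.hess i u.x) (p.dir i u.x)‖ ^ 2) := by
      have := cut_nonneg c.Khess ‖u.s i‖; positivity
    have e7 : 0 ≤ c.μg⁻¹ ^ 2 * (c.lam * c.excess (u.s i) ^ 2) := by positivity
    rw [Consts.lam] at *
    nlinarith [sq_nonneg c.Bdir]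

theorem norm_avg_sq_le {V : Type*} [SeminormedAddCommGroup V] [NormedSpace ℝ V] {m : ℕ}
    (v : Fin m → V) : ‖(1 / (m : ℝ)) • ∑ i, v i‖ ^ 2 ≤ (1 / (m : ℝ)) * ∑ i, ‖v i‖ ^ 2 := by
  rcases Nat.eq_zero_or_pos m with rfl | hm
  · simp
  have hm' : (0 : ℝ) < m := by exact_mod_cast hm
  rw [norm_smul, mul_pow, Real.norm_eq_abs, sq_abs]
  have h2 : ‖∑ i, v i‖ ^ 2 ≤ m * ∑ i, ‖v i‖ ^ 2 := by
    have := (pow_le_pow_left₀ (norm_nonneg _) (norm_sum_le Finset.univ v) 2).trans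
      (sq_sum_le_card_mul_sum_sq (s := Finset.univ) (f := fun i => ‖v i‖))
    simpa using this
  calc (1 / (m : ℝ)) ^ 2 * ‖∑ i, v i‖ ^ 2 ≤ (1 / (m : ℝ)) ^ 2 * (m * ∑ i, ‖v i‖ ^ 2) :=
        mul_le_mul_of_nonneg_left h2 (by positivity)
    _ = _ := by field_simp

/-- `hyper_sub_le` block by block, followed by Jensen; the solve error is measured at the exact
right-hand side, where `hessErr` controls it. -/
theorem bias_sq_le (hc : c.Pos) (h : p.Regular c) (hu : u.Adm p.A c) :
    ‖gradient p.F u.x - (1 / (m : ℝ)) • ∑ i, p.hyper i u.x (u.α i) (u.y i) (u.s i)‖ ^ 2 ≤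
      (1 / (m : ℝ)) * ∑ i, biasBound p c i u := by
  rw [h.gradient_F hc, ← smul_sub, ← Finset.sum_sub_distrib]
  refine (norm_avg_sq_le _).trans (mul_le_mul_of_nonneg_left (Finset.sum_le_sum fun i _ => ?_)
    (by positivity))
  rw [norm_sub_rev]
  have e1 := h.hyper_sub_le hc i u.x u.x (hu.α_mem i) (h.αSol_mem hc i u.x) (u.y i)
    (p.ySol i u.x) (p.hess i u.x) (hu.coercive i)
  have e2 := norm_solve_sub_sq_le hc h hu i
  rw [Problem.fySol] at e2
  rw [sub_self, norm_zero, zero_add] at e1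
  set q := ‖(u.s i).inverse (p.fy i u.x (p.αSol i u.x) (p.ySol i u.x)) -
    (p.hess i u.x).inverse (p.fy i u.x (p.αSol i u.x) (p.ySol i u.x))‖
  set A := ‖u.α i - p.αSol i u.x‖
  set Y := ‖u.y i - p.ySol i u.x‖
  refine (pow_le_pow_left₀ (norm_nonneg _) e1 2).trans ?_
  have e3 : (c.Lhyp * (A + Y) + c.Cgxy * q) ^ 2 ≤
      3 * c.Lhyp ^ 2 * A ^ 2 + 3 * c.Lhyp ^ 2 * Y ^ 2 + 3 * c.Cgxy ^ 2 * q ^ 2 := by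
    nlinarith [sq_nonneg (c.Lhyp * A - c.Lhyp * Y), sq_nonneg (c.Lhyp * A - c.Cgxy * q),
      sq_nonneg (c.Lhyp * Y - c.Cgxy * q)]
  have e4 := mul_le_mul_of_nonneg_left e2 (show 0 ≤ 3 * c.Cgxy ^ 2 by positivity)
  rw [biasBound, Consts.Kin, Consts.Kh]
  linarith

end Errors

section Continuity

variable {m dx dα dy : ℕ} {p : Problem m dx dα dy} {c : Consts}

theorem continuous_of_norm_le {V W : Type*} [SeminormedAddCommGroup V] [SeminormedAddCommGroup W]
    {φ : V → W} {L : ℝ} (hL : 0 ≤ L) (h : ∀ x y, ‖φ x - φ y‖ ≤ L * ‖x - y‖) : Continuous φ :=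
  (LipschitzWith.of_dist_le_mul (K := ⟨L, hL⟩) fun x y => by
    rw [dist_eq_norm, dist_eq_norm]; exact h x y).continuous

namespace Problem.Regular

theorem continuous_ySol (h : p.Regular c) (hc : c.Pos) (i : Fin m) : Continuous (p.ySol i) :=
  continuous_of_norm_le hc.Cy_pos.le (h.ySol_lip hc i)

theorem continuous_αSol (h : p.Regular c) (hc : c.Pos) (i : Fin m) : Continuous (p.αSol i) :=
  continuous_of_norm_le (by have := hc.Cy_pos; have := hc.Cα_pos; positivity) (h.αSol_lip hc i)

theorem continuous_hess (h : p.Regular c) (hc : c.Pos) (i : Fin m) : Continuous (p.hess i) :=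
  continuous_of_norm_le (by have := hc.Cy_pos; have := hc.Lgyy; positivity) (h.hess_lip hc i)

theorem continuous_dir (h : p.Regular c) (hc : c.Pos) (i : Fin m) : Continuous (p.dir i) :=
  continuous_of_norm_le hc.Ldir_pos.le (h.dir_lip hc i)

theorem continuous_gradient_F (h : p.Regular c) (hc : c.Pos) (hm : 1 ≤ m) :
    Continuous (gradient p.F) :=
  continuous_of_norm_le hc.Lgrad_pos.le (h.gradient_F_lip hc hm)

theorem measurable_errα (h : p.Regular c) (hc : c.Pos) (i : Fin m) :
    Measurable fun u : State m dx dα dy => ‖u.α i - p.αSol i u.x‖ ^ 2 :=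
  ((State.measurable_α i).sub ((h.continuous_αSol hc i).measurable.comp
    State.measurable_x)).norm.pow_const 2

theorem measurable_erry (h : p.Regular c) (hc : c.Pos) (i : Fin m) :
    Measurable fun u : State m dx dα dy => ‖u.y i - p.ySol i u.x‖ ^ 2 :=
  ((State.measurable_y i).sub ((h.continuous_ySol hc i).measurable.comp
    State.measurable_x)).norm.pow_const 2

theorem measurable_hessErr (h : p.Regular c) (hc : c.Pos) (i : Fin m) :
    Measurable fun u : State m dx dα dy => hessErr p c i u := by
  have h1 := State.measurable_s (m := m) (dx := dx) (dα := dα) (dy := dy) i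
  have h2 : Measurable fun u : State m dx dα dy => p.hess i u.x :=
    (h.continuous_hess hc i).measurable.comp State.measurable_x
  have h3 : Measurable fun u : State m dx dα dy => p.dir i u.x :=
    (h.continuous_dir hc i).measurable.comp State.measurable_x
  exact (((continuous_cut _).measurable.comp h1.norm).mul
    ((measurable_apply_clm (h1.sub h2) h3).norm.pow_const 2)).add
    ((((c.continuous_excess dy).measurable.comp h1).pow_const 2).const_mul _)

end Problem.Regular

end Continuity

section Block

variable {m dx dα dy b n : ℕ} {Ξ Z : Type*} [MeasurableSpace Ξ] [MeasurableSpace Z]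
variable {p : Problem m dx dα dy} {c : Consts} {o : Oracles m dx dα dy b Ξ Z}

theorem step_x (A : Set (E dα)) (o : Oracles m dx dα dy b Ξ Z) (k : Steps)
    (u : State m dx dα dy) (w : Draw m b Ξ Z) :
    (step A o k u w).x = u.x - k.η₀ • (step A o k u w).z := rfl

theorem norm_sub_step_x (A : Set (E dα)) (o : Oracles m dx dα dy b Ξ Z) {k : Steps}
    (h0 : 0 ≤ k.η₀) (u : State m dx dα dy) (w : Draw m b Ξ Z) :
    ‖u.x - (step A o k u w).x‖ = k.η₀ * ‖(step A o k u w).z‖ := by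
  rw [step_x, sub_sub_cancel, norm_smul, Real.norm_of_nonneg h0]

theorem errα_step_le (hc : c.Pos) (h : p.Regular c) {k : Steps} (h0 : 0 ≤ k.η₀) {a : ℝ}
    (ha0 : 0 < a) (ha1 : a ≤ 1) (u : State m dx dα dy) (i : Fin m) (w : Draw m b Ξ Z) :
    ‖(step p.A o k u w).α i - p.αSol i (step p.A o k u w).x‖ ^ 2 ≤
      (1 + a) * ‖(step p.A o k u w).α i - p.αSol i u.x‖ ^ 2 +
        2 / a * ((c.Cα * (1 + c.Cy)) ^ 2 * (k.η₀ ^ 2 * ‖(step p.A o k u w).z‖ ^ 2)) := by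
  have h1 := h.αSol_lip hc i u.x (step p.A o k u w).x
  rw [norm_sub_step_x _ _ h0] at h1
  refine (norm_sub_sq_le_young ha0 ha1 _ _ _ h1).trans (le_of_eq (by ring))

theorem erry_step_le (hc : c.Pos) (h : p.Regular c) {k : Steps} (h0 : 0 ≤ k.η₀) {a : ℝ}
    (ha0 : 0 < a) (ha1 : a ≤ 1) (u : State m dx dα dy) (i : Fin m) (w : Draw m b Ξ Z) :
    ‖(step p.A o k u w).y i - p.ySol i (step p.A o k u w).x‖ ^ 2 ≤
      (1 + a) * ‖(step p.A o k u w).y i - p.ySol i u.x‖ ^ 2 +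
        2 / a * (c.Cy ^ 2 * (k.η₀ ^ 2 * ‖(step p.A o k u w).z‖ ^ 2)) := by
  have h1 := h.ySol_lip hc i u.x (step p.A o k u w).x
  rw [norm_sub_step_x _ _ h0] at h1
  refine (norm_sub_sq_le_young ha0 ha1 _ _ _ h1).trans (le_of_eq (by ring))

/-- Splits the new error into changes of `s`, of the cutoff and of `x`. Where the new cutoff is
positive, `‖s'‖ < 3K`, so both the residual and its change with `x` are uniformly bounded; where it
vanishes there is nothing to bound. -/
theorem hessErr_step_le (hc : c.Pos) (h : p.Regular c) {k : Steps} (h0 : 0 ≤ k.η₀) {a : ℝ}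
    (ha0 : 0 < a) (ha1 : a ≤ 1) (u : State m dx dα dy) (i : Fin m) (w : Draw m b Ξ Z) :
    hessErr p c i (step p.A o k u w) ≤
      (1 + a) * (cut c.Khess ‖u.s i‖ *
          ‖((step p.A o k u w).s i - p.hess i u.x) (p.dir i u.x)‖ ^ 2 +
        c.Bcut ^ 2 * max (cut c.Khess ‖(step p.A o k u w).s i‖ - cut c.Khess ‖u.s i‖) 0) +
        c.lam * c.excess ((step p.A o k u w).s i) ^ 2 +
        2 / a * (c.Lcut ^ 2 * (k.η₀ ^ 2 * ‖(step p.A o k u w).z‖ ^ 2)) := by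
  set u' := step p.A o k u w with hu'
  set g := cut c.Khess ‖u.s i‖
  set g' := cut c.Khess ‖u'.s i‖ with hg'
  have hK := hc.Khess_pos
  have hB := hc.Bdir_pos
  have hL := hc.Lcut_pos
  have hg0 : 0 ≤ g := cut_nonneg _ _
  have hg0' : 0 ≤ g' := cut_nonneg _ _
  have hg1' : g' ≤ 1 := cut_le_one _ _
  set P := ‖(u'.s i - p.hess i u.x) (p.dir i u.x)‖ with hP
  set D := k.η₀ ^ 2 * ‖u'.z‖ ^ 2 with hD
  have hD0 : 0 ≤ D := by positivity
  suffices hmain : g' * ‖(u'.s i - p.hess i u'.x) (p.dir i u'.x)‖ ^ 2 ≤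
      (1 + a) * (g * P ^ 2 + c.Bcut ^ 2 * max (g' - g) 0) + 2 / a * (c.Lcut ^ 2 * D) by
    rw [hessErr]; linarith
  by_cases hbig : 3 * c.Khess ≤ ‖u'.s i‖
  · rw [hg', cut_eq_zero hK hbig, zero_mul]
    positivity
  push Not at hbig
  have hLg : c.Lg ≤ c.Khess := by rw [Consts.Khess]; linarith [hc.σ]
  have hn : ∀ x, ‖u'.s i - p.hess i x‖ ≤ 4 * c.Khess := fun x =>
    (norm_sub_le _ _).trans (by linarith [h.norm_hess_le hc i x])
  have hPB : P ≤ c.Bcut :=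
    (ContinuousLinearMap.le_opNorm _ _).trans (mul_le_mul (hn _) (h.norm_dir_le hc i u.x)
      (norm_nonneg _) (by positivity))
  -- Both the direction and the exact Hessian move with `x`; the first change is multiplied by `‖s'
  -- - S‖ ≤ 3K + L_g ≤ 4K`.
  have hdiff : ‖(u'.s i - p.hess i u.x) (p.dir i u.x) - (u'.s i - p.hess i u'.x) (p.dir i u'.x)‖ ≤
      c.Lcut * (k.η₀ * ‖u'.z‖) := by
    have e1 : (u'.s i - p.hess i u.x) (p.dir i u.x) - (u'.s i - p.hess i u'.x) (p.dir i u'.x) =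
        (u'.s i - p.hess i u'.x) (p.dir i u.x - p.dir i u'.x) -
          (p.hess i u.x - p.hess i u'.x) (p.dir i u.x) := by
      simp only [sub_apply, map_sub]; abel
    have e2 := h.dir_lip hc i u.x u'.x
    have e3 := h.hess_lip hc i u.x u'.x
    rw [hu', norm_sub_step_x _ _ h0, ← hu'] at e2 e3
    have e4 := ((u'.s i - p.hess i u'.x).le_opNorm (p.dir i u.x - p.dir i u'.x)).trans
      (mul_le_mul (hn _) e2 (norm_nonneg _) (by positivity))
    have e5 := ((p.hess i u.x - p.hess i u'.x).le_opNorm (p.dir i u.x)).trans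
      (mul_le_mul e3 (h.norm_dir_le hc i u.x) (norm_nonneg _)
        ((norm_nonneg _).trans e3))
    rw [e1]
    refine (norm_sub_le _ _).trans ((add_le_add e4 e5).trans (le_of_eq ?_))
    rw [Consts.Lcut, Consts.Bdir]
    ring
  have hy : ‖(u'.s i - p.hess i u'.x) (p.dir i u'.x)‖ ^ 2 ≤
      (1 + a) * P ^ 2 + 2 / a * (c.Lcut ^ 2 * D) := by
    have := norm_sub_sq_le_young ha0 ha1 0 ((u'.s i - p.hess i u.x) (p.dir i u.x))
      ((u'.s i - p.hess i u'.x) (p.dir i u'.x)) hdiff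
    rw [zero_sub, zero_sub, norm_neg, norm_neg] at this
    refine this.trans (le_of_eq ?_)
    rw [hD]; ring
  have f1 := mul_le_mul_of_nonneg_left hy hg0'
  have f2 : g' * (2 / a * (c.Lcut ^ 2 * D)) ≤ 2 / a * (c.Lcut ^ 2 * D) :=
    mul_le_of_le_one_left (by positivity) hg1'
  -- The new cutoff is replaced by the old one plus its positive increase, so that the residual
  -- keeps a weight that is deterministic given the past.
  have f3 : g' * P ^ 2 ≤ g * P ^ 2 + c.Bcut ^ 2 * max (g' - g) 0 := by
    have f4 : g' ≤ g + max (g' - g) 0 := by linarith [le_max_left (g' - g) 0]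
    have f5 := mul_le_mul_of_nonneg_right f4 (sq_nonneg P)
    have f6 := mul_le_mul_of_nonneg_right (pow_le_pow_left₀ (norm_nonneg _) hPB 2)
      (le_max_right (g' - g) 0)
    linarith
  have f7 := mul_le_mul_of_nonneg_left f3 (show 0 ≤ 1 + a by linarith)
  linarith

/-- One step of the recursion for the Hessian error, with the drift of `x` split off. -/
theorem ebound_hess (hc : c.Pos) (h : p.Regular c) (hv : o.Valid p c) (hn : n ≤ m) (hb : 1 ≤ b)
    {k : Steps} (h0 : 0 ≤ k.β₁) (h1 : k.β₁ ≤ 1) (u : State m dx dα dy) (i : Fin m) {a : ℝ}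
    (ha : a = (n : ℝ) / m * k.β₁ / 2) (ha1 : a ≤ 1) :
    EBound (o.drawLaw n) (fun w => (1 + a) * (cut c.Khess ‖u.s i‖ *
          ‖((step p.A o k u w).s i - p.hess i u.x) (p.dir i u.x)‖ ^ 2 +
        c.Bcut ^ 2 * max (cut c.Khess ‖(step p.A o k u w).s i‖ - cut c.Khess ‖u.s i‖) 0) +
        c.lam * c.excess ((step p.A o k u w).s i) ^ 2)
      ((1 - a) * hessErr p c i u + 4 * a * c.κy * ‖u.y i - p.ySol i u.x‖ ^ 2 +
        2 * a * k.β₁ * c.κs * (c.σ ^ 2 / b)) := by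
  have ha0 : 0 ≤ a := by rw [ha]; positivity
  have hK := hc.Khess_pos
  set g := cut c.Khess ‖u.s i‖
  have hg0 : 0 ≤ g := cut_nonneg _ _
  have hg1 : g ≤ 1 := cut_le_one _ _
  have e1 := (((ebound_s_dir hc h hv hn h0 h1 u i).const_mul hg0).add
    ((ebound_cut hc h hv hn hb h0 u i).const_mul (sq_nonneg c.Bcut))).const_mul
      (show 0 ≤ 1 + a by linarith)
  have e2 := (ebound_excess hc h hv hn hb h0 h1 u i).const_mul hc.lam_pos.le
  refine (e1.add e2).mono ?_
  have er : (n : ℝ) / m * k.β₁ = 2 * a := by rw [ha]; ring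
  set r := (n : ℝ) / m
  set P := ‖(u.s i - p.hess i u.x) (p.dir i u.x)‖ ^ 2 with hP
  have hP0 : 0 ≤ P := sq_nonneg _
  set Y := ‖u.y i - p.ySol i u.x‖ ^ 2
  have hY0 : 0 ≤ Y := sq_nonneg _
  set W := c.excess (u.s i) ^ 2
  have hW0 : 0 ≤ W := sq_nonneg _
  set s := c.σ ^ 2 / (b : ℝ)
  have hs0 : 0 ≤ s := by positivity
  rw [hessErr]
  have f1 : r * (k.β₁ * ((c.Lgyy * (c.μg⁻¹ * c.Cf)) ^ 2 * Y)) = 2 * a * (c.κy * Y) := by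
    rw [← er, Consts.κy, Consts.Bdir]; ring
  have f2 : r * (k.β₁ ^ 2 * ((c.μg⁻¹ * c.Cf) ^ 2 * s)) = 2 * a * (k.β₁ * c.Bdir ^ 2 * s) := by
    rw [← er, Consts.Bdir]; ring
  -- `16 · 3 · 2 = 96`: the square of `4K` in `Bcut`, the factor of the cutoff bound, and `rβ₁ =
  -- 2a`.
  have f3 : c.Bcut ^ 2 * (r * (3 * k.β₁ / c.Khess ^ 2 * W)) = 96 * a * (c.Bdir ^ 2 * W) := by
    rw [show 96 * a * (c.Bdir ^ 2 * W) = 48 * (2 * a) * (c.Bdir ^ 2 * W) by ring, ← er,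
      Consts.Bcut]
    field_simp
    ring
  have f4 : r * (k.β₁ ^ 2 * s) = 2 * a * (k.β₁ * s) := by rw [← er]; ring
  rw [f1, f2, f3, f4, er, Consts.lam, Consts.κs]
  have g1 : (1 + a) * (g * ((1 - 2 * a) * P)) ≤ (1 - a) * (g * P) := by
    nlinarith [mul_nonneg (sq_nonneg a) (mul_nonneg hg0 hP0)]
  have g2 : (1 + a) * (g * (2 * a * (c.κy * Y))) ≤ 4 * a * c.κy * Y := by
    have : (1 + a) * g ≤ 2 := by nlinarith
    have := mul_le_mul_of_nonneg_right this
      (show 0 ≤ 2 * a * (c.κy * Y) by have := hc.κy_pos; positivity)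
    linarith
  have g3 : (1 + a) * (g * (2 * a * (k.β₁ * c.Bdir ^ 2 * s))) ≤
      4 * a * (k.β₁ * c.Bdir ^ 2 * s) := by
    have : (1 + a) * g ≤ 2 := by nlinarith
    have := mul_le_mul_of_nonneg_right this
      (show 0 ≤ 2 * a * (k.β₁ * c.Bdir ^ 2 * s) by positivity)
    linarith
  -- The cost is at most `a · lam · W`, by the choice `lam = 192 Bdir²`: half of the decay `2a` of
  -- the excess term pays for the growth of the cutoff, the other half is kept.
  have g4 : (1 + a) * (96 * a * (c.Bdir ^ 2 * W)) ≤ 192 * a * (c.Bdir ^ 2 * W) := by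
    have := mul_le_mul_of_nonneg_right ha1 (show 0 ≤ 96 * a * (c.Bdir ^ 2 * W) by positivity)
    linarith
  linarith

end Block

end MinMaxBilevel

/-! ### The Lyapunov function and its decrease in one iteration. -/

namespace MinMaxBilevel

open Filter Topology Set

/-- The contraction rate of the dual errors. -/
noncomputable def Steps.rateα (k : Steps) (c : Consts) (m n : ℕ) : ℝ :=
  (n : ℝ) / m * (k.η₁ * c.μf / 4)

/-- The contraction rate of the lower-level errors. -/
noncomputable def Steps.ratey (k : Steps) (c : Consts) (m n : ℕ) : ℝ :=
  (n : ℝ) / m * (k.η₂ * c.μg / 2)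

/-- The contraction rate of the Hessian errors. -/
noncomputable def Steps.rates (k : Steps) (m n : ℕ) : ℝ := (n : ℝ) / m * k.β₁ / 2

/-- The conditions on the step sizes that the analysis uses. -/
structure Steps.Good (k : Steps) (c : Consts) (m n : ℕ) : Prop where
  η₀_pos : 0 < k.η₀
  η₁_pos : 0 < k.η₁
  η₂_pos : 0 < k.η₂
  β₀_pos : 0 < k.β₀
  β₁_pos : 0 < k.β₁
  β₀_le : k.β₀ ≤ 1
  β₁_le : k.β₁ ≤ 1
  η₁_le : k.η₁ * c.Lf ^ 2 ≤ c.μf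
  η₂_le : k.η₂ * c.Lg ^ 2 ≤ c.μg
  rateα_le : k.rateα c m n ≤ 1
  ratey_le : k.ratey c m n ≤ 1
  descent : 4 * c.Lgrad * k.η₀ ≤ 1
  momentum : 4 * c.Lgrad ^ 2 * k.η₀ ^ 2 / k.β₀ ^ 2 ≤ 1 / 20
  drift : k.η₀ ^ 2 * (2 * c.wα / k.rateα c m n ^ 2 * (c.Cα * (1 + c.Cy)) ^ 2 +
    2 * c.wy / k.ratey c m n ^ 2 * c.Cy ^ 2 + 2 * c.ws / k.rates m n ^ 2 * c.Lcut ^ 2) ≤ 9 / 20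

/-- The noise that one iteration adds to the Lyapunov function. -/
noncomputable def Steps.noise (k : Steps) (c : Consts) (b : ℕ) : ℝ :=
  (8 * c.wα * k.η₁ / c.μf + 4 * c.wy * k.η₂ / c.μg + 2 * c.ws * k.β₁ * c.κs) * (c.σ ^ 2 / b)

section Defs

variable {m dx dα dy : ℕ}

/-- The weighted inner errors of block `i`. -/
noncomputable def innerErr (p : Problem m dx dα dy) (c : Consts) (k : Steps) (n : ℕ) (i : Fin m)
    (u : State m dx dα dy) : ℝ :=
  c.wα / k.rateα c m n * ‖u.α i - p.αSol i u.x‖ ^ 2 +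
    c.wy / k.ratey c m n * ‖u.y i - p.ySol i u.x‖ ^ 2 + c.ws / k.rates m n * hessErr p c i u

/-- The part of the Lyapunov function that does not involve the momentum; `B` is a lower bound of
the objective. -/
noncomputable def potential (p : Problem m dx dα dy) (c : Consts) (k : Steps) (n : ℕ) (B : ℝ)
    (u : State m dx dα dy) : ℝ :=
  2 / k.η₀ * (p.F u.x - B) + (1 / (m : ℝ)) * ∑ i, innerErr p c k n i u

/-- The squared gradient at the point from which the state was reached. -/
noncomputable def prevGrad (p : Problem m dx dα dy) (k : Steps) (u : State m dx dα dy) : ℝ :=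
  ‖gradient p.F (u.x + k.η₀ • u.z)‖ ^ 2

/-- The squared error of the momentum as an estimate of the gradient at the point from which the
state was reached. -/
noncomputable def gradErr (p : Problem m dx dα dy) (k : Steps) (u : State m dx dα dy) : ℝ :=
  ‖gradient p.F (u.x + k.η₀ • u.z) - u.z‖ ^ 2

/-- The Lyapunov function. -/
noncomputable def lyapunov (p : Problem m dx dα dy) (c : Consts) (k : Steps) (n : ℕ) (B : ℝ)
    (u : State m dx dα dy) : ℝ :=
  potential p c k n B u + (2 / k.β₀ - 2) * gradErr p k u + 1 / 20 * ‖u.z‖ ^ 2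

end Defs

namespace Steps.Good

variable {k : Steps} {c : Consts} {m n : ℕ}

theorem rateα_pos (hk : k.Good c m n) (hc : c.Pos) (hn1 : 1 ≤ n) (hn : n ≤ m) :
    0 < k.rateα c m n := by
  have := hk.η₁_pos; have := hc.μf
  have : (0 : ℝ) < n := by exact_mod_cast hn1
  have : (0 : ℝ) < m := by exact_mod_cast hn1.trans hn
  unfold Steps.rateα; positivity

theorem ratey_pos (hk : k.Good c m n) (hc : c.Pos) (hn1 : 1 ≤ n) (hn : n ≤ m) :
    0 < k.ratey c m n := by
  have := hk.η₂_pos; have := hc.μg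
  have : (0 : ℝ) < n := by exact_mod_cast hn1
  have : (0 : ℝ) < m := by exact_mod_cast hn1.trans hn
  unfold Steps.ratey; positivity

theorem rates_pos (hk : k.Good c m n) (hn1 : 1 ≤ n) (hn : n ≤ m) :
    0 < k.rates m n := by
  have := hk.β₁_pos
  have : (0 : ℝ) < n := by exact_mod_cast hn1
  have : (0 : ℝ) < m := by exact_mod_cast hn1.trans hn
  unfold Steps.rates; positivity

theorem rates_le (hk : k.Good c m n) (hn1 : 1 ≤ n) (hn : n ≤ m) : k.rates m n ≤ 1 := by
  have hm : (0 : ℝ) < m := by exact_mod_cast hn1.trans hn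
  have e1 : (n : ℝ) / m ≤ 1 := by rw [div_le_one hm]; exact_mod_cast hn
  have e2 : (n : ℝ) / m * k.β₁ ≤ 1 := mul_le_one₀ e1 hk.β₁_pos.le hk.β₁_le
  rw [Steps.rates]
  linarith

end Steps.Good

section Measurable

variable {m dx dα dy : ℕ} {p : Problem m dx dα dy} {c : Consts}

theorem innerErr_nonneg (hc : c.Pos) {k : Steps} {n : ℕ} (hk : k.Good c m n) (hn1 : 1 ≤ n)
    (hn : n ≤ m) (i : Fin m) (u : State m dx dα dy) : 0 ≤ innerErr p c k n i u := by
  have := hk.rateα_pos hc hn1 hn; have := hk.ratey_pos hc hn1 hn; have := hk.rates_pos hn1 hn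
  have := hc.wα_pos; have := hc.wy_pos; have := hc.ws_pos
  have := hessErr_nonneg (p := p) hc i u
  unfold innerErr
  positivity

theorem lyapunov_nonneg (hc : c.Pos) {k : Steps} {n : ℕ} (hk : k.Good c m n) (hn1 : 1 ≤ n)
    (hn : n ≤ m) {B : ℝ} (hB : ∀ x, B ≤ p.F x) (u : State m dx dα dy) :
    0 ≤ lyapunov p c k n B u := by
  have h1 := hk.η₀_pos
  have h2 : 0 ≤ p.F u.x - B := sub_nonneg.mpr (hB _)
  have h3 : 0 ≤ ∑ i, innerErr p c k n i u :=
    Finset.sum_nonneg fun i _ => innerErr_nonneg hc hk hn1 hn i u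
  have h4 : 0 ≤ 2 / k.β₀ - 2 := by
    rw [sub_nonneg, le_div_iff₀ hk.β₀_pos]; linarith [hk.β₀_le]
  unfold lyapunov potential gradErr
  positivity

theorem measurable_gradient_prev (h : p.Regular c) (hc : c.Pos) (hm : 1 ≤ m) (k : Steps) :
    Measurable fun u : State m dx dα dy => gradient p.F (u.x + k.η₀ • u.z) :=
  (h.continuous_gradient_F hc hm).measurable.comp
    (State.measurable_x.add (State.measurable_z.const_smul k.η₀))

theorem measurable_prevGrad (h : p.Regular c) (hc : c.Pos) (hm : 1 ≤ m) (k : Steps) :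
    Measurable (prevGrad p k : State m dx dα dy → ℝ) :=
  (measurable_gradient_prev h hc hm k).norm.pow_const 2

theorem measurable_gradErr (h : p.Regular c) (hc : c.Pos) (hm : 1 ≤ m) (k : Steps) :
    Measurable (gradErr p k : State m dx dα dy → ℝ) :=
  ((measurable_gradient_prev h hc hm k).sub State.measurable_z).norm.pow_const 2

theorem measurable_lyapunov (h : p.Regular c) (hc : c.Pos) (hm : 1 ≤ m) (k : Steps) (n : ℕ)
    (B : ℝ) : Measurable (lyapunov p c k n B : State m dx dα dy → ℝ) := by
  refine Measurable.add (Measurable.add (Measurable.add ?_ ?_) ?_) ?_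
  · exact (((h.differentiable_F hc).continuous.measurable.comp
      State.measurable_x).sub_const B).const_mul _
  · exact (Finset.measurable_fun_sum _ fun i _ => (((h.measurable_errα hc i).const_mul _).add
      ((h.measurable_erry hc i).const_mul _)).add
        ((h.measurable_hessErr hc i).const_mul _)).const_mul _
  · exact (measurable_gradErr h hc hm k).const_mul _
  · exact (State.measurable_z.norm.pow_const 2).const_mul _

end Measurable

section Step

variable {m dx dα dy b n : ℕ} {Ξ Z : Type*} [MeasurableSpace Ξ] [MeasurableSpace Z]
variable {p : Problem m dx dα dy} {c : Consts} {o : Oracles m dx dα dy b Ξ Z}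
variable {u : State m dx dα dy} {k : Steps}

/-- The previous point can be recovered from the state, so the momentum error and the gradient at
the previous point are functions of the current state alone. -/
theorem prev_step (A : Set (E dα)) (o : Oracles m dx dα dy b Ξ Z) (k : Steps)
    (u : State m dx dα dy) (w : Draw m b Ξ Z) :
    (step A o k u w).x + k.η₀ • (step A o k u w).z = u.x := by
  rw [step_x, sub_add_cancel]

/-- `rateα` is half of the contraction; the other half is given up to the Young factor, by `(1 +
a)(1 - 2a) ≤ 1 - a`. Division of the weight by the rate makes the decrease exactly `wα` times the
error, whatever the step size. -/
theorem ebound_weighted_α (hc : c.Pos) (h : p.Regular c) (hv : o.Valid p c) (hn1 : 1 ≤ n)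
    (hn : n ≤ m) (hk : k.Good c m n) (hu : u.Adm p.A c) (i : Fin m) :
    EBound (o.drawLaw n) (fun w => c.wα / k.rateα c m n * ((1 + k.rateα c m n) *
        ‖(step p.A o k u w).α i - p.αSol i u.x‖ ^ 2))
      ((c.wα / k.rateα c m n - c.wα) * ‖u.α i - p.αSol i u.x‖ ^ 2 +
        8 * c.κα / c.μf * c.wα * ‖u.y i - p.ySol i u.x‖ ^ 2 +
        8 * c.wα * k.η₁ / c.μf * (c.σ ^ 2 / b)) := by
  have ha := hk.rateα_pos hc hn1 hn
  have ha1 := hk.rateα_le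
  have hw := hc.wα_pos
  have hμ := hc.μf
  have e1 := ((ebound_α hc h hv hn hk.η₁_pos.le hk.η₁_le hu i).const_mul
    (show 0 ≤ 1 + k.rateα c m n by linarith)).const_mul
      (show 0 ≤ c.wα / k.rateα c m n by positivity)
  refine e1.mono ?_
  set a := k.rateα c m n with had
  have r1 : (n : ℝ) / m * (k.η₁ * c.μf / 2) = 2 * a := by rw [had, Steps.rateα]; ring
  have r2 : (n : ℝ) / m * k.η₁ = 4 * a / c.μf := by rw [had, Steps.rateα]; field_simp
  set D := ‖u.α i - p.αSol i u.x‖ ^ 2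
  have hD : 0 ≤ D := sq_nonneg _
  set Y := ‖u.y i - p.ySol i u.x‖ ^ 2
  have hY : 0 ≤ Y := sq_nonneg _
  set s := c.σ ^ 2 / (b : ℝ)
  have hs : 0 ≤ s := by positivity
  have r3 : (n : ℝ) / m * (k.η₁ * c.κα) * Y = 4 * a / c.μf * (c.κα * Y) := by rw [← r2]; ring
  have r4 : (n : ℝ) / m * (k.η₁ ^ 2 * s) = 4 * a / c.μf * (k.η₁ * s) := by rw [← r2]; ring
  rw [r1, r3, r4]
  have e2 : (1 + a) * ((1 - 2 * a) * D) ≤ (1 - a) * D := by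
    nlinarith [mul_nonneg (sq_nonneg a) hD]
  have e3 : (1 + a) * (4 * a / c.μf * (c.κα * Y)) ≤ 2 * (4 * a / c.μf * (c.κα * Y)) :=
    mul_le_mul_of_nonneg_right (by linarith) (by have := hc.κα_pos; positivity)
  have e4 : (1 + a) * (4 * a / c.μf * (k.η₁ * s)) ≤ 2 * (4 * a / c.μf * (k.η₁ * s)) :=
    mul_le_mul_of_nonneg_right (by linarith) (by have := hk.η₁_pos; positivity)
  have e5 : (1 + a) * ((1 - 2 * a) * D + 4 * a / c.μf * (c.κα * Y) + 4 * a / c.μf * (k.η₁ * s)) ≤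
      (1 - a) * D + 2 * (4 * a / c.μf * (c.κα * Y)) + 2 * (4 * a / c.μf * (k.η₁ * s)) := by
    linarith
  refine (mul_le_mul_of_nonneg_left e5 (show 0 ≤ c.wα / a by positivity)).trans (le_of_eq ?_)
  field_simp
  ring

theorem ebound_weighted_y (hc : c.Pos) (h : p.Regular c) (hv : o.Valid p c) (hn1 : 1 ≤ n)
    (hn : n ≤ m) (hk : k.Good c m n) (u : State m dx dα dy) (i : Fin m) :
    EBound (o.drawLaw n) (fun w => c.wy / k.ratey c m n * ((1 + k.ratey c m n) *
        ‖(step p.A o k u w).y i - p.ySol i u.x‖ ^ 2))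
      ((c.wy / k.ratey c m n - c.wy) * ‖u.y i - p.ySol i u.x‖ ^ 2 +
        4 * c.wy * k.η₂ / c.μg * (c.σ ^ 2 / b)) := by
  have ha := hk.ratey_pos hc hn1 hn
  have ha1 := hk.ratey_le
  have hw := hc.wy_pos
  have hμ := hc.μg
  have e1 := ((ebound_y hc h hv hn hk.η₂_pos.le hk.η₂_le u i).const_mul
    (show 0 ≤ 1 + k.ratey c m n by linarith)).const_mul
      (show 0 ≤ c.wy / k.ratey c m n by positivity)
  refine e1.mono ?_
  set a := k.ratey c m n with had
  have r1 : (n : ℝ) / m * (k.η₂ * c.μg) = 2 * a := by rw [had, Steps.ratey]; ring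
  have r2 : (n : ℝ) / m * k.η₂ = 2 * a / c.μg := by rw [had, Steps.ratey]; field_simp
  set Y := ‖u.y i - p.ySol i u.x‖ ^ 2
  have hY : 0 ≤ Y := sq_nonneg _
  set s := c.σ ^ 2 / (b : ℝ)
  have hs : 0 ≤ s := by positivity
  have r4 : (n : ℝ) / m * (k.η₂ ^ 2 * s) = 2 * a / c.μg * (k.η₂ * s) := by rw [← r2]; ring
  rw [r1, r4]
  have e2 : (1 + a) * ((1 - 2 * a) * Y) ≤ (1 - a) * Y := by
    nlinarith [mul_nonneg (sq_nonneg a) hY]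
  have e4 : (1 + a) * (2 * a / c.μg * (k.η₂ * s)) ≤ 2 * (2 * a / c.μg * (k.η₂ * s)) :=
    mul_le_mul_of_nonneg_right (by linarith) (by have := hk.η₂_pos; positivity)
  have e5 : (1 + a) * ((1 - 2 * a) * Y + 2 * a / c.μg * (k.η₂ * s)) ≤
      (1 - a) * Y + 2 * (2 * a / c.μg * (k.η₂ * s)) := by linarith
  refine (mul_le_mul_of_nonneg_left e5 (show 0 ≤ c.wy / a by positivity)).trans (le_of_eq ?_)
  field_simp
  ring

/-- The mean of the weighted inner errors after one step, without the drift of `x`. -/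
theorem ebound_weighted (hc : c.Pos) (h : p.Regular c) (hv : o.Valid p c) (hn1 : 1 ≤ n)
    (hn : n ≤ m) (hb : 1 ≤ b) (hk : k.Good c m n) (hu : u.Adm p.A c) (i : Fin m) :
    EBound (o.drawLaw n) (fun w =>
      c.wα / k.rateα c m n * ((1 + k.rateα c m n) *
        ‖(step p.A o k u w).α i - p.αSol i u.x‖ ^ 2) +
      c.wy / k.ratey c m n * ((1 + k.ratey c m n) *
        ‖(step p.A o k u w).y i - p.ySol i u.x‖ ^ 2) +
      c.ws / k.rates m n * ((1 + k.rates m n) * (cut c.Khess ‖u.s i‖ *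
          ‖((step p.A o k u w).s i - p.hess i u.x) (p.dir i u.x)‖ ^ 2 +
        c.Bcut ^ 2 * max (cut c.Khess ‖(step p.A o k u w).s i‖ - cut c.Khess ‖u.s i‖) 0) +
        c.lam * c.excess ((step p.A o k u w).s i) ^ 2))
      (innerErr p c k n i u - 4 * biasBound p c i u + k.noise c b) := by
  have ha := hk.rates_pos (c := c) hn1 hn
  have hw := hc.ws_pos
  have e1 := (ebound_hess hc h hv hn hb hk.β₁_pos.le hk.β₁_le u i (a := k.rates m n) rfl
    (hk.rates_le hn1 hn)).const_mul (show 0 ≤ c.ws / k.rates m n by positivity)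
  refine (((ebound_weighted_α hc h hv hn1 hn hk hu i).add
    (ebound_weighted_y hc h hv hn1 hn hk u i)).add e1).mono (le_of_eq ?_)
  rw [innerErr, biasBound, Steps.noise]
  have e2 : c.ws / k.rates m n * ((1 - k.rates m n) * hessErr p c i u +
      4 * k.rates m n * c.κy * ‖u.y i - p.ySol i u.x‖ ^ 2 +
      2 * k.rates m n * k.β₁ * c.κs * (c.σ ^ 2 / b)) =
      (c.ws / k.rates m n - c.ws) * hessErr p c i u +
        4 * c.κy * c.ws * ‖u.y i - p.ySol i u.x‖ ^ 2 +
        2 * c.ws * k.β₁ * c.κs * (c.σ ^ 2 / b) := by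
    field_simp
  -- The weights were defined so that the decays add up to four times the bias bound; the surplus in
  -- `wy` pays for the error in `y` that feeds the other two recursions.
  have e3 : 4 * (c.Kin * ‖u.α i - p.αSol i u.x‖ ^ 2) = c.wα * ‖u.α i - p.αSol i u.x‖ ^ 2 := by
    rw [Consts.wα]; ring
  have e4 : 4 * (c.Kh * hessErr p c i u) = c.ws * hessErr p c i u := by rw [Consts.ws]; ring
  have e5 : 4 * (c.Kin * ‖u.y i - p.ySol i u.x‖ ^ 2) =
      (c.wy - 8 * c.κα / c.μf * c.wα - 4 * c.κy * c.ws) * ‖u.y i - p.ySol i u.x‖ ^ 2 := by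
    rw [Consts.wy]; ring
  rw [e2]
  linarith

/-- The descent of the objective in one step. -/
theorem F_step_le (hc : c.Pos) (h : p.Regular c) (hm : 1 ≤ m) (hk : k.Good c m n)
    (u : State m dx dα dy) (w : Draw m b Ξ Z) :
    2 / k.η₀ * p.F (step p.A o k u w).x + ‖gradient p.F u.x‖ ^ 2 +
        1 / 2 * ‖(step p.A o k u w).z‖ ^ 2 ≤
      2 / k.η₀ * p.F u.x + ‖gradient p.F u.x - (step p.A o k u w).z‖ ^ 2 := by
  have hη := hk.η₀_pos
  have e1 := h.F_descent hc hm u.x (step p.A o k u w).x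
  set z := (step p.A o k u w).z with hz
  have e2 : (step p.A o k u w).x - u.x = -(k.η₀ • z) := by rw [step_x, sub_sub_cancel_left]
  rw [e2, inner_neg_right, inner_smul_right, norm_neg, norm_smul, Real.norm_of_nonneg hη.le] at e1
  have e3 := norm_sub_sq_real (gradient p.F u.x) z
  set G := gradient p.F u.x
  have e4 := mul_le_mul_of_nonneg_left e1 (show 0 ≤ 2 / k.η₀ by positivity)
  have e5 : 2 / k.η₀ * (p.F u.x + -(k.η₀ * inner ℝ G z) + c.Lgrad * (k.η₀ * ‖z‖) ^ 2) =
      2 / k.η₀ * p.F u.x - 2 * inner ℝ G z + 2 * (c.Lgrad * k.η₀) * ‖z‖ ^ 2 := by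
    field_simp
    ring
  -- Expanding `‖∇F - z‖²` left `-‖z‖²`; half of it is spent on the smoothness term here.
  have e6 : 2 * (c.Lgrad * k.η₀) * ‖z‖ ^ 2 ≤ 1 / 2 * ‖z‖ ^ 2 :=
    mul_le_mul_of_nonneg_right (by linarith [hk.descent]) (sq_nonneg _)
  linarith

/-- One step of the Lyapunov analysis, in terms of the mean squared error of the momentum. -/
theorem ebound_lyapunov_of (hc : c.Pos) (h : p.Regular c) (hv : o.Valid p c) (hn1 : 1 ≤ n)
    (hn : n ≤ m) (hb : 1 ≤ b) (hk : k.Good c m n) (hu : u.Adm p.A c) {B : ℝ}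
    (hB : ∀ x, B ≤ p.F x) {e : ℝ}
    (he : EBound (o.drawLaw n) (fun w => gradErr p k (step p.A o k u w)) e) :
    EBound (o.drawLaw n) (fun w => lyapunov p c k n B (step p.A o k u w) +
        (prevGrad p k (step p.A o k u w) + gradErr p k (step p.A o k u w)))
      (potential p c k n B u - 4 * ((1 / (m : ℝ)) * ∑ i, biasBound p c i u) + k.noise c b +
        2 / k.β₀ * e) := by
  have hm1 := hn1.trans hn
  have hm0 : (0 : ℝ) < m := by exact_mod_cast hm1
  have := hv.prob_drawLaw (n := n) hn
  have hβ := hk.β₀_pos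
  have hη := hk.η₀_pos
  have hsum := (EBound.sum Finset.univ fun i _ =>
    ebound_weighted hc h hv hn1 hn hb hk hu i).const_mul (show 0 ≤ 1 / (m : ℝ) by positivity)
  have hall := (EBound.const (ν := o.drawLaw n) (2 / k.η₀ * (p.F u.x - B))).add
    (hsum.add (he.const_mul (show 0 ≤ 2 / k.β₀ by positivity)))
  refine (hall.mono (le_of_eq ?_)).mono_left ?_ (fun w => ?_) (Eventually.of_forall fun w => ?_)
  · rw [potential, Finset.sum_add_distrib, Finset.sum_sub_distrib, Finset.sum_const,
      Finset.card_univ, Fintype.card_fin, nsmul_eq_mul, ← Finset.mul_sum]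
    field_simp
    ring
  · have hs := measurable_step_right h hv k u
    exact (((measurable_lyapunov h hc hm1 k n B).comp hs).add
      (((measurable_prevGrad h hc hm1 k).comp hs).add
        ((measurable_gradErr h hc hm1 k).comp hs))).aestronglyMeasurable
  · exact add_nonneg (lyapunov_nonneg hc hk hn1 hn hB _)
      (add_nonneg (sq_nonneg _) (sq_nonneg _))
  · have hF := F_step_le (o := o) hc h hm1 hk u w
    have hgE : gradErr p k (step p.A o k u w) =
        ‖gradient p.F u.x - (step p.A o k u w).z‖ ^ 2 := by rw [gradErr, prev_step]
    have hpG : prevGrad p k (step p.A o k u w) = ‖gradient p.F u.x‖ ^ 2 := by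
      rw [prevGrad, prev_step]
    have hα := hk.rateα_pos hc hn1 hn
    have hy := hk.ratey_pos hc hn1 hn
    have hs := hk.rates_pos (c := c) hn1 hn
    set zz := k.η₀ ^ 2 * ‖(step p.A o k u w).z‖ ^ 2 with hzz
    have hi : ∀ i, innerErr p c k n i (step p.A o k u w) ≤
        (c.wα / k.rateα c m n * ((1 + k.rateα c m n) *
          ‖(step p.A o k u w).α i - p.αSol i u.x‖ ^ 2) +
        c.wy / k.ratey c m n * ((1 + k.ratey c m n) *
          ‖(step p.A o k u w).y i - p.ySol i u.x‖ ^ 2) +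
        c.ws / k.rates m n * ((1 + k.rates m n) * (cut c.Khess ‖u.s i‖ *
            ‖((step p.A o k u w).s i - p.hess i u.x) (p.dir i u.x)‖ ^ 2 +
          c.Bcut ^ 2 * max (cut c.Khess ‖(step p.A o k u w).s i‖ - cut c.Khess ‖u.s i‖) 0) +
          c.lam * c.excess ((step p.A o k u w).s i) ^ 2)) + 9 / 20 * ‖(step p.A o k u w).z‖ ^ 2 := by
      intro i
      have f1 := mul_le_mul_of_nonneg_left
        (errα_step_le (o := o) hc h hη.le hα hk.rateα_le u i w)
        (show 0 ≤ c.wα / k.rateα c m n from div_nonneg hc.wα_pos.le hα.le)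
      have f2 := mul_le_mul_of_nonneg_left
        (erry_step_le (o := o) hc h hη.le hy hk.ratey_le u i w)
        (show 0 ≤ c.wy / k.ratey c m n from div_nonneg hc.wy_pos.le hy.le)
      have f3 := mul_le_mul_of_nonneg_left
        (hessErr_step_le (o := o) hc h hη.le hs (hk.rates_le hn1 hn) u i w)
        (show 0 ≤ c.ws / k.rates m n from div_nonneg hc.ws_pos.le hs.le)
      -- Of the `‖z‖²/2` supplied by descent, `9/20` pays for the drift of the inner solutions; the
      -- remaining `1/20` is stored in `lyapunov` for the momentum drift of the next step.
      have f4 := mul_le_mul_of_nonneg_right hk.drift (sq_nonneg ‖(step p.A o k u w).z‖)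
      have f5 : k.η₀ ^ 2 * (2 * c.wα / k.rateα c m n ^ 2 * (c.Cα * (1 + c.Cy)) ^ 2 +
          2 * c.wy / k.ratey c m n ^ 2 * c.Cy ^ 2 + 2 * c.ws / k.rates m n ^ 2 * c.Lcut ^ 2) *
            ‖(step p.A o k u w).z‖ ^ 2 =
          c.wα / k.rateα c m n * (2 / k.rateα c m n * ((c.Cα * (1 + c.Cy)) ^ 2 * zz)) +
          c.wy / k.ratey c m n * (2 / k.ratey c m n * (c.Cy ^ 2 * zz)) +
          c.ws / k.rates m n * (2 / k.rates m n * (c.Lcut ^ 2 * zz)) := by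
        rw [hzz]
        field_simp
      rw [f5] at f4
      rw [innerErr]
      rw [mul_add] at f1 f2 f3
      linarith
    have hsum' := mul_le_mul_of_nonneg_left (Finset.sum_le_sum fun i (_ : i ∈ Finset.univ) => hi i)
      (show 0 ≤ 1 / (m : ℝ) by positivity)
    rw [Finset.sum_add_distrib, Finset.sum_const, Finset.card_univ, Fintype.card_fin,
      nsmul_eq_mul, mul_add, show 1 / (m : ℝ) * (m * (9 / 20 * ‖(step p.A o k u w).z‖ ^ 2)) =
        9 / 20 * ‖(step p.A o k u w).z‖ ^ 2 by field_simp] at hsum'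
    rw [lyapunov, potential, hpG, hgE]
    linarith

/-- The recursion for the mean squared error of the momentum. -/
theorem ebound_gradErr (hc : c.Pos) (h : p.Regular c) (hv : o.Valid p c) (hn1 : 1 ≤ n)
    (hn : n ≤ m) (hb : 1 ≤ b) (hk : k.Good c m n) (hu : u.Adm p.A c) :
    EBound (o.drawLaw n) (fun w => gradErr p k (step p.A o k u w))
      ((1 - k.β₀) * gradErr p k u + 2 * c.Lgrad ^ 2 * k.η₀ ^ 2 / k.β₀ * ‖u.z‖ ^ 2 +
        2 * k.β₀ * ((1 / (m : ℝ)) * ∑ i, biasBound p c i u) +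
        k.β₀ ^ 2 * (c.Vgrad / min (n : ℝ) (b : ℝ))) := by
  have := hv.prob_drawLaw (n := n) hn
  have hm1 := hn1.trans hn
  set Gm := (1 / (m : ℝ)) • ∑ i, p.hyper i u.x (u.α i) (u.y i) (u.s i) with hGm
  have e1 := (isUnbiased_gradEst hc h hv hn1 hn hb hu).ebound_norm_add_sq
    (gradient p.F u.x - (1 - k.β₀) • u.z) (-k.β₀)
  have e2 : (fun w => gradErr p k (step p.A o k u w)) = fun w =>
      ‖gradient p.F u.x - (1 - k.β₀) • u.z + (-k.β₀) • gradEst o u w‖ ^ 2 := by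
    ext w
    rw [gradErr, prev_step]
    congr 2
    simp only [step, nextZ]
    module
  rw [e2]
  refine e1.mono ?_
  rw [neg_sq]
  refine add_le_add_left ?_ _
  -- The mean error after the step is composed of the old error, the change of the gradient since
  -- the previous point, and the bias.
  have e3 : gradient p.F u.x - (1 - k.β₀) • u.z + -k.β₀ • Gm =
      (1 - k.β₀) • (gradient p.F (u.x + k.η₀ • u.z) - u.z) +
      (1 - k.β₀) • (gradient p.F u.x - gradient p.F (u.x + k.η₀ • u.z)) +
      k.β₀ • (gradient p.F u.x - Gm) := by module
  have hβ1 : 0 ≤ 1 - k.β₀ := sub_nonneg.mpr hk.β₀_le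
  set e := ‖gradient p.F (u.x + k.η₀ • u.z) - u.z‖ with he
  set d := ‖gradient p.F u.x - gradient p.F (u.x + k.η₀ • u.z)‖ with hd
  set bi := ‖gradient p.F u.x - Gm‖ with hbi
  have e4 : ‖gradient p.F u.x - (1 - k.β₀) • u.z + -k.β₀ • Gm‖ ≤
      (1 - k.β₀) * e + (1 - k.β₀) * d + k.β₀ * bi := by
    rw [e3]
    refine norm_add₃_le.trans (le_of_eq ?_)
    rw [norm_smul, norm_smul, norm_smul, Real.norm_of_nonneg hβ1,
      Real.norm_of_nonneg hk.β₀_pos.le]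
  refine (pow_le_pow_left₀ (norm_nonneg _) e4 2).trans
    ((convex_add_sq_le hk.β₀_pos hk.β₀_le (norm_nonneg _) (norm_nonneg _)).trans ?_)
  have e5 : d ≤ c.Lgrad * (k.η₀ * ‖u.z‖) := by
    refine (h.gradient_F_lip hc hm1 _ _).trans (le_of_eq ?_)
    rw [sub_add_cancel_left, norm_neg, norm_smul, Real.norm_of_nonneg hk.η₀_pos.le]
  have e6 := mul_le_mul_of_nonneg_left (pow_le_pow_left₀ (norm_nonneg _) e5 2)
    (show 0 ≤ 2 / k.β₀ from div_nonneg zero_le_two hk.β₀_pos.le)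
  have e7 := mul_le_mul_of_nonneg_left (bias_sq_le hc h hu)
    (show 0 ≤ 2 * k.β₀ by linarith [hk.β₀_pos])
  have e8 : 2 / k.β₀ * (c.Lgrad * (k.η₀ * ‖u.z‖)) ^ 2 =
      2 * c.Lgrad ^ 2 * k.η₀ ^ 2 / k.β₀ * ‖u.z‖ ^ 2 := by ring
  rw [gradErr]
  linarith

/-- The decrease of the Lyapunov function. -/
theorem ebound_lyapunov (hc : c.Pos) (h : p.Regular c) (hv : o.Valid p c) (hn1 : 1 ≤ n)
    (hn : n ≤ m) (hb : 1 ≤ b) (hk : k.Good c m n) (hu : u.Adm p.A c) {B : ℝ}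
    (hB : ∀ x, B ≤ p.F x) :
    EBound (o.drawLaw n) (fun w => lyapunov p c k n B (step p.A o k u w) +
        (prevGrad p k (step p.A o k u w) + gradErr p k (step p.A o k u w)))
      (lyapunov p c k n B u +
        (k.noise c b + 2 * k.β₀ * (c.Vgrad / min (n : ℝ) (b : ℝ)))) := by
  refine (ebound_lyapunov_of hc h hv hn1 hn hb hk hu hB
    (ebound_gradErr hc h hv hn1 hn hb hk hu)).mono ?_
  have hβ := hk.β₀_pos
  have e1 := mul_le_mul_of_nonneg_right hk.momentum (sq_nonneg ‖u.z‖)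
  set S := (1 / (m : ℝ)) * ∑ i, biasBound p c i u
  set V := c.Vgrad / min (n : ℝ) (b : ℝ)
  -- The contraction turns `2/β₀` into `2/β₀ - 2`, the weight in `lyapunov`. Of the missing `2`, one
  -- unit covers the error in the descent inequality and one is the momentum error that is to be
  -- summed. The bias `4 S` cancels against the decay of the inner errors.
  have e2 : 2 / k.β₀ * ((1 - k.β₀) * gradErr p k u +
      2 * c.Lgrad ^ 2 * k.η₀ ^ 2 / k.β₀ * ‖u.z‖ ^ 2 + 2 * k.β₀ * S + k.β₀ ^ 2 * V) =
      (2 / k.β₀ - 2) * gradErr p k u +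
        4 * c.Lgrad ^ 2 * k.η₀ ^ 2 / k.β₀ ^ 2 * ‖u.z‖ ^ 2 + 4 * S + 2 * k.β₀ * V := by
    field_simp
    ring
  rw [e2, lyapunov]
  linarith

end Step

end MinMaxBilevel

/-! ### From one iteration to the whole run; the uniform random time. -/

namespace MinMaxBilevel

open Filter Topology Set

section Uniform

theorem uniformOn_Iic_singleton {T t : ℕ} (ht : t ≤ T) :
    uniformOn {r : ℕ | r ≤ T} {t} = ENNReal.ofReal (1 / ((T : ℝ) + 1)) := by
  have h1 : ({r : ℕ | r ≤ T} : Set ℕ) = ((Finset.range (T + 1) : Finset ℕ) : Set ℕ) := by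
    ext r; simp
  have h2 : ({r : ℕ | r ≤ T} ∩ {t} : Set ℕ) = {t} :=
    inter_eq_right.mpr (singleton_subset_iff.mpr ht)
  rw [uniformOn, cond_apply (MeasurableSet.of_discrete), h2, h1, Measure.count_apply_finset,
    Measure.count_singleton, Finset.card_range, mul_one, one_div, ENNReal.ofReal_inv_of_pos
    (by positivity)]
  congr 1
  rw [show (T : ℝ) + 1 = ((T + 1 : ℕ) : ℝ) by push_cast; rfl, ENNReal.ofReal_natCast]

/-- The mean of a process at an independent uniform time. -/
theorem ebound_uniform {Ω W : Type*} [MeasurableSpace Ω] [MeasurableSpace W] {μ : Measure Ω}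
    [IsProbabilityMeasure μ] {τ : Ω → ℕ} {X : Ω → W} {T : ℕ} (hτ : Measurable τ)
    (hlaw : μ.map τ = uniformOn {t : ℕ | t ≤ T}) (hind : IndepFun τ X μ)
    {φ : ℕ → W → ℝ} (hφ : ∀ t, Measurable (φ t)) {a : ℕ → ℝ}
    (he : ∀ t ∈ Finset.range (T + 1), EBound μ (fun ω => φ t (X ω)) (a t)) :
    EBound μ (fun ω => φ (τ ω) (X ω)) (1 / ((T : ℝ) + 1) * ∑ t ∈ Finset.range (T + 1), a t) := by
  have hle : ∀ᵐ ω ∂μ, τ ω ≤ T := by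
    have h1 : ∀ᵐ t ∂(μ.map τ), t ≤ T := by
      rw [hlaw]
      exact ae_cond_mem (MeasurableSet.of_discrete)
    exact ae_of_ae_map hτ.aemeasurable h1
  -- Almost surely the value at time `τ` is the sum over `t ≤ T` of the indicator of `τ = t` times
  -- the value at `t`; independence factors the mean of each term.
  have hpt : ∀ t ∈ Finset.range (T + 1),
      EBound μ (fun ω => ({t} : Set ℕ).indicator (1 : ℕ → ℝ) (τ ω) * φ t (X ω))
        (1 / ((T : ℝ) + 1) * a t) := by
    intro t ht
    have ht' : t ≤ T := Nat.lt_succ_iff.mp (Finset.mem_range.mp ht)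
    have hm : Measurable (({t} : Set ℕ).indicator (1 : ℕ → ℝ)) := measurable_of_countable _
    have hi : IndepFun (fun ω => ({t} : Set ℕ).indicator (1 : ℕ → ℝ) (τ ω))
        (fun ω => φ t (X ω)) μ := hind.comp hm (hφ t)
    have e1 : (fun ω => ({t} : Set ℕ).indicator (1 : ℕ → ℝ) (τ ω)) =
        (τ ⁻¹' {t}).indicator 1 := rfl
    have e2 : ∫ ω, ({t} : Set ℕ).indicator (1 : ℕ → ℝ) (τ ω) ∂μ = 1 / ((T : ℝ) + 1) := by
      rw [e1, integral_indicator_one (hτ (measurableSet_singleton t)), Measure.real,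
        ← Measure.map_apply hτ (measurableSet_singleton t), hlaw, uniformOn_Iic_singleton ht',
        ENNReal.toReal_ofReal (by positivity)]
    have e3 : Integrable (fun ω => ({t} : Set ℕ).indicator (1 : ℕ → ℝ) (τ ω)) μ := by
      rw [e1]
      exact (integrable_const (1 : ℝ)).indicator (hτ (measurableSet_singleton t))
    refine ⟨hi.integrable_mul e3 (he t ht).1, ?_⟩
    rw [hi.integral_fun_mul_eq_mul_integral e3.aestronglyMeasurable
      (he t ht).1.aestronglyMeasurable, e2]
    exact mul_le_mul_of_nonneg_left (he t ht).2 (by positivity)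
  have hs := EBound.sum _ hpt
  rw [← Finset.mul_sum] at hs
  have heq : (fun ω => ∑ t ∈ Finset.range (T + 1),
      ({t} : Set ℕ).indicator (1 : ℕ → ℝ) (τ ω) * φ t (X ω)) =ᵐ[μ] fun ω => φ (τ ω) (X ω) := by
    filter_upwards [hle] with ω hω
    rw [Finset.sum_eq_single_of_mem (τ ω) (Finset.mem_range.mpr (Nat.lt_succ_of_le hω))
      (fun t _ hne => by simp [Set.indicator, hne.symm])]
    simp
  exact ⟨hs.1.congr heq, (integral_congr_ae heq).symm.le.trans hs.2⟩

end Uniform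

section Run

variable {m dx dα dy b n T : ℕ} {Ξ Z Ω : Type*} [MeasurableSpace Ξ] [MeasurableSpace Z]
  [MeasurableSpace Ω]
variable {p : Problem m dx dα dy} {c : Consts} {o : Oracles m dx dα dy b Ξ Z}
variable {μ : Measure Ω} {w : ℕ → Ω → Draw m b Ξ Z} {τ : Ω → ℕ}

/-- The state at time `t` is a measurable function of the first `t` draws. -/
theorem exists_measurable_run (h : p.Regular c) (hv : o.Valid p c) (k : Steps)
    (u₀ : State m dx dα dy) (t : ℕ) :
    ∃ G : (Finset.range t → Draw m b Ξ Z) → State m dx dα dy, Measurable G ∧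
      ∀ w : ℕ → Draw m b Ξ Z, run p.A o k u₀ w t = G fun r => w r := by
  induction t with
  | zero => exact ⟨fun _ => u₀, measurable_const, fun _ => rfl⟩
  | succ t ih =>
    obtain ⟨G, hG, hrun⟩ := ih
    have hsub : ∀ r : Finset.range t, (r : ℕ) ∈ Finset.range (t + 1) := fun r =>
      Finset.mem_range.mpr ((Finset.mem_range.mp r.2).trans (Nat.lt_succ_self t))
    refine ⟨fun v => step p.A o k (G fun r => v ⟨r, hsub r⟩)
      (v ⟨t, Finset.self_mem_range_succ t⟩), ?_, fun w => ?_⟩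
    · exact (measurable_step h hv k).comp ((hG.comp (measurable_pi_lambda _ fun r =>
        measurable_pi_apply _)).prodMk (measurable_pi_apply _))
    · rw [run, hrun]

theorem measurable_run (h : p.Regular c) (hv : o.Valid p c) (k : Steps)
    (u₀ : State m dx dα dy) (t : ℕ) :
    Measurable fun w : ℕ → Draw m b Ξ Z => run p.A o k u₀ w t := by
  obtain ⟨G, hG, hrun⟩ := exists_measurable_run h hv k u₀ t
  simp_rw [hrun]
  exact hG.comp (measurable_pi_lambda _ fun r => measurable_pi_apply _)

theorem IsSampling.measurable_draws (hs : IsSampling μ o n T w τ) :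
    Measurable fun ω t => w t ω := measurable_pi_lambda _ hs.w_meas

/-- The state at time `t` depends on the draws before `t` only, and these are independent of draw
`t`. -/
theorem IsSampling.indepFun_run (hs : IsSampling μ o n T w τ) (h : p.Regular c)
    (hv : o.Valid p c) (k : Steps) (u₀ : State m dx dα dy) (t : ℕ) :
    IndepFun (fun ω => run p.A o k u₀ (fun r => w r ω) t) (w t) μ := by
  obtain ⟨G, hG, hrun⟩ := exists_measurable_run h hv k u₀ t
  have h1 := hs.w_indep.indepFun_finset (Finset.range t) {t}
    (Finset.disjoint_singleton_right.mpr Finset.notMem_range_self) hs.w_meas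
  have h2 := h1.comp hG
    (measurable_pi_apply (⟨t, Finset.mem_singleton_self t⟩ : ({t} : Finset ℕ)))
  have h3 : (fun ω => run p.A o k u₀ (fun r => w r ω) t) =
      G ∘ fun ω (r : Finset.range t) => w r ω := funext fun ω => hrun _
  rw [h3]
  exact h2

/-- A bound for the mean after one step, conditional on the past, can be integrated. -/
theorem IsSampling.ebound_run_succ (hs : IsSampling μ o n T w τ) (hn : n ≤ m) (h : p.Regular c)
    (hv : o.Valid p c) {k : Steps} (h0 : 0 ≤ k.β₁) (h1 : k.β₁ ≤ 1) {u₀ : State m dx dα dy}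
    (hu : u₀.Adm p.A c) (t : ℕ) {φ ψ : State m dx dα dy → ℝ} (hφ : Measurable φ)
    (hφ0 : ∀ u, 0 ≤ φ u)
    (hstep : ∀ u : State m dx dα dy, u.Adm p.A c →
      EBound (o.drawLaw n) (fun v => φ (step p.A o k u v)) (ψ u))
    {a : ℝ} (hψ : EBound μ (fun ω => ψ (run p.A o k u₀ (fun r => w r ω) t)) a) :
    EBound μ (fun ω => φ (run p.A o k u₀ (fun r => w r ω) (t + 1))) a := by
  have := hs.prob
  have := hv.prob_drawLaw (n := n) hn
  set U : Ω → State m dx dα dy := fun ω => run p.A o k u₀ (fun r => w r ω) t with hU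
  have hUm : Measurable U := (measurable_run h hv k u₀ t).comp hs.measurable_draws
  have hst := measurable_step h hv k
  have hUadm : ∀ ω, (U ω).Adm p.A c := fun ω => hu.run h hv h0 h1 _ t
  -- The joint law of state and fresh draw is a product, written as an image of `μ` times the law of
  -- a draw, so that Fubini's theorem applies with `ω` fixed and the one-step bound is used at the
  -- state `U ω`.
  have hmap : μ.map (fun ω => (U ω, w t ω)) =
      (μ.prod (o.drawLaw n)).map (Prod.map U (id : Draw m b Ξ Z → _)) := by
    rw [(indepFun_iff_map_prod_eq_prod_map_map hUm.aemeasurable (hs.w_meas t).aemeasurable).mp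
      (hs.indepFun_run h hv k u₀ t), hs.w_law t, ← Measure.map_prod_map _ _ hUm measurable_id,
      Measure.map_id]
  have hm2 : Measurable fun q : State m dx dα dy × Draw m b Ξ Z => φ (step p.A o k q.1 q.2) :=
    hφ.comp hst
  have hm3 : Measurable fun q : Ω × Draw m b Ξ Z => φ (step p.A o k (U q.1) q.2) :=
    hm2.comp ((hUm.comp measurable_fst).prodMk measurable_snd)
  have e1 : EBound (μ.prod (o.drawLaw n)) (fun q => φ (step p.A o k (U q.1) q.2)) a := by
    have hi : Integrable (fun q : Ω × Draw m b Ξ Z => φ (step p.A o k (U q.1) q.2))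
        (μ.prod (o.drawLaw n)) := by
      rw [integrable_prod_iff hm3.aestronglyMeasurable]
      refine ⟨Eventually.of_forall fun ω => (hstep _ (hUadm ω)).1, ?_⟩
      refine hψ.1.mono' hm3.aestronglyMeasurable.norm.integral_prod_right'
        (Eventually.of_forall fun ω => ?_)
      rw [Real.norm_of_nonneg (integral_nonneg fun _ => norm_nonneg _)]
      simp only [Real.norm_of_nonneg (hφ0 _)]
      exact (hstep _ (hUadm ω)).2
    refine ⟨hi, ?_⟩
    rw [integral_prod _ hi]
    exact (integral_mono hi.integral_prod_left hψ.1 fun ω => (hstep _ (hUadm ω)).2).trans hψ.2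
  have hpres : MeasurePreserving (Prod.map U (id : Draw m b Ξ Z → _)) (μ.prod (o.drawLaw n))
      (μ.map fun ω => (U ω, w t ω)) := ⟨hUm.prodMap measurable_id, hmap.symm⟩
  have e2 : EBound (μ.map fun ω => (U ω, w t ω))
      (fun q => φ (step p.A o k q.1 q.2)) a := by
    rw [hmap]
    have hpm := hUm.prodMap (measurable_id : Measurable (id : Draw m b Ξ Z → _))
    exact ⟨(integrable_map_measure hm2.aestronglyMeasurable hpm.aemeasurable).mpr e1.1, by
      rw [integral_map hpm.aemeasurable hm2.aestronglyMeasurable]; exact e1.2⟩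
  exact e2.comp ⟨hUm.prodMk (hs.w_meas t), rfl⟩

/-- The initial state is deterministic, so only the law of the first draw matters. -/
theorem IsSampling.errz_eq (hs : IsSampling μ o n T w τ) (hc : c.Pos) (h : p.Regular c)
    (hv : o.Valid p c) (hm : 1 ≤ m) (k : Steps) (u₀ : State m dx dα dy) :
    errz μ p o k u₀ w = ∫ v, gradErr p k (step p.A o k u₀ v) ∂(o.drawLaw n) := by
  have hmeas : Measurable fun v => gradErr p k (step p.A o k u₀ v) :=
    (measurable_gradErr h hc hm k).comp (measurable_step_right h hv k u₀)
  rw [← hs.w_law 0, integral_map (hs.w_meas 0).aemeasurable hmeas.aestronglyMeasurable, errz]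
  refine integral_congr_ae (Eventually.of_forall fun ω => ?_)
  simp only [gradErr, prev_step]
  rfl

/-- The sum of the mean squared gradients and momentum errors along the run. -/
theorem IsSampling.ebound_sum (hs : IsSampling μ o n T w τ) (hc : c.Pos) (h : p.Regular c)
    (hv : o.Valid p c) (hn1 : 1 ≤ n) (hn : n ≤ m) (hb : 1 ≤ b) {k : Steps} (hk : k.Good c m n)
    {u₀ : State m dx dα dy} (hu : u₀.Adm p.A c) {B : ℝ} (hB : ∀ x, B ≤ p.F x) (t : ℕ) :
    EBound μ (fun ω => lyapunov p c k n B (run p.A o k u₀ (fun r => w r ω) (t + 1)) +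
        ∑ s ∈ Finset.range (t + 1), (prevGrad p k (run p.A o k u₀ (fun r => w r ω) (s + 1)) +
          gradErr p k (run p.A o k u₀ (fun r => w r ω) (s + 1))))
      (potential p c k n B u₀ + 2 / k.β₀ * errz μ p o k u₀ w +
        ((t : ℝ) + 1) * (k.noise c b + 2 * k.β₀ * (c.Vgrad / min (n : ℝ) (b : ℝ)))) := by
  have hP := hs.prob
  have hm1 := hn1.trans hn
  have hmL := measurable_lyapunov h hc hm1 k n B
  have hmN : Measurable fun u : State m dx dα dy => prevGrad p k u + gradErr p k u :=
    (measurable_prevGrad h hc hm1 k).add (measurable_gradErr h hc hm1 k)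
  have hN0 : ∀ u : State m dx dα dy, 0 ≤ prevGrad p k u + gradErr p k u := fun u =>
    add_nonneg (sq_nonneg _) (sq_nonneg _)
  have hL0 := lyapunov_nonneg hc hk hn1 hn hB
  have hrm : ∀ t, Measurable fun ω => run p.A o k u₀ (fun r => w r ω) t := fun t =>
    (measurable_run h hv k u₀ t).comp hs.measurable_draws
  induction t with
  | zero =>
    -- The first step uses the actual mean error of `z₁` instead of the recursion, because the bound
    -- on `T` is stated through that error and not through `z₀`.
    have e2 := ebound_lyapunov_of hc h hv hn1 hn hb hk hu hB
      ⟨(ebound_gradErr hc h hv hn1 hn hb hk hu).1, (hs.errz_eq hc h hv hm1 k u₀).ge⟩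
    have e3 : MeasurePreserving (w 0) μ (o.drawLaw n) := ⟨hs.w_meas 0, hs.w_law 0⟩
    have e4 := e2.comp e3
    simp only [Finset.range_one, Finset.sum_singleton, zero_add, Nat.cast_zero, one_mul]
    refine EBound.mono e4 ?_
    have e5 : 0 ≤ 1 / (m : ℝ) * ∑ i, biasBound p c i u₀ :=
      mul_nonneg (by positivity) (Finset.sum_nonneg fun i _ => biasBound_nonneg hc i u₀)
    have e6 : 0 ≤ 2 * k.β₀ * (c.Vgrad / min (n : ℝ) (b : ℝ)) := by
      have := hk.β₀_pos; have := hc.Vgrad_pos; positivity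
    linarith
  | succ t ih =>
    -- Both parts are nonnegative, so each is dominated by the integrable total of the induction
    -- hypothesis and they may be treated separately.
    have hLt : Integrable (fun ω => lyapunov p c k n B
        (run p.A o k u₀ (fun r => w r ω) (t + 1))) μ := by
      refine (ih.mono_left (hmL.comp (hrm (t + 1))).aestronglyMeasurable (fun ω => hL0 _)
        (Eventually.of_forall fun ω => ?_)).1
      exact le_add_of_nonneg_right (Finset.sum_nonneg fun s _ => hN0 _)
    have hSt : Integrable (fun ω => ∑ s ∈ Finset.range (t + 1),
        (prevGrad p k (run p.A o k u₀ (fun r => w r ω) (s + 1)) +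
          gradErr p k (run p.A o k u₀ (fun r => w r ω) (s + 1)))) μ := by
      refine (ih.mono_left (Finset.measurable_fun_sum _ fun s _ =>
        hmN.comp (hrm (s + 1))).aestronglyMeasurable
        (fun ω => Finset.sum_nonneg fun s _ => hN0 _) (Eventually.of_forall fun ω => ?_)).1
      exact le_add_of_nonneg_left (hL0 _)
    have e1 := hs.ebound_run_succ hn h hv hk.β₁_pos.le hk.β₁_le hu (t + 1)
      (φ := fun u => lyapunov p c k n B u + (prevGrad p k u + gradErr p k u)) (hmL.add hmN)
      (fun u => add_nonneg (hL0 u) (hN0 u))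
      (fun u hu' => ebound_lyapunov hc h hv hn1 hn hb hk hu' hB)
      (EBound.add ⟨hLt, le_rfl⟩ (EBound.const _))
    have e2 := e1.add (⟨hSt, le_rfl⟩ : EBound μ _ _)
    have e3 := ih.2
    rw [integral_add hLt hSt] at e3
    refine (e2.mono_left ?_ ?_ (Eventually.of_forall fun ω => le_of_eq ?_)).mono ?_
    · exact ((hmL.comp (hrm _)).add (Finset.measurable_fun_sum _ fun s _ =>
        hmN.comp (hrm (s + 1)))).aestronglyMeasurable
    · exact fun ω => add_nonneg (hL0 _) (Finset.sum_nonneg fun s _ => hN0 _)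
    · rw [Finset.sum_range_succ]
      ring
    · push_cast
      linarith

/-- The guarantee at a uniform time, from a bound for the sum along the run. -/
theorem IsSampling.guarantee_of (hs : IsSampling μ o n T w τ) (hc : c.Pos) (h : p.Regular c)
    (hv : o.Valid p c) (hn1 : 1 ≤ n) (hn : n ≤ m) (hb : 1 ≤ b) {k : Steps} (hk : k.Good c m n)
    {u₀ : State m dx dα dy} (hu : u₀.Adm p.A c) {B ε : ℝ} (hB : ∀ x, B ≤ p.F x) (hε : 0 < ε)
    (hle : potential p c k n B u₀ + 2 / k.β₀ * errz μ p o k u₀ w +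
        ((T : ℝ) + 1) * (k.noise c b + 2 * k.β₀ * (c.Vgrad / min (n : ℝ) (b : ℝ))) ≤
      ((T : ℝ) + 1) * ε ^ 2) :
    Guarantee μ p o k u₀ w τ ε := by
  have hP := hs.prob
  have hm1 := hn1.trans hn
  have hL0 := lyapunov_nonneg hc hk hn1 hn hB
  have hsum := hs.ebound_sum hc h hv hn1 hn hb hk hu hB T
  -- The shift by one: the state at time `t + 1` carries both `x_t`, as its previous point, and
  -- `z_{t+1}`.
  set G : ℕ → (ℕ → Draw m b Ξ Z) → ℝ := fun t v =>
    prevGrad p k (run p.A o k u₀ v (t + 1)) with hG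
  set N : ℕ → (ℕ → Draw m b Ξ Z) → ℝ := fun t v =>
    gradErr p k (run p.A o k u₀ v (t + 1)) with hN
  have hGm : ∀ t, Measurable (G t) := fun t =>
    (measurable_prevGrad h hc hm1 k).comp (measurable_run h hv k u₀ (t + 1))
  have hNm : ∀ t, Measurable (N t) := fun t =>
    (measurable_gradErr h hc hm1 k).comp (measurable_run h hv k u₀ (t + 1))
  have hG0 : ∀ t v, 0 ≤ G t v := fun t v => sq_nonneg _
  have hN0 : ∀ t v, 0 ≤ N t v := fun t v => sq_nonneg _
  -- Stated for any nonnegative summand below the controlled sum, so as to serve both the gradient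
  -- and the momentum error.
  have key : ∀ Φ : ℕ → (ℕ → Draw m b Ξ Z) → ℝ, (∀ t, Measurable (Φ t)) → (∀ t v, 0 ≤ Φ t v) →
      (∀ t v, Φ t v ≤ G t v + N t v) →
      EBound μ (fun ω => Φ (τ ω) fun r => w r ω) (ε ^ 2) := by
    intro Φ hm h0 hΦ
    have hs1 : EBound μ (fun ω => ∑ t ∈ Finset.range (T + 1), Φ t fun r => w r ω)
        (((T : ℝ) + 1) * ε ^ 2) := by
      refine (hsum.mono hle).mono_left (Finset.measurable_fun_sum _ fun t _ =>
        (hm t).comp hs.measurable_draws).aestronglyMeasurable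
        (fun ω => Finset.sum_nonneg fun t _ => h0 _ _) (Eventually.of_forall fun ω => ?_)
      exact (Finset.sum_le_sum fun t _ => hΦ t _).trans (le_add_of_nonneg_left (hL0 _))
    have hi : ∀ t ∈ Finset.range (T + 1), EBound μ (fun ω => Φ t fun r => w r ω)
        (∫ ω, Φ t (fun r => w r ω) ∂μ) := fun t ht =>
      ⟨(hs1.mono_left ((hm t).comp hs.measurable_draws).aestronglyMeasurable (fun ω => h0 _ _)
        (Eventually.of_forall fun ω => Finset.single_le_sum
          (f := fun t => Φ t fun r => w r ω) (fun t _ => h0 t _) ht)).1, le_rfl⟩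
    refine (ebound_uniform hs.τ_meas hs.τ_law hs.τ_indep hm hi).mono ?_
    rw [← integral_finsetSum _ fun t ht => (hi t ht).1, one_div, inv_mul_le_iff₀ (by positivity)]
    exact hs1.2
  have e1 := key G hGm hG0 fun t v => le_add_of_nonneg_right (hN0 t v)
  have e2 := key N hNm hN0 fun t v => le_add_of_nonneg_left (hG0 t v)
  have f1 : (fun ω => G (τ ω) fun r => w r ω) = fun ω =>
      ‖gradient p.F (run p.A o k u₀ (fun r => w r ω) (τ ω)).x‖ ^ 2 := by
    ext ω
    simp only [hG, prevGrad, run, prev_step]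
  have f2 : (fun ω => N (τ ω) fun r => w r ω) = fun ω =>
      ‖gradient p.F (run p.A o k u₀ (fun r => w r ω) (τ ω)).x -
        (run p.A o k u₀ (fun r => w r ω) (τ ω + 1)).z‖ ^ 2 := by
    ext ω
    simp only [hN, gradErr, run, prev_step]
  rw [f1] at e1
  rw [f2] at e2
  refine ⟨⟨e1.1, e1.2⟩, e2.1, e2.2.trans_lt ?_⟩
  -- The momentum error in fact has mean at most `ε²`; strictness comes from `ε > 0`.
  nlinarith [sq_pos_of_pos hε]

end Run

end MinMaxBilevel

/-! ### The constants, and the guarantee under the explicit conditions. -/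

namespace MinMaxBilevel

open Filter Topology Set

namespace Consts

/-- The constants in the conditions on the step sizes and the number of iterations. -/
noncomputable def rateConsts (c : Consts) : RateConsts where
  C₁ := 10 * c.wα * (1 + 1 / c.μf ^ 2 + (1 + c.Cy) ^ 2)
  C₂ := 10 * c.wy
  C₃ := 10 * c.ws * (1 + c.κs + c.κi + c.Lcut ^ 2 / (c.Lgyy ^ 2 * (1 + c.Cy ^ 2)))
  C₄ := 10 * c.Vgrad
  LF := 2 * c.Lgrad

variable {c : Consts}

theorem Pos.rateConsts (hc : c.Pos) : c.rateConsts.Pos := by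
  have := hc.wα_pos; have := hc.wy_pos; have := hc.ws_pos; have := hc.Vgrad_pos
  have := hc.Lgrad_pos; have := hc.κs_pos; have := hc.κi_pos
  constructor <;> unfold Consts.rateConsts <;> dsimp only <;> positivity

/-- The three summands of `C₁` serve, in turn, the initial error, the noise, and the drift; the last
is needed because the condition on `η₀` mentions `C_α` only, whereas `α_i` has Lipschitz constant
`C_α (1 + C_y)`. -/
theorem Pos.wα_le (hc : c.Pos) : 10 * c.wα ≤ c.rateConsts.C₁ ∧
    10 * c.wα ≤ c.rateConsts.C₁ * c.μf ^ 2 ∧ 10 * c.wα * (1 + c.Cy) ^ 2 ≤ c.rateConsts.C₁ := by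
  have h1 := hc.wα_pos; have h2 := hc.μf
  have e0 : 0 ≤ 10 * c.wα * (1 / c.μf ^ 2) := by positivity
  have e1 : 0 ≤ 10 * c.wα * (1 + c.Cy) ^ 2 := by positivity
  have e2 : c.rateConsts.C₁ = 10 * c.wα + 10 * c.wα * (1 / c.μf ^ 2) +
    10 * c.wα * (1 + c.Cy) ^ 2 := by rw [Consts.rateConsts]; ring
  refine ⟨by linarith, ?_, by linarith⟩
  have e3 : 10 * c.wα = 10 * c.wα * (1 / c.μf ^ 2) * c.μf ^ 2 := by field_simp
  conv_lhs => rw [e3]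
  exact mul_le_mul_of_nonneg_right (by linarith) (sq_nonneg _)

/-- The summands of `C₃` serve the noise, the initial error in spectral norm, and the drift; the
quotient in it trades the constant `Lcut` of the residual for the `L_gyy √(1 + C_y²)` of the
condition on `η₀`. -/
theorem Pos.ws_le (hc : c.Pos) : 10 * c.ws * c.κs ≤ c.rateConsts.C₃ ∧
    10 * c.ws * c.κi ≤ c.rateConsts.C₃ ∧
    10 * c.ws * c.Lcut ^ 2 ≤ c.rateConsts.C₃ * (c.Lgyy ^ 2 * (1 + c.Cy ^ 2)) := by
  have h1 := hc.ws_pos; have h2 := hc.Lgyy; have h3 := hc.κs_pos; have h4 := hc.κi_pos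
  have hq : 0 < c.Lgyy ^ 2 * (1 + c.Cy ^ 2) := by positivity
  have e0 : 0 ≤ 10 * c.ws * c.κs := by positivity
  have e1 : 0 ≤ 10 * c.ws * c.κi := by positivity
  have e2 : 0 ≤ 10 * c.ws * (c.Lcut ^ 2 / (c.Lgyy ^ 2 * (1 + c.Cy ^ 2))) := by positivity
  have e3 : c.rateConsts.C₃ = 10 * c.ws + 10 * c.ws * c.κs + 10 * c.ws * c.κi +
    10 * c.ws * (c.Lcut ^ 2 / (c.Lgyy ^ 2 * (1 + c.Cy ^ 2))) := by rw [Consts.rateConsts]; ring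
  refine ⟨by linarith, by linarith, ?_⟩
  have e4 : 10 * c.ws * c.Lcut ^ 2 = 10 * c.ws * (c.Lcut ^ 2 / (c.Lgyy ^ 2 * (1 + c.Cy ^ 2))) *
    (c.Lgyy ^ 2 * (1 + c.Cy ^ 2)) := by field_simp
  rw [e4]
  exact mul_le_mul_of_nonneg_right (by linarith) hq.le

end Consts

theorem sq_mul_sq_le_of_le_div {x a d : ℝ} (hx : 0 ≤ x) (hd : 0 < d) (h : x ≤ a / d) :
    x ^ 2 * d ^ 2 ≤ a ^ 2 := by
  rw [← mul_pow]
  exact pow_le_pow_left₀ (by positivity) ((le_div_iff₀ hd).mp h) 2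

theorem two_mul_div_sq_mul_le {w L a x : ℝ} (ha : 0 < a) (h : 40 * (x ^ 2 * (w * L ^ 2)) ≤ a ^ 2) :
    x ^ 2 * (2 * w / a ^ 2 * L ^ 2) ≤ 1 / 20 := by
  have e : x ^ 2 * (2 * w / a ^ 2 * L ^ 2) = 2 * (x ^ 2 * (w * L ^ 2)) / a ^ 2 := by ring
  rw [e, div_le_iff₀ (by positivity)]
  linarith

/-- The conditions on the step sizes imply those that the analysis uses. -/
theorem Steps.Ok.good {k : Steps} {c : Consts} {m n b : ℕ} {ε : ℝ} (hc : c.Pos) (hn1 : 1 ≤ n)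
    (hn : n ≤ m) (hk : k.Ok c c.rateConsts m n b ε) : k.Good c m n := by
  have hn0 : (0 : ℝ) < n := by exact_mod_cast hn1
  have hm0 : (0 : ℝ) < m := by exact_mod_cast hn1.trans hn
  have hμf := hc.μf; have hμg := hc.μg; have hLf := hc.Lf; have hLg := hc.Lg
  have hL := hc.Lgrad_pos; have hLy := hc.Lgyy; have hCα := hc.Cα_pos; have hCy := hc.Cy_pos
  have hC := hc.rateConsts
  have hC1 := hC.C₁; have hC2 := hC.C₂; have hC3 := hC.C₃
  have h0 := hk.η₀_pos; have h1 := hk.η₁_pos; have h2 := hk.η₂_pos; have h3 := hk.β₀_pos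
  have h4 := hk.β₁_pos
  obtain ⟨⟨a1, a2⟩, a3, a4⟩ := by simpa only [le_min_iff] using hk.η₁_le
  obtain ⟨b1, b2, b3⟩ := by simpa only [le_min_iff] using hk.η₂_le
  obtain ⟨⟨c1, c2⟩, c3, c4, c5⟩ := by simpa only [le_min_iff] using hk.η₀_le
  have hLF : c.rateConsts.LF = 2 * c.Lgrad := rfl
  have hα : 0 < k.rateα c m n := by unfold Steps.rateα; positivity
  have hy : 0 < k.ratey c m n := by unfold Steps.ratey; positivity
  have hs : 0 < k.rates m n := by unfold Steps.rates; positivity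
  rw [hLF] at c1 c2
  refine ⟨h0, h1, h2, h3, h4, (le_min_iff.mp hk.β₀_le).1, (le_min_iff.mp hk.β₁_le).1, ?_, ?_, ?_,
    ?_, ?_, ?_, ?_⟩
  · rwa [le_div_iff₀ (by positivity)] at a1
  · rwa [le_div_iff₀ (by positivity)] at b1
  · rw [le_div_iff₀ (by positivity)] at a3
    rw [Steps.rateα, div_mul_eq_mul_div, div_le_one hm0]
    linarith
  · rw [le_div_iff₀ (by positivity)] at b2
    rw [Steps.ratey, div_mul_eq_mul_div, div_le_one hm0]
    linarith
  · rw [le_div_iff₀ (by positivity)] at c1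
    linarith
  · have e := sq_mul_sq_le_of_le_div h0.le (by positivity) c2
    rw [mul_pow, Real.sq_sqrt (by norm_num)] at e
    rw [div_le_iff₀ (by positivity)]
    nlinarith
  · have e1 := sq_mul_sq_le_of_le_div h0.le (by positivity) c3
    have e2 := sq_mul_sq_le_of_le_div h0.le (by positivity) c5
    have e3 := sq_mul_sq_le_of_le_div h0.le (by positivity) c4
    simp only [mul_pow, Real.sq_sqrt (show (0 : ℝ) ≤ 640 by norm_num),
      Real.sq_sqrt (show (0 : ℝ) ≤ 160 by norm_num), Real.sq_sqrt hC1.le, Real.sq_sqrt hC2.le,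
      Real.sq_sqrt hC3.le, Real.sq_sqrt (show 0 ≤ 1 + c.Cy ^ 2 by positivity)] at e1 e2 e3
    have r1 : k.η₁ ^ 2 * c.μf ^ 2 * n ^ 2 = 16 * (m : ℝ) ^ 2 * k.rateα c m n ^ 2 := by
      rw [Steps.rateα]; field_simp; norm_num
    have r2 : (n : ℝ) ^ 2 * k.η₂ ^ 2 * c.μg ^ 2 = 4 * (m : ℝ) ^ 2 * k.ratey c m n ^ 2 := by
      rw [Steps.ratey]; field_simp; norm_num
    have r3 : (n : ℝ) ^ 2 * k.β₁ ^ 2 = 4 * (m : ℝ) ^ 2 * k.rates m n ^ 2 := by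
      rw [Steps.rates]; field_simp; norm_num
    rw [r1] at e1
    rw [r2] at e2
    rw [r3] at e3
    -- Here `40 = 640/16`, the `16` coming from the quarter in `rateα`; below, the halves in the
    -- other two rates give `160/4` and `640/4`.
    have s1 : 40 * (k.η₀ ^ 2 * c.Cα ^ 2) * c.rateConsts.C₁ ≤ k.rateα c m n ^ 2 := by
      refine le_of_mul_le_mul_left ?_ (show 0 < 16 * (m : ℝ) ^ 2 by positivity)
      linarith
    have s2 : 40 * (k.η₀ ^ 2 * c.Cy ^ 2) * c.rateConsts.C₂ ≤ k.ratey c m n ^ 2 := by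
      refine le_of_mul_le_mul_left ?_ (show 0 < 4 * (m : ℝ) ^ 2 by positivity)
      linarith
    have s3 : 160 * k.η₀ ^ 2 * (c.rateConsts.C₃ * (c.Lgyy ^ 2 * (1 + c.Cy ^ 2))) ≤
        k.rates m n ^ 2 := by
      refine le_of_mul_le_mul_left ?_ (show 0 < 4 * (m : ℝ) ^ 2 by positivity)
      linarith
    have t1 := mul_le_mul_of_nonneg_left hc.wα_le.2.2
      (show 0 ≤ 40 * (k.η₀ ^ 2 * c.Cα ^ 2) by positivity)
    have t3 := mul_le_mul_of_nonneg_left hc.ws_le.2.2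
      (show 0 ≤ 160 * k.η₀ ^ 2 by positivity)
    have t2 : c.rateConsts.C₂ = 10 * c.wy := rfl
    rw [t2] at s2
    have u1 : 0 ≤ k.η₀ ^ 2 * c.Cα ^ 2 * (c.wα * (1 + c.Cy) ^ 2) := by
      have := hc.wα_pos; positivity
    have u2 : 0 ≤ k.η₀ ^ 2 * c.Cy ^ 2 * c.wy := by have := hc.wy_pos; positivity
    have u3 : 0 ≤ k.η₀ ^ 2 * (c.ws * c.Lcut ^ 2) := by have := hc.ws_pos; positivity
    -- Each of the three drifts costs at most `1/20`, well within the allowed `9/20`.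
    have v1 := two_mul_div_sq_mul_le (x := k.η₀) (w := c.wα) (L := c.Cα * (1 + c.Cy)) hα (by linarith)
    have v2 := two_mul_div_sq_mul_le (x := k.η₀) (w := c.wy) (L := c.Cy) hy (by linarith)
    have v3 := two_mul_div_sq_mul_le (x := k.η₀) (w := c.ws) (L := c.Lcut) hs (by linarith)
    linarith

/-- The noise of one iteration is small in comparison with the accuracy. -/
theorem Steps.Ok.noise_le {k : Steps} {c : Consts} {m n b : ℕ} {ε : ℝ} (hc : c.Pos)
    (hn1 : 1 ≤ n) (hb : 1 ≤ b) (hk : k.Ok c c.rateConsts m n b ε) :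
    k.noise c b + 2 * k.β₀ * (c.Vgrad / min (n : ℝ) (b : ℝ)) ≤ ε ^ 2 / 20 := by
  have hn0 : (0 : ℝ) < n := by exact_mod_cast hn1
  have hb0 : (0 : ℝ) < b := by exact_mod_cast hb
  have hμf := hc.μf; have hμg := hc.μg; have hσ := hc.σ
  have hw1 := hc.wα_pos; have hw2 := hc.wy_pos; have hw3 := hc.ws_pos; have hκ := hc.κs_pos
  have hV := hc.Vgrad_pos
  have hC := hc.rateConsts
  have hC1 := hC.C₁; have hC2 := hC.C₂; have hC3 := hC.C₃; have hC4 := hC.C₄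
  obtain ⟨-, -, a4⟩ := by simpa only [le_min_iff] using hk.η₁_le
  obtain ⟨-, -, b3⟩ := by simpa only [le_min_iff] using hk.η₂_le
  have c2 := (le_min_iff.mp hk.β₁_le).2
  have d2 := (le_min_iff.mp hk.β₀_le).2
  have hmin : 0 < min (n : ℝ) (b : ℝ) := lt_min hn0 hb0
  have t2 : c.rateConsts.C₂ = 10 * c.wy := rfl
  have t4 : c.rateConsts.C₄ = 10 * c.Vgrad := rfl
  have v1 : 8 * c.wα * k.η₁ / c.μf * (c.σ ^ 2 / b) ≤ ε ^ 2 / 120 := by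
    have e1 := mul_le_mul_of_nonneg_left a4 (show 0 ≤ 8 * c.wα / c.μf * (c.σ ^ 2 / b) by positivity)
    have e2 : 8 * c.wα / c.μf * (c.σ ^ 2 / b) *
        (b * ε ^ 2 / (96 * c.rateConsts.C₁ * c.μf * c.σ ^ 2)) =
        10 * c.wα * ε ^ 2 / (120 * (c.rateConsts.C₁ * c.μf ^ 2)) := by field_simp; ring
    have e3 : 10 * c.wα * ε ^ 2 / (120 * (c.rateConsts.C₁ * c.μf ^ 2)) ≤ ε ^ 2 / 120 := by
      rw [div_le_div_iff₀ (by positivity) (by positivity)]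
      nlinarith [mul_le_mul_of_nonneg_right hc.wα_le.2.1 (sq_nonneg ε)]
    have e4 : 8 * c.wα * k.η₁ / c.μf * (c.σ ^ 2 / b) =
        8 * c.wα / c.μf * (c.σ ^ 2 / b) * k.η₁ := by ring
    linarith
  have v2 : 4 * c.wy * k.η₂ / c.μg * (c.σ ^ 2 / b) ≤ ε ^ 2 / 120 := by
    have e1 := mul_le_mul_of_nonneg_left b3 (show 0 ≤ 4 * c.wy / c.μg * (c.σ ^ 2 / b) by positivity)
    have e2 : 4 * c.wy / c.μg * (c.σ ^ 2 / b) *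
        (c.μg * b * ε ^ 2 / (48 * (10 * c.wy) * c.σ ^ 2)) = ε ^ 2 / 120 := by field_simp; ring
    have e4 : 4 * c.wy * k.η₂ / c.μg * (c.σ ^ 2 / b) =
        4 * c.wy / c.μg * (c.σ ^ 2 / b) * k.η₂ := by ring
    rw [t2, e2] at e1
    linarith
  have v3 : 2 * c.ws * k.β₁ * c.κs * (c.σ ^ 2 / b) ≤ ε ^ 2 / 120 := by
    have e1 := mul_le_mul_of_nonneg_left c2
      (show 0 ≤ 2 * c.ws * c.κs * (c.σ ^ 2 / b) by positivity)
    have e2 : 2 * c.ws * c.κs * (c.σ ^ 2 / b) *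
        (b * ε ^ 2 / (96 * c.rateConsts.C₃ * c.σ ^ 2)) =
        10 * c.ws * c.κs * ε ^ 2 / (480 * c.rateConsts.C₃) := by field_simp; ring
    have e3 : 10 * c.ws * c.κs * ε ^ 2 / (480 * c.rateConsts.C₃) ≤ ε ^ 2 / 120 := by
      rw [div_le_div_iff₀ (by positivity) (by positivity)]
      nlinarith [mul_le_mul_of_nonneg_right hc.ws_le.1 (sq_nonneg ε),
        mul_nonneg hC3.le (sq_nonneg ε)]
    have e4 : 2 * c.ws * k.β₁ * c.κs * (c.σ ^ 2 / b) =
        2 * c.ws * c.κs * (c.σ ^ 2 / b) * k.β₁ := by ring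
    linarith
  have v4 : 2 * k.β₀ * (c.Vgrad / min (n : ℝ) (b : ℝ)) ≤ ε ^ 2 / 60 := by
    have e1 := mul_le_mul_of_nonneg_left d2
      (show 0 ≤ 2 * (c.Vgrad / min (n : ℝ) (b : ℝ)) by positivity)
    have e2 : 2 * (c.Vgrad / min (n : ℝ) (b : ℝ)) *
        (min (n : ℝ) (b : ℝ) * ε ^ 2 / (12 * (10 * c.Vgrad))) = ε ^ 2 / 60 := by
      field_simp; ring
    rw [t4, e2] at e1
    linarith
  rw [Steps.noise]
  -- The four shares add up to `3/120 + 1/60 = 1/24 < 1/20`.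
  have := sq_nonneg ε
  linarith

section Main

variable {m dx dα dy b n T : ℕ} {Ξ Z Ω : Type*} [MeasurableSpace Ξ] [MeasurableSpace Z]
  [MeasurableSpace Ω]
variable {p : Problem m dx dα dy} {c : Consts} {o : Oracles m dx dα dy b Ξ Z}
variable {μ : Measure Ω} {w : ℕ → Ω → Draw m b Ξ Z} {τ : Ω → ℕ}

/-- The inner errors of the initial state. -/
theorem sum_innerErr_le (hc : c.Pos) (h : p.Regular c) {k : Steps} (hk : k.Good c m n)
    (hn1 : 1 ≤ n) (hn : n ≤ m) (u : State m dx dα dy) :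
    (1 / (m : ℝ)) * ∑ i, innerErr p c k n i u ≤
      4 * c.wα / (n * k.η₁ * c.μf) * errα p u + 2 * c.wy / (n * k.η₂ * c.μg) * erry p u +
        2 * (c.ws * c.κi) / (n * k.β₁) * errgyy p u := by
  have hn0 : (0 : ℝ) < n := by exact_mod_cast hn1
  have hm0 : (0 : ℝ) < m := by exact_mod_cast hn1.trans hn
  have hs := hk.rates_pos (c := c) hn1 hn
  have hw := hc.ws_pos
  have h1 := hk.η₁_pos; have h2 := hk.η₂_pos; have h3 := hk.β₁_pos
  have hμf := hc.μf; have hμg := hc.μg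
  have e1 : ∑ i, innerErr p c k n i u ≤ c.wα / k.rateα c m n * errα p u +
      c.wy / k.ratey c m n * erry p u + c.ws / k.rates m n * (c.κi * errgyy p u) := by
    rw [errα, erry, errgyy, Finset.mul_sum, Finset.mul_sum, Finset.mul_sum, Finset.mul_sum,
      ← Finset.sum_add_distrib, ← Finset.sum_add_distrib]
    refine Finset.sum_le_sum fun i _ => add_le_add_right ?_ _
    exact mul_le_mul_of_nonneg_left (hessErr_le hc h i u) (by positivity)
  refine (mul_le_mul_of_nonneg_left e1 (by positivity)).trans (le_of_eq ?_)
  rw [Steps.rateα, Steps.ratey, Steps.rates]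
  field_simp

/-- The guarantee under the explicit conditions. -/
theorem IsSampling.guarantee (hs : IsSampling μ o n T w τ) (hc : c.Pos) (h : p.Regular c)
    (hv : o.Valid p c) (hn1 : 1 ≤ n) (hn : n ≤ m) (hb : 1 ≤ b) {k : Steps} {ε ΔF : ℝ}
    {u₀ : State m dx dα dy} (hu : u₀.Adm p.A c) (hε : 0 < ε) (hF : ∀ x, p.F u₀.x - p.F x ≤ ΔF)
    (hk : k.Ok c c.rateConsts m n b ε)
    (hT : iterBound k c c.rateConsts n ε ΔF (errz μ p o k u₀ w) (errα p u₀) (erry p u₀)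
      (errgyy p u₀) ≤ T) : Guarantee μ p o k u₀ w τ ε := by
  have hg := hk.good hc hn1 hn
  -- The gap hypothesis is read as a lower bound of `F`; the objective part of the initial potential
  -- is then exactly `2 ΔF / η₀`.
  refine hs.guarantee_of hc h hv hn1 hn hb hg hu (B := p.F u₀.x - ΔF)
    (fun x => by linarith [hF x]) hε ?_
  have hn0 : (0 : ℝ) < n := by exact_mod_cast hn1
  have h0 := hk.η₀_pos; have h1 := hk.η₁_pos; have h2 := hk.η₂_pos; have h3 := hk.β₀_pos
  have h4 := hk.β₁_pos
  have hμf := hc.μf; have hμg := hc.μg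
  have hw1 := hc.wα_pos; have hw2 := hc.wy_pos; have hw3 := hc.ws_pos
  have hsum := sum_innerErr_le hc h hg hn1 hn u₀
  have hnoise := hk.noise_le hc hn1 hb
  simp only [iterBound, max_le_iff] at hT
  obtain ⟨⟨i1, i2⟩, i3, i4, i5⟩ := hT
  rw [div_le_iff₀ (by positivity)] at i1 i2 i3 i4 i5
  have hα0 : 0 ≤ errα p u₀ := Finset.sum_nonneg fun i _ => sq_nonneg _
  have hg0 : 0 ≤ errgyy p u₀ := Finset.sum_nonneg fun i _ => sq_nonneg _
  have hTε : 0 ≤ T * ε ^ 2 := by positivity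
  -- Each term of the bound on `T` gives one share of `T ε²`: four of `1/15` and one of `2/15`. With
  -- the noise share `(T + 1) ε² / 20` the total stays below `(T + 1) ε²`.
  have v1 : 2 / k.η₀ * ΔF ≤ T * ε ^ 2 / 15 := by
    rw [div_mul_eq_mul_div, div_le_iff₀ h0]
    linarith
  have v2 : 2 / k.β₀ * errz μ p o k u₀ w ≤ 2 * (T * ε ^ 2) / 15 := by
    rw [div_mul_eq_mul_div, div_le_iff₀ h3]
    linarith
  have v3 : 4 * c.wα / (n * k.η₁ * c.μf) * errα p u₀ ≤ T * ε ^ 2 / 15 := by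
    have : 0 ≤ T * (n * k.η₁ * c.μf * ε ^ 2) := by positivity
    rw [div_mul_eq_mul_div, div_le_iff₀ (by positivity)]
    linarith [mul_le_mul_of_nonneg_right hc.wα_le.1 hα0]
  have v4 : 2 * c.wy / (n * k.η₂ * c.μg) * erry p u₀ ≤ T * ε ^ 2 / 15 := by
    have t2 : c.rateConsts.C₂ = 10 * c.wy := rfl
    rw [t2] at i4
    have : 0 ≤ T * (n * k.η₂ * c.μg * ε ^ 2) := by positivity
    rw [div_mul_eq_mul_div, div_le_iff₀ (by positivity)]
    linarith
  have v5 : 2 * (c.ws * c.κi) / (n * k.β₁) * errgyy p u₀ ≤ T * ε ^ 2 / 15 := by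
    have : 0 ≤ T * (n * k.β₁ * ε ^ 2) := by positivity
    rw [div_mul_eq_mul_div, div_le_iff₀ (by positivity)]
    linarith [mul_le_mul_of_nonneg_right hc.ws_le.2.1 hg0]
  have v6 := mul_le_mul_of_nonneg_left hnoise (show 0 ≤ (T : ℝ) + 1 by positivity)
  have hε2 := sq_nonneg ε
  rw [potential, sub_sub_cancel]
  linarith

end Main

end MinMaxBilevel

/-! ### Orders of the step sizes, of the iterations and of the samples. -/

namespace MinMaxBilevel

open Filter Topology Set

/-- The two candidates for the minimum in `η₀` correspond to the two terms of `rate`. -/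
theorem inv_min_mul_le_rate {m n b : ℕ} {ε : ℝ} (hn1 : 1 ≤ n) (hn : n ≤ m) (hb : 1 ≤ b)
    (hε : 0 < ε) :
    1 / (min (min (n : ℝ) (b : ℝ) * ε ^ 2) (n * b * ε ^ 2 / m) * ε ^ 2) ≤ rate m n b ε := by
  have hn0 : (0 : ℝ) < n := by exact_mod_cast hn1
  have hm0 : (0 : ℝ) < m := by exact_mod_cast hn1.trans hn
  have hb0 : (0 : ℝ) < b := by exact_mod_cast hb
  have hmin : 0 < min (n : ℝ) (b : ℝ) := lt_min hn0 hb0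
  rw [rate]
  rcases min_choice (min (n : ℝ) (b : ℝ) * ε ^ 2) (n * b * ε ^ 2 / m) with e | e
  · rw [e]
    refine le_max_of_le_right (le_of_eq ?_)
    ring
  · rw [e]
    refine le_max_of_le_left (le_of_eq ?_)
    field_simp

theorem div_mul_le_mul_rate {m n b : ℕ} {ε K q d : ℝ} (hK : 0 ≤ K) (hd : 0 < d)
    (hq : 1 / q ≤ rate m n b ε) : K / (d * q) ≤ K / d * rate m n b ε := by
  rw [show K / (d * q) = K / d * (1 / q) by rw [div_mul_div_comm, mul_one]]
  exact mul_le_mul_of_nonneg_left hq (by positivity)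

set_option maxHeartbeats 1000000 in
/-- Step sizes of the stated orders satisfy the conditions, once the factors are small. -/
theorem StepFactors.exists_ok {c : Consts} (hc : c.Pos) {D : ℝ} (hD : 0 < D) :
    ∃ a : StepFactors, ∀ (m n b : ℕ) (ε : ℝ), 1 ≤ n → n ≤ m → 1 ≤ b → 0 < ε → b * ε ^ 2 ≤ D →
      (a.steps m n b ε).Ok c c.rateConsts m n b ε := by
  have hμf := hc.μf; have hμg := hc.μg; have hLf := hc.Lf; have hLg := hc.Lg; have hσ := hc.σ
  have hLy := hc.Lgyy; have hCα := hc.Cα_pos; have hCy := hc.Cy_pos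
  have hC1 := hc.rateConsts.C₁; have hC2 := hc.rateConsts.C₂; have hC3 := hc.rateConsts.C₃
  have hC4 := hc.rateConsts.C₄; have hLF := hc.rateConsts.LF
  set C := c.rateConsts
  -- Bounds that do not scale with `ε` are met through `b ε² ≤ D`, hence the products with `D`;
  -- bounds proportional to `b ε²` are met by the factor itself.
  obtain ⟨a₁, ha1, ha1', ha1'', ha1'''⟩ : ∃ a₁, 0 < a₁ ∧ a₁ * D ≤ c.μf / c.Lf ^ 2 ∧
      a₁ * D ≤ 1 / c.μf ∧ a₁ ≤ 1 / (96 * C.C₁ * c.μf * c.σ ^ 2) := by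
    refine ⟨min (min (c.μf / c.Lf ^ 2 / D) (1 / c.μf / D)) (1 / (96 * C.C₁ * c.μf * c.σ ^ 2)),
      by positivity, ?_, ?_, min_le_right _ _⟩
    · rw [← le_div_iff₀ hD]; exact (min_le_left _ _).trans (min_le_left _ _)
    · rw [← le_div_iff₀ hD]; exact (min_le_left _ _).trans (min_le_right _ _)
  obtain ⟨a₂, ha2, ha2', ha2'', ha2'''⟩ : ∃ a₂, 0 < a₂ ∧ a₂ * D ≤ c.μg / c.Lg ^ 2 ∧
      a₂ * D ≤ 2 / c.μg ∧ a₂ ≤ c.μg / (48 * C.C₂ * c.σ ^ 2) := by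
    refine ⟨min (min (c.μg / c.Lg ^ 2 / D) (2 / c.μg / D)) (c.μg / (48 * C.C₂ * c.σ ^ 2)),
      by positivity, ?_, ?_, min_le_right _ _⟩
    · rw [← le_div_iff₀ hD]; exact (min_le_left _ _).trans (min_le_left _ _)
    · rw [← le_div_iff₀ hD]; exact (min_le_left _ _).trans (min_le_right _ _)
  obtain ⟨b₁, hb1, hb1', hb1''⟩ : ∃ b₁, 0 < b₁ ∧ b₁ * D ≤ 1 ∧
      b₁ ≤ 1 / (96 * C.C₃ * c.σ ^ 2) := by
    refine ⟨min (1 / D) (1 / (96 * C.C₃ * c.σ ^ 2)), by positivity, ?_, min_le_right _ _⟩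
    rw [← le_div_iff₀ hD]; exact min_le_left _ _
  obtain ⟨b₀, hb0, hb0', hb0''⟩ : ∃ b₀, 0 < b₀ ∧ b₀ * D ≤ 1 ∧ b₀ ≤ 1 / (12 * C.C₄) := by
    refine ⟨min (1 / D) (1 / (12 * C.C₄)), by positivity, ?_, min_le_right _ _⟩
    rw [← le_div_iff₀ hD]; exact min_le_left _ _
  -- Chosen last, since the bounds on `η₀` involve the other step sizes. The `min` in `η₀` supplies
  -- the scaling: its first entry matches `β₀`, its second `n/m` times the other three.
  obtain ⟨a₀, ha0, g1, g2, g3, g4, g5⟩ : ∃ a₀, 0 < a₀ ∧ a₀ * D ≤ 1 / (2 * C.LF) ∧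
      a₀ ≤ b₀ / (√80 * C.LF) ∧ a₀ ≤ a₁ * c.μf / (√640 * √C.C₁ * c.Cα) ∧
      a₀ ≤ b₁ / (√640 * √C.C₃ * c.Lgyy * √(1 + c.Cy ^ 2)) ∧
      a₀ ≤ a₂ * c.μg / (√160 * √C.C₂ * c.Cy) := by
    refine ⟨min (1 / (2 * C.LF) / D) (min (b₀ / (√80 * C.LF)) (min
      (a₁ * c.μf / (√640 * √C.C₁ * c.Cα)) (min (b₁ / (√640 * √C.C₃ * c.Lgyy * √(1 + c.Cy ^ 2)))
        (a₂ * c.μg / (√160 * √C.C₂ * c.Cy))))), by positivity, ?_, ?_, ?_, ?_, ?_⟩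
    · rw [← le_div_iff₀ hD]; exact min_le_left _ _
    · exact (min_le_right _ _).trans (min_le_left _ _)
    · exact (min_le_right _ _).trans ((min_le_right _ _).trans (min_le_left _ _))
    · exact (min_le_right _ _).trans ((min_le_right _ _).trans
        ((min_le_right _ _).trans (min_le_left _ _)))
    · exact (min_le_right _ _).trans ((min_le_right _ _).trans
        ((min_le_right _ _).trans (min_le_right _ _)))
  refine ⟨⟨a₀, a₁, a₂, b₀, b₁, ha0, ha1, ha2, hb0, hb1⟩, fun m n b ε hn1 hn hb hε hbD => ?_⟩
  have hn0 : (0 : ℝ) < n := by exact_mod_cast hn1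
  have hm0 : (0 : ℝ) < m := by exact_mod_cast hn1.trans hn
  have hbp : (0 : ℝ) < b := by exact_mod_cast hb
  have hnm : (n : ℝ) ≤ m := by exact_mod_cast hn
  have hmin : 0 < min (n : ℝ) (b : ℝ) := lt_min hn0 hbp
  set X := (b : ℝ) * ε ^ 2 with hX
  have hX0 : 0 < X := by positivity
  set Y := min (n : ℝ) (b : ℝ) * ε ^ 2 with hY
  have hY0 : 0 < Y := by positivity
  have hYX : Y ≤ X := mul_le_mul_of_nonneg_right (min_le_right _ _) (sq_nonneg ε)
  have hnX : (n : ℝ) * b * ε ^ 2 / m = n * X / m := by rw [hX]; ring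
  set M := min Y (n * X / m) with hM
  have hM0 : 0 < M := by positivity
  have hMX : M ≤ n * X / m := min_le_right _ _
  have hsteps : (StepFactors.mk a₀ a₁ a₂ b₀ b₁ ha0 ha1 ha2 hb0 hb1).steps m n b ε =
      ⟨a₀ * M, a₁ * X, a₂ * X, b₀ * Y, b₁ * X⟩ := by
    rw [StepFactors.steps, hnX]
  rw [hsteps]
  refine ⟨by dsimp only; positivity, by dsimp only; positivity, by dsimp only; positivity,
    by dsimp only; positivity, by dsimp only; positivity, ?_, ?_, ?_, ?_, ?_⟩ <;>
    simp only [le_min_iff]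
  · refine ⟨⟨(mul_le_mul_of_nonneg_left hbD ha1.le).trans ha1',
      (mul_le_mul_of_nonneg_left hbD ha1.le).trans ha1''⟩,
      ((mul_le_mul_of_nonneg_left hbD ha1.le).trans ha1'').trans ?_, ?_⟩
    -- The bound `4m / (μ_f n)` follows from `1 / μ_f`, because `n ≤ m`.
    · rw [div_le_div_iff₀ hμf (by positivity)]
      linarith [mul_le_mul_of_nonneg_left hnm hμf.le, mul_pos hm0 hμf]
    · refine (mul_le_mul_of_nonneg_right ha1''' hX0.le).trans (le_of_eq ?_)
      rw [one_div_mul_eq_div]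
  · refine ⟨(mul_le_mul_of_nonneg_left hbD ha2.le).trans ha2',
      ((mul_le_mul_of_nonneg_left hbD ha2.le).trans ha2'').trans ?_, ?_⟩
    · rw [div_le_div_iff₀ hμg (by positivity)]
      linarith [mul_le_mul_of_nonneg_left hnm hμg.le]
    · refine (mul_le_mul_of_nonneg_right ha2''' hX0.le).trans (le_of_eq ?_)
      rw [hX]; ring
  · refine ⟨(mul_le_mul_of_nonneg_left hbD hb1.le).trans hb1', ?_⟩
    refine (mul_le_mul_of_nonneg_right hb1'' hX0.le).trans (le_of_eq ?_)
    rw [one_div_mul_eq_div]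
  · refine ⟨(mul_le_mul_of_nonneg_left (hYX.trans hbD) hb0.le).trans hb0', ?_⟩
    refine (mul_le_mul_of_nonneg_right hb0'' hY0.le).trans (le_of_eq ?_)
    rw [one_div_mul_eq_div]
  · refine ⟨⟨(mul_le_mul_of_nonneg_left (((min_le_left _ _).trans hYX).trans hbD) ha0.le).trans g1,
      ?_⟩, ?_, ?_, ?_⟩
    · refine (mul_le_mul g2 (min_le_left _ _) hM0.le (by positivity)).trans (le_of_eq ?_)
      ring
    · refine (mul_le_mul g3 hMX hM0.le (by positivity)).trans (le_of_eq ?_)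
      field_simp
    · refine (mul_le_mul g4 hMX hM0.le (by positivity)).trans (le_of_eq ?_)
      field_simp
    · refine (mul_le_mul g5 hMX hM0.le (by positivity)).trans (le_of_eq ?_)
      field_simp

/-- A bound for the initial momentum error, when the initial errors are at most `D`. -/
noncomputable def Consts.Dz (c : Consts) (D : ℝ) : ℝ :=
  2 * c.Bhyp ^ 2 + 2 * D + D + 2 * (2 * c.Kin * D + c.Kh * c.κi * D) + c.Vgrad

section Orders

variable {m dx dα dy b n T : ℕ} {Ξ Z Ω : Type*} [MeasurableSpace Ξ] [MeasurableSpace Z]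
  [MeasurableSpace Ω]
variable {p : Problem m dx dα dy} {c : Consts} {o : Oracles m dx dα dy b Ξ Z}
variable {μ : Measure Ω} {w : ℕ → Ω → Draw m b Ξ Z} {τ : Ω → ℕ}

/-- The momentum recursion applied to the initial state, which has no predecessor: `x₀ + η₀ z₀` acts
as a fictitious previous point. -/
theorem IsSampling.errz_le (hs : IsSampling μ o n T w τ) (hc : c.Pos) (h : p.Regular c)
    (hv : o.Valid p c) (hn1 : 1 ≤ n) (hn : n ≤ m) (hb : 1 ≤ b) {k : Steps} (hk : k.Good c m n)
    {u₀ : State m dx dα dy} (hu : u₀.Adm p.A c) {D : ℝ} (hz : ‖u₀.z‖ ^ 2 ≤ D)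
    (hα : errα p u₀ ≤ m * D) (hy : erry p u₀ ≤ m * D) (hg : errgyy p u₀ ≤ m * D) :
    errz μ p o k u₀ w ≤ c.Dz D := by
  have hm1 := hn1.trans hn
  have hm0 : (0 : ℝ) < m := by exact_mod_cast hm1
  have hβ0 := hk.β₀_pos
  have hβ1 := hk.β₀_le
  have hK := hc.Kin_pos; have hKh := hc.Kh_pos; have hκ := hc.κi_pos; have hV := hc.Vgrad_pos
  have hL := hc.Lgrad_pos
  have hD0 : 0 ≤ D := (sq_nonneg _).trans hz
  have hmin : 1 ≤ min (n : ℝ) (b : ℝ) := le_min (by exact_mod_cast hn1) (by exact_mod_cast hb)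
  rw [hs.errz_eq hc h hv hm1 k u₀]
  refine (ebound_gradErr hc h hv hn1 hn hb hk hu).2.trans ?_
  have e1 : gradErr p k u₀ ≤ 2 * c.Bhyp ^ 2 + 2 * D := by
    have f1 := norm_sub_le (gradient p.F (u₀.x + k.η₀ • u₀.z)) u₀.z
    have f2 := pow_le_pow_left₀ (norm_nonneg _) (h.norm_gradient_F_le hc hm1
      (u₀.x + k.η₀ • u₀.z)) 2
    have f3 := pow_le_pow_left₀ (norm_nonneg _) f1 2
    have f4 := sq_nonneg (‖gradient p.F (u₀.x + k.η₀ • u₀.z)‖ - ‖u₀.z‖)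
    rw [gradErr]
    linarith
  -- The momentum condition is stated with `β₀²`, and `β₀² ≤ β₀`.
  have e2 : 2 * c.Lgrad ^ 2 * k.η₀ ^ 2 / k.β₀ * ‖u₀.z‖ ^ 2 ≤ D := by
    have f1 : 2 * c.Lgrad ^ 2 * k.η₀ ^ 2 / k.β₀ ≤ 1 := by
      have f2 := hk.momentum
      rw [div_le_iff₀ (by positivity)] at f2 ⊢
      have : k.β₀ ^ 2 ≤ k.β₀ := by nlinarith
      linarith
    have f3 := mul_le_mul f1 hz (sq_nonneg _) zero_le_one
    linarith
  have e3 : (1 / (m : ℝ)) * ∑ i, biasBound p c i u₀ ≤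
      2 * c.Kin * D + c.Kh * c.κi * D := by
    have f1 : ∑ i, biasBound p c i u₀ ≤ c.Kin * errα p u₀ + c.Kin * erry p u₀ +
        c.Kh * (c.κi * errgyy p u₀) := by
      rw [errα, erry, errgyy, Finset.mul_sum, Finset.mul_sum, Finset.mul_sum, Finset.mul_sum,
        ← Finset.sum_add_distrib, ← Finset.sum_add_distrib]
      exact Finset.sum_le_sum fun i _ => add_le_add_right
        (mul_le_mul_of_nonneg_left (hessErr_le hc h i u₀) hKh.le) _
    have f2 := mul_le_mul_of_nonneg_left hα hK.le
    have f3 := mul_le_mul_of_nonneg_left hy hK.le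
    have f4 := mul_le_mul_of_nonneg_left hg (mul_pos hKh hκ).le
    rw [one_div, inv_mul_le_iff₀ hm0]
    linarith
  have e3' : 0 ≤ (1 / (m : ℝ)) * ∑ i, biasBound p c i u₀ :=
    mul_nonneg (by positivity) (Finset.sum_nonneg fun i _ => biasBound_nonneg hc i u₀)
  have e4 : c.Vgrad / min (n : ℝ) (b : ℝ) ≤ c.Vgrad := div_le_self hV.le hmin
  have e5 : k.β₀ ^ 2 * (c.Vgrad / min (n : ℝ) (b : ℝ)) ≤ 1 * c.Vgrad :=
    mul_le_mul (pow_le_one₀ hβ0.le hβ1) e4 (by positivity) zero_le_one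
  have e6 : (1 - k.β₀) * gradErr p k u₀ ≤ 1 * (2 * c.Bhyp ^ 2 + 2 * D) :=
    mul_le_mul (by linarith) e1 (sq_nonneg _) zero_le_one
  have e7 := mul_le_mul_of_nonneg_right hβ1 e3'
  rw [Consts.Dz]
  linarith

theorem IsSampling.samplesUsed_ae (hs : IsSampling μ o n T w τ) (hv : o.Valid p c)
    (S : ℕ) : ∀ᵐ ω ∂μ, samplesUsed (fun t => w t ω) S = (S + 1) * (n * (b + b)) := by
  have hcard : ∀ t, ∀ᵐ ω ∂μ, (w t ω).1.card = n := by
    intro t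
    have := hv.prob_batches
    have h1 : ∀ᵐ v ∂(μ.map (w t)), v.1.card = n := by
      rw [hs.w_law t, Oracles.drawLaw]
      exact Measure.quasiMeasurePreserving_fst.ae (ae_card_blocks n)
    exact ae_of_ae_map (hs.w_meas t).aemeasurable h1
  filter_upwards [ae_all_iff.mpr hcard] with ω hω
  simp [samplesUsed, hω]

/-- From `n b = min {n, b} · max {n, b}`: the two terms of `rate` become `m / ε⁴` and `max {n, b} /
ε⁴`. -/
theorem mul_rate_le {m n b : ℕ} {ε : ℝ} (hn1 : 1 ≤ n) (hn : n ≤ m) (hb : 1 ≤ b) (hε : 0 < ε) :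
    n * b * rate m n b ε ≤ max (m : ℝ) (b : ℝ) / ε ^ 4 := by
  have hn0 : (0 : ℝ) < n := by exact_mod_cast hn1
  have hb0 : (0 : ℝ) < b := by exact_mod_cast hb
  have hnm : (n : ℝ) ≤ m := by exact_mod_cast hn
  have hmin : 0 < min (n : ℝ) (b : ℝ) := lt_min hn0 hb0
  have e1 : (n : ℝ) * b = min (n : ℝ) (b : ℝ) * max (n : ℝ) (b : ℝ) := (min_mul_max _ _).symm
  rw [rate, mul_max_of_nonneg _ _ (by positivity), max_le_iff]
  constructor
  · rw [show (n : ℝ) * b * (m / (n * b * ε ^ 4)) = m / ε ^ 4 by field_simp]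
    exact div_le_div_of_nonneg_right (le_max_left _ _) (by positivity)
  · rw [e1, show min (n : ℝ) (b : ℝ) * max (n : ℝ) (b : ℝ) * (1 / (min (n : ℝ) (b : ℝ) * ε ^ 4)) =
      max (n : ℝ) (b : ℝ) / ε ^ 4 by field_simp]
    exact div_le_div_of_nonneg_right (max_le_max hnm le_rfl) (by positivity)

/-- Rounding up and counting iteration `0` cost at most two further iterations, that is `4 n b`
samples; these have the right order because `(b ε²)² ≤ D²`. -/
theorem samples_le {m n b : ℕ} {ε D K : ℝ} (hn1 : 1 ≤ n) (hn : n ≤ m) (hb : 1 ≤ b) (hε : 0 < ε)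
    (hbD : b * ε ^ 2 ≤ D) (hK : 0 < K) :
    (((⌈K * rate m n b ε⌉₊ + 1) * (n * (b + b)) : ℕ) : ℝ) ≤
      (2 * K + 4 * D ^ 2) * max (m : ℝ) (b : ℝ) / ε ^ 4 := by
  have hn0 : (0 : ℝ) < n := by exact_mod_cast hn1
  have hb0 : (0 : ℝ) < b := by exact_mod_cast hb
  have hb1 : (1 : ℝ) ≤ b := by exact_mod_cast hb
  have hnm : (n : ℝ) ≤ m := by exact_mod_cast hn
  have hR : 0 ≤ rate m n b ε := le_max_of_le_left (by positivity)
  have e1 : (⌈K * rate m n b ε⌉₊ : ℝ) ≤ K * rate m n b ε + 1 :=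
    (Nat.ceil_lt_add_one (by positivity)).le
  have e2 : (n : ℝ) * b ≤ D ^ 2 * max (m : ℝ) (b : ℝ) / ε ^ 4 := by
    rw [le_div_iff₀ (by positivity)]
    have f1 : ((b : ℝ) * ε ^ 2) ^ 2 ≤ D ^ 2 := pow_le_pow_left₀ (by positivity) hbD 2
    calc (n : ℝ) * b * ε ^ 4 ≤ (n : ℝ) * b * ε ^ 4 * b := le_mul_of_one_le_right (by positivity) hb1
      _ = (b * ε ^ 2) ^ 2 * n := by ring
      _ ≤ D ^ 2 * max (m : ℝ) (b : ℝ) :=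
        mul_le_mul f1 (hnm.trans (le_max_left _ _)) hn0.le (sq_nonneg _)
  have e3 := mul_le_mul_of_nonneg_left (mul_rate_le hn1 hn hb hε) hK.le
  push_cast
  calc ((⌈K * rate m n b ε⌉₊ : ℝ) + 1) * (n * (b + b)) ≤
      (K * rate m n b ε + 1 + 1) * (n * (b + b)) :=
        mul_le_mul_of_nonneg_right (by linarith) (by positivity)
    _ = 2 * (K * (n * b * rate m n b ε)) + 4 * (n * b) := by ring
    _ ≤ 2 * (K * (max (m : ℝ) (b : ℝ) / ε ^ 4)) + 4 * (D ^ 2 * max (m : ℝ) (b : ℝ) / ε ^ 4) := by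
      linarith
    _ = _ := by ring

/-- The factor of `rate` in a sufficient number of iterations. -/
noncomputable def StepFactors.iterFactor (a : StepFactors) (c : Consts) (D : ℝ) : ℝ :=
  30 * D / a.a₀ + 15 * c.Dz D / a.b₀ + 60 * c.rateConsts.C₁ * D / (c.μf * a.a₁) +
    30 * c.rateConsts.C₂ * D / (c.μg * a.a₂) + 60 * c.rateConsts.C₃ * D / a.b₁

theorem Consts.Pos.Dz_pos (hc : c.Pos) {D : ℝ} (hD : 0 < D) : 0 < c.Dz D := by
  have := hc.Kin_pos; have := hc.Kh_pos; have := hc.κi_pos; have := hc.Vgrad_pos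
  unfold Consts.Dz; positivity

theorem StepFactors.iterFactor_pos (a : StepFactors) (hc : c.Pos) {D : ℝ} (hD : 0 < D) :
    0 < a.iterFactor c D := by
  have := hc.Dz_pos hD; have := hc.rateConsts.C₁; have := hc.rateConsts.C₂
  have := hc.rateConsts.C₃; have := hc.μf; have := hc.μg
  have := a.a₀_pos; have := a.a₁_pos; have := a.a₂_pos; have := a.b₀_pos; have := a.b₁_pos
  unfold StepFactors.iterFactor; positivity

/-- Every denominator in `iterBound` has order `n b ε⁴ / m`, `min {n, b} ε⁴`, or their minimum; the
factor `m` in the first comes from the initial errors being sums over the blocks. `iterFactor` adds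
up the five coefficients to dominate the maximum. -/
theorem iterBound_le (hc : c.Pos) (a : StepFactors) {D ε dz dα dy dg : ℝ} (hD : 0 < D)
    (hn1 : 1 ≤ n) (hn : n ≤ m) (hb : 1 ≤ b) (hε : 0 < ε) (hz : dz ≤ c.Dz D) (hα : dα ≤ m * D)
    (hy : dy ≤ m * D) (hg : dg ≤ m * D) :
    iterBound (a.steps m n b ε) c c.rateConsts n ε D dz dα dy dg ≤
      a.iterFactor c D * rate m n b ε := by
  have hDz := hc.Dz_pos hD
  have hC1 := hc.rateConsts.C₁; have hC2 := hc.rateConsts.C₂; have hC3 := hc.rateConsts.C₃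
  have hμf := hc.μf; have hμg := hc.μg
  have ha0 := a.a₀_pos; have ha1 := a.a₁_pos; have ha2 := a.a₂_pos; have hb0 := a.b₀_pos
  have hb1 := a.b₁_pos
  have hn0 : (0 : ℝ) < n := by exact_mod_cast hn1
  have hm0 : (0 : ℝ) < m := by exact_mod_cast hn1.trans hn
  have hbp : (0 : ℝ) < b := by exact_mod_cast hb
  have hmin : 0 < min (n : ℝ) (b : ℝ) := lt_min hn0 hbp
  have hR : 0 ≤ rate m n b ε := le_max_of_le_left (by positivity)
  have r1 := inv_min_mul_le_rate hn1 hn hb hε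
  have r2 : 1 / (min (n : ℝ) (b : ℝ) * ε ^ 2 * ε ^ 2) ≤ rate m n b ε :=
    le_max_of_le_right (le_of_eq (by ring))
  have r3 : 1 / (n * b * ε ^ 4 / m) ≤ rate m n b ε :=
    le_max_of_le_left (le_of_eq (one_div_div _ _))
  set R := rate m n b ε
  set M := min (min (n : ℝ) (b : ℝ) * ε ^ 2) (n * b * ε ^ 2 / m) with hM
  have hM0 : 0 < M := by positivity
  have s1 : 0 ≤ 30 * D / a.a₀ * R := by positivity
  have s2 : 0 ≤ 15 * c.Dz D / a.b₀ * R := by positivity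
  have s3 : 0 ≤ 60 * c.rateConsts.C₁ * D / (c.μf * a.a₁) * R := by positivity
  have s4 : 0 ≤ 30 * c.rateConsts.C₂ * D / (c.μg * a.a₂) * R := by positivity
  have s5 : 0 ≤ 60 * c.rateConsts.C₃ * D / a.b₁ * R := by positivity
  have hsum : a.iterFactor c D * R = 30 * D / a.a₀ * R + 15 * c.Dz D / a.b₀ * R +
      60 * c.rateConsts.C₁ * D / (c.μf * a.a₁) * R +
      30 * c.rateConsts.C₂ * D / (c.μg * a.a₂) * R + 60 * c.rateConsts.C₃ * D / a.b₁ * R := by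
    rw [StepFactors.iterFactor]; ring
  rw [hsum]
  simp only [iterBound, max_le_iff, StepFactors.steps]
  refine ⟨⟨?_, ?_⟩, ?_, ?_, ?_⟩
  · have := div_mul_le_mul_rate (K := 30 * D) (by positivity) ha0 r1
    rw [mul_assoc a.a₀]
    linarith
  · have e1 : 15 * dz / (a.b₀ * (min (n : ℝ) (b : ℝ) * ε ^ 2) * ε ^ 2) ≤
        15 * c.Dz D / (a.b₀ * (min (n : ℝ) (b : ℝ) * ε ^ 2) * ε ^ 2) :=
      div_le_div_of_nonneg_right (by linarith) (by positivity)
    have := div_mul_le_mul_rate (K := 15 * c.Dz D) (by positivity) hb0 r2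
    rw [mul_assoc a.b₀] at e1 ⊢
    linarith
  · have e1 : 60 * c.rateConsts.C₁ * dα / (c.μf * n * (a.a₁ * (b * ε ^ 2)) * ε ^ 2) ≤
        60 * c.rateConsts.C₁ * (m * D) / (c.μf * n * (a.a₁ * (b * ε ^ 2)) * ε ^ 2) :=
      div_le_div_of_nonneg_right (mul_le_mul_of_nonneg_left hα (by positivity)) (by positivity)
    have e2 : 60 * c.rateConsts.C₁ * (m * D) / (c.μf * n * (a.a₁ * (b * ε ^ 2)) * ε ^ 2) =
        60 * c.rateConsts.C₁ * D / (c.μf * a.a₁ * (n * b * ε ^ 4 / m)) := by field_simp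
    have := div_mul_le_mul_rate (K := 60 * c.rateConsts.C₁ * D) (d := c.μf * a.a₁) (by positivity)
      (by positivity) r3
    linarith
  · have e1 : 30 * c.rateConsts.C₂ * dy / (n * (a.a₂ * (b * ε ^ 2)) * c.μg * ε ^ 2) ≤
        30 * c.rateConsts.C₂ * (m * D) / (n * (a.a₂ * (b * ε ^ 2)) * c.μg * ε ^ 2) :=
      div_le_div_of_nonneg_right (mul_le_mul_of_nonneg_left hy (by positivity)) (by positivity)
    have e2 : 30 * c.rateConsts.C₂ * (m * D) / (n * (a.a₂ * (b * ε ^ 2)) * c.μg * ε ^ 2) =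
        30 * c.rateConsts.C₂ * D / (c.μg * a.a₂ * (n * b * ε ^ 4 / m)) := by field_simp
    have := div_mul_le_mul_rate (K := 30 * c.rateConsts.C₂ * D) (d := c.μg * a.a₂) (by positivity)
      (by positivity) r3
    linarith
  · have e1 : 60 * c.rateConsts.C₃ * dg / (n * (a.b₁ * (b * ε ^ 2)) * ε ^ 2) ≤
        60 * c.rateConsts.C₃ * (m * D) / (n * (a.b₁ * (b * ε ^ 2)) * ε ^ 2) :=
      div_le_div_of_nonneg_right (mul_le_mul_of_nonneg_left hg (by positivity)) (by positivity)
    have e2 : 60 * c.rateConsts.C₃ * (m * D) / (n * (a.b₁ * (b * ε ^ 2)) * ε ^ 2) =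
        60 * c.rateConsts.C₃ * D / (a.b₁ * (n * b * ε ^ 4 / m)) := by field_simp
    have := div_mul_le_mul_rate (K := 60 * c.rateConsts.C₃ * D) (by positivity) hb1 r3
    linarith

end Orders

end MinMaxBilevel

theorem mainTheorem1 (c : MinMaxBilevel.Consts) (hc : c.Pos) :
    ∃ C : MinMaxBilevel.RateConsts, C.Pos ∧
      -- the objective is differentiable, with `LF`-Lipschitz gradient
      (∀ (m dx dα dy : ℕ) (p : MinMaxBilevel.Problem m dx dα dy), 1 ≤ m → p.Regular c →
        Differentiable ℝ p.F ∧
        ∀ x x', ‖gradient p.F x - gradient p.F x'‖ ≤ C.LF * ‖x - x'‖) ∧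
      -- explicit conditions on the step sizes and the number of iterations
      (∀ (m dx dα dy n b : ℕ) (Ξ : Type u) (Z : Type v) (Ω : Type w)
        [MeasurableSpace Ξ] [MeasurableSpace Z] [MeasurableSpace Ω]
        (p : MinMaxBilevel.Problem m dx dα dy) (o : MinMaxBilevel.Oracles m dx dα dy b Ξ Z)
        (u₀ : MinMaxBilevel.State m dx dα dy) (k : MinMaxBilevel.Steps) (ε ΔF : ℝ) (T : ℕ)
        (μ : MeasureTheory.Measure Ω) (w : ℕ → Ω → MinMaxBilevel.Draw m b Ξ Z) (τ : Ω → ℕ),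
        1 ≤ n → n ≤ m → 1 ≤ b → 0 < ε →
        p.Regular c → o.Valid p c → u₀.Admissible p.A c →
        MinMaxBilevel.IsSampling μ o n T w τ →
        (∀ x, p.F u₀.x - p.F x ≤ ΔF) →
        k.Ok c C m n b ε →
        MinMaxBilevel.iterBound k c C n ε ΔF (MinMaxBilevel.errz μ p o k u₀ w)
          (MinMaxBilevel.errα p u₀) (MinMaxBilevel.erry p u₀) (MinMaxBilevel.errgyy p u₀) ≤ T →
        MinMaxBilevel.Guarantee μ p o k u₀ w τ ε) ∧
      -- the orders of the step sizes, of the number of iterations and of the number of samples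
      (∀ D : ℝ, 0 < D → ∃ (a : MinMaxBilevel.StepFactors) (K₁ K₂ : ℝ), 0 < K₁ ∧ 0 < K₂ ∧
        ∀ (m dx dα dy n b : ℕ) (Ξ : Type u) (Z : Type v) (Ω : Type w)
          [MeasurableSpace Ξ] [MeasurableSpace Z] [MeasurableSpace Ω]
          (p : MinMaxBilevel.Problem m dx dα dy) (o : MinMaxBilevel.Oracles m dx dα dy b Ξ Z)
          (u₀ : MinMaxBilevel.State m dx dα dy) (ε : ℝ) (T : ℕ)
          (μ : MeasureTheory.Measure Ω) (w : ℕ → Ω → MinMaxBilevel.Draw m b Ξ Z) (τ : Ω → ℕ),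
          1 ≤ n → n ≤ m → 1 ≤ b → 0 < ε → b * ε ^ 2 ≤ D →
          p.Regular c → o.Valid p c → u₀.Admissible p.A c →
          MinMaxBilevel.IsSampling μ o n T w τ →
          (∀ x, p.F u₀.x - p.F x ≤ D) → ‖u₀.z‖ ^ 2 ≤ D →
          MinMaxBilevel.errα p u₀ ≤ m * D → MinMaxBilevel.erry p u₀ ≤ m * D →
          MinMaxBilevel.errgyy p u₀ ≤ m * D →
          (a.steps m n b ε).Ok c C m n b ε ∧
          (K₁ * MinMaxBilevel.rate m n b ε ≤ T →
            MinMaxBilevel.Guarantee μ p o (a.steps m n b ε) u₀ w τ ε) ∧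
          (T = ⌈K₁ * MinMaxBilevel.rate m n b ε⌉₊ →
            ∀ᵐ ω ∂μ, (MinMaxBilevel.samplesUsed (fun t => w t ω) T : ℝ) ≤
              K₂ * max (m : ℝ) (b : ℝ) / ε ^ 4)) := by
  refine ⟨c.rateConsts, hc.rateConsts, fun m dx dα dy p hm h => ⟨h.differentiable_F hc, ?_⟩, ?_, ?_⟩
  · intro x x'
    refine (h.gradient_F_lip hc hm x x').trans
      (mul_le_mul_of_nonneg_right ?_ (norm_nonneg _))
    have := hc.Lgrad_pos
    -- `LF` is twice the Lipschitz constant found, so that `η₀ ≤ 1/(2 LF)` yields the `4 Lgrad η₀ ≤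
    -- 1` of the descent step.
    change c.Lgrad ≤ 2 * c.Lgrad
    linarith
  · intro m dx dα dy n b Ξ Z Ω _ _ _ p o u₀ k ε ΔF T μ w τ hn1 hn hb hε h hv hu hs hF hk hT
    exact hs.guarantee hc h hv hn1 hn hb hu.adm hε hF hk hT
  · intro D hD
    obtain ⟨a, ha⟩ := MinMaxBilevel.StepFactors.exists_ok hc hD
    have hK := a.iterFactor_pos hc hD
    -- In `K₂`, the term `2 K₁` counts both halves of each batch over the main iterations, and `4
    -- D²` pays for rounding up and for iteration `0`.
    refine ⟨a, a.iterFactor c D, 2 * a.iterFactor c D + 4 * D ^ 2, hK, by positivity, ?_⟩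
    intro m dx dα dy n b Ξ Z Ω _ _ _ p o u₀ ε T μ w τ hn1 hn hb hε hbD h hv hu hs hF hz hα hy hg
    have hok := ha m n b ε hn1 hn hb hε hbD
    refine ⟨hok, fun hT => ?_, fun hT => ?_⟩
    · refine hs.guarantee hc h hv hn1 hn hb hu.adm hε hF hok (le_trans ?_ hT)
      exact MinMaxBilevel.iterBound_le hc a hD hn1 hn hb hε
        (hs.errz_le hc h hv hn1 hn hb (hok.good hc hn1 hn) hu.adm hz hα hy hg) hα hy hg
    · filter_upwards [hs.samplesUsed_ae hv T] with ω hω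
      rw [hω, hT]
      exact MinMaxBilevel.samples_le hn1 hn hb hε hbD hK
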